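/- Let $T>0$, $1<\alpha\le 2$ and $N\in\mathbb N$. For $0<\theta<1$ let $H^\theta(0,T)$ be the Sobolev–Slobodeckij space of all $u\in L^2(0,T)$ with $\int_0^T\!\int_0^T |u(t)-u(s)|^2|t-s|^{-1-2\theta}\,dt\,ds<\infty$, and for $k\in\mathbb N$ let $W^{k,p}(0,T)$ and $H^k(0,T)=W^{k,2}(0,T)$ be the usual Sobolev spaces. Put $H_0(0,T)=L^2(0,T)$ and, for $0<\theta<1$, let $H_\theta(0,T)$ be $H^\theta(0,T)$ if $\theta<\frac12$, $\{u\in H^{1/2}(0,T):\int_0^T t^{-1}|u(t)|^2\,dt<\infty\}$ if $\theta=\frac12$, and $\{u\in H^\theta(0,T): u(0)=0\}$ if $\theta>\frac12$. For an integer $\ell\ge1$ let $H_\ell(0,T)=\{u\in H^\ell(0,T): \frac{d^ku}{dt^k}(0)=0,\ k=0,\dots,\ell-1\}$, and for $0\le\theta<1$ let $H_{\ell+\theta}(0,T)=\{u\in H_\ell(0,T): \frac{d^\ell u}{dt^\ell}\in H_\theta(0,T)\}$. The Caputo-type derivative $\partial_t^\alpha: H_\alpha(0,T)\to L^2(0,T)$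 is the inverse of the Riemann–Liouville integral $J^\alpha v(t)=\frac1{\Gamma(\alpha)}\int_0^t(t-s)^{\alpha-1}v(s)\,ds$, regarded as a bijection $L^2(0,T)\to H_\alpha(0,T)$. Let $a_0,a_1\in\mathbb R^N$, let $P$ be an $N\times N$ matrix function and $F$ an $\mathbb R^N$-valued function on $(0,T)$, and let $u$ be the solution of $$\partial_t^\alpha(u-a_0-ta_1)=P(t)u(t)+F(t),\quad 0<t<T,\qquad u-a_0-ta_1\in (H_\alpha(0,T))^N.$$ (i) Let $\beta>0$. If $P\in (W^{\lceil\beta\rceil,\infty}(0,T))^{N\times N}$ and $F+Pa_0+tPa_1\in (H_\beta(0,T))^N$, then $u-a_0-ta_1\in (H_{\alpha+\beta}(0,T))^N$. (ii) If $P\in (W^{1,\infty}(0,T))^{N\times N}$ and $F+Pa_0\in (H_1(0,T))^N$, then $u-a_0-ta_1\in (H_{\alpha+1}(0,T))^N$. -/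

import Mathlib

open MeasureTheory Set
open scoped ENNReal ContDiff Matrix

namespace FracODE

noncomputable section

/-- Lebesgue measure on the interval `(0, T)`. -/
abbrev vol (T : ℝ) : Measure ℝ := volume.restrict (Ioo 0 T)

/-- `w` is the `k`-th weak derivative of `u` on `(0, T)`
(functions are real functions on `ℝ` of which only the class a.e. on `(0, T)` matters). -/
def IsWeakDeriv (T : ℝ) (k : ℕ) (u w : ℝ → ℝ) : Prop :=
  LocallyIntegrableOn u (Ioo 0 T) ∧ LocallyIntegrableOn w (Ioo 0 T) ∧
    ∀ φ : ℝ → ℝ, ContDiff ℝ ∞ φ → HasCompactSupport φ → tsupport φ ⊆ Ioo 0 T →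
      ∫ t in Ioo 0 T, u t * iteratedDeriv k φ t = (-1) ^ k * ∫ t in Ioo 0 T, w t * φ t

/-- `u` belongs to the Sobolev space `W^{k,p}(0, T)`; for `p = 2` this is `H^k(0, T)`. -/
def MemSobolev (T : ℝ) (k : ℕ) (p : ℝ≥0∞) (u : ℝ → ℝ) : Prop :=
  MemLp u p (vol T) ∧ ∀ j ≤ k, ∃ w : ℝ → ℝ, MemLp w p (vol T) ∧ IsWeakDeriv T j u w

/-- `u` belongs to the Sobolev-Slobodeckij space `H^θ(0, T)`, for `0 < θ < 1`. -/
def MemSlobodeckij (T θ : ℝ) (u : ℝ → ℝ) : Prop :=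
  MemLp u 2 (vol T) ∧
    ∫⁻ t in Ioo 0 T, ∫⁻ s in Ioo 0 T,
      ENNReal.ofReal (|u t - u s| ^ 2 / |t - s| ^ (1 + 2 * θ)) < ⊤

/-- `u(0) = c`, for the representative of `u` that is continuous on `[0, T]`. -/
def HasInitialValue (T : ℝ) (u : ℝ → ℝ) (c : ℝ) : Prop :=
  ∃ g : ℝ → ℝ, ContinuousOn g (Icc 0 T) ∧ u =ᵐ[vol T] g ∧ g 0 = c

/-- `u` belongs to `H_θ(0, T)`, for `0 ≤ θ < 1`: this is `L²(0, T)` for `θ = 0` and `H^θ(0, T)` for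
`0 < θ < 1/2`, with the condition `∫ |u|² / t < ∞` for `θ = 1/2` and with `u(0) = 0` for
`1/2 < θ < 1`. -/
def MemHFrac (T θ : ℝ) (u : ℝ → ℝ) : Prop :=
  MemLp u 2 (vol T) ∧
    (0 < θ → MemSlobodeckij T θ u) ∧
    (θ = 1 / 2 → ∫⁻ t in Ioo 0 T, ENNReal.ofReal (|u t| ^ 2 / t) < ⊤) ∧
    (1 / 2 < θ → HasInitialValue T u 0)

/-- `u` belongs to `H_ℓ(0, T)`, for an integer `ℓ ≥ 0`: `u ∈ H^ℓ(0, T)` and the derivatives of `u`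
of the orders `0, …, ℓ - 1` vanish at `0`. -/
def MemHNat (T : ℝ) (ℓ : ℕ) (u : ℝ → ℝ) : Prop :=
  MemSobolev T ℓ 2 u ∧
    ∀ k < ℓ, ∃ w : ℝ → ℝ, IsWeakDeriv T k u w ∧ HasInitialValue T w 0

/-- `u` belongs to `H_γ(0, T)`, for real `γ ≥ 0`: with `γ = ℓ + θ`, `ℓ` an integer and `0 ≤ θ < 1`,
`u ∈ H_ℓ(0, T)` and the `ℓ`-th derivative of `u` is in `H_θ(0, T)`. -/
def MemH (T γ : ℝ) (u : ℝ → ℝ) : Prop :=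
  MemHNat T ⌊γ⌋₊ u ∧
    ∃ w : ℝ → ℝ, IsWeakDeriv T ⌊γ⌋₊ u w ∧ MemHFrac T (Int.fract γ) w

/-- The Riemann-Liouville fractional integral `J^γ v`, for `γ ≥ 0`. -/
def rlIntegral (γ : ℝ) (v : ℝ → ℝ) (t : ℝ) : ℝ :=
  if γ = 0 then v t else ∫ s in (0 : ℝ)..t, (t - s) ^ (γ - 1) / Real.Gamma γ * v s

/-- `∂_t^γ v = w`: here `∂_t^γ` is the inverse of `J^γ : L²(0, T) → H_γ(0, T)`, so this says that
`v ∈ H_γ(0, T)`, `w ∈ L²(0, T)` and `J^γ w = v`. -/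
def IsFracDeriv (T γ : ℝ) (v w : ℝ → ℝ) : Prop :=
  MemH T γ v ∧ MemLp w 2 (vol T) ∧ rlIntegral γ w =ᵐ[vol T] v

/-- `u` solves `∂_t^α (u - a₀ - t a₁) = P(t) u + F` on `(0, T)`, with
`u - a₀ - t a₁ ∈ (H_α(0, T))^N`. -/
def IsSolution {N : ℕ} (T α : ℝ) (P : ℝ → Matrix (Fin N) (Fin N) ℝ) (F : ℝ → Fin N → ℝ)
    (a₀ a₁ : Fin N → ℝ) (u : ℝ → Fin N → ℝ) : Prop :=
  (∀ i, MemH T α (fun t => (u t - a₀ - t • a₁) i)) ∧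
    ∀ i, IsFracDeriv T α (fun t => (u t - a₀ - t • a₁) i) (fun t => (P t *ᵥ u t + F t) i)

end

end FracODE

/-!
The proof rests on one identity: for every real `γ ≥ 0` the space `H_γ(0, T)` is exactly the range
of the Riemann-Liouville integral `J^γ` on `L²(0, T)` (`memH_iff_memRL`). Once this is known, the
equation reads `v = J^α (P v + G)` with `v = u - a₀ - t a₁` and `G = F + P a₀ + t P a₁`, and regularity
follows by bootstrapping (`memRL_of_integral_equation`): if `v` lies in the range of `J^γ` with
`γ ≤ β`, then so does `P v + G`, because multiplication by functions in `W^{⌈γ⌉,∞}` preserves this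
range (`memRL_mul`), and the semigroup law `J^α J^γ = J^(α+γ)` puts `v` into the range of
`J^(α+γ)`. Finitely many rounds reach `α + β`. The second assertion is the case `β = 1` of the first,
as `t P a₁` belongs to `H_1` whenever `P` is Lipschitz.

The integer part of the identity is elementary (`J^1` is the primitive, and a function with an
integrable weak derivative is a primitive by the lemma of du Bois-Reymond). For `0 < θ < 1` the
operator `J^θ` is conjugated by `e^(-t)` into convolution with the integrable kernel
`t₊^(θ-1) e^(-t) / Γ(θ)`, whose Fourier transform is `(1 + 2πiξ)^(-θ)` (`fourier_fker`). This yields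
the semigroup law, and together with the formula
`∫∫ |f(t) - f(s)|² |t - s|^(-1-2θ) = C ∫ |ξ|^(2θ) |𝓕 f(ξ)|²` (`gag_univ_eq`) it shows that `J^θ` maps `L²`
into `H_θ` (`memHFrac_rlIntegral`): the condition at `t = 0` is visible because the convolution
vanishes on the negative half line. Conversely, a function in `H_θ(0, T)` satisfies a Hardy inequality
`∫ |f|² t^(-2θ) < ∞` (`MemHFrac.lintegral_weight_lt_top`). Hence its extension to the line, by zero on
the left and by reflection at `T` on the right, has finite Gagliardo energy. On the Fourier side
this means that the damped integral of order `1 - θ` of the extension has a square integrable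
derivative, so `J^(1-θ) f = J^1 q` with `q ∈ L²`, and `f = J^θ q` (`exists_rlIntegral_of_memHFrac`).

Multiplication by `p` preserves `H_θ` for `0 < θ < 1` because `p` is Lipschitz, and the case of larger
order follows by induction from the product rule `p J^1 h = J^1 (p' J^1 h + p h)`.
-/

namespace FracODE

noncomputable section

open FourierTransform

/-! ### The Fourier transform on `L¹ ∩ L²` -/

/-- The Fourier transform on `L²`, defined by density, is the Fourier integral on `L¹ ∩ L²`: both
define the same tempered distribution. -/
theorem fourier_toLp_ae_eq {f : ℝ → ℂ} (hf : Integrable f) (hf2 : MemLp f 2) :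
    ((𝓕 (hf2.toLp f) : Lp ℂ 2 (volume : Measure ℝ)) : ℝ → ℂ) =ᵐ[volume] 𝓕 f := by
  have hcont : Continuous (𝓕 f) :=
    VectorFourier.fourierIntegral_continuous Real.continuous_fourierChar
      (innerSL ℝ).continuous₂ hf
  refine ae_eq_of_integral_contDiff_smul_eq
    ((Lp.memLp _).locallyIntegrable (by norm_num)) hcont.locallyIntegrable ?_
  intro φ hφ hφc
  have hφ' : ContDiff ℝ ∞ (fun x => (φ x : ℂ)) := Complex.ofRealCLM.contDiff.comp hφ
  have hφc' : HasCompactSupport (fun x => (φ x : ℂ)) := hφc.comp_left Complex.ofReal_zero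
  let s : SchwartzMap ℝ ℂ := hφc'.toSchwartzMap hφ'
  have hs : ∀ x, s x = φ x := fun x => rfl
  have h1 := Lp.fourier_toTemperedDistribution_eq (hf2.toLp f)
  have h2 := congrArg (fun D => D s) h1
  simp only [TemperedDistribution.fourier_apply, Lp.toTemperedDistribution_apply] at h2
  have h3 : ∫ x, (𝓕 s : SchwartzMap ℝ ℂ) x • (hf2.toLp f) x
      = ∫ x, (𝓕 (fun x => (φ x : ℂ))) x • f x := by
    refine integral_congr_ae ?_
    filter_upwards [hf2.coeFn_toLp] with x hx
    rw [hx, SchwartzMap.fourier_coe]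
    rfl
  have hφi : Integrable (fun x => (φ x : ℂ)) := hφ'.continuous.integrable_of_hasCompactSupport hφc'
  have h4 := VectorFourier.integral_fourierIntegral_smul_eq_flip (L := innerₗ ℝ)
    (μ := (volume : Measure ℝ)) (ν := (volume : Measure ℝ)) Real.continuous_fourierChar
    (by exact (innerSL ℝ).continuous₂) hφi hf
  have h5 : ∫ x, (𝓕 (fun x => (φ x : ℂ))) x • f x = ∫ x, (φ x : ℂ) • 𝓕 f x := by
    have : (innerₗ ℝ).flip = innerₗ ℝ := by ext; simp
    rw [this] at h4
    exact h4
  rw [h3, h5] at h2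
  simpa [hs] using h2.symm

theorem memLp_fourier {f : ℝ → ℂ} (hf : Integrable f) (hf2 : MemLp f 2) : MemLp (𝓕 f) 2 :=
  (memLp_congr_ae (fourier_toLp_ae_eq hf hf2)).1 (Lp.memLp _)

/-- Plancherel's identity for the Fourier integral on `L¹ ∩ L²`. -/
theorem integral_conj_fourier_mul_fourier {f g : ℝ → ℂ} (hf : Integrable f) (hf2 : MemLp f 2)
    (hg : Integrable g) (hg2 : MemLp g 2) :
    ∫ ξ, (starRingEnd ℂ) (𝓕 f ξ) * 𝓕 g ξ = ∫ x, (starRingEnd ℂ) (f x) * g x := by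
  have h := Lp.inner_fourier_eq (hf2.toLp f) (hg2.toLp g)
  rw [L2.inner_def, L2.inner_def] at h
  calc _ = _ := integral_congr_ae ?_
    _ = _ := h
    _ = _ := integral_congr_ae ?_
  · filter_upwards [fourier_toLp_ae_eq hf hf2, fourier_toLp_ae_eq hg hg2] with x h1 h2
    rw [h1, h2]; simp [mul_comm]
  · filter_upwards [hf2.coeFn_toLp, hg2.coeFn_toLp] with x h1 h2
    rw [h1, h2]; simp [mul_comm]

theorem eLpNorm_fourier {f : ℝ → ℂ} (hf : Integrable f) (hf2 : MemLp f 2) :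
    eLpNorm (𝓕 f) 2 = eLpNorm f 2 := by
  rw [← eLpNorm_congr_ae (fourier_toLp_ae_eq hf hf2), ← eLpNorm_congr_ae hf2.coeFn_toLp,
    ← Lp.enorm_def, ← Lp.enorm_def, ← ofReal_norm, ← ofReal_norm, Lp.norm_fourier_eq]

theorem lintegral_fourier_sq {f : ℝ → ℂ} (hf : Integrable f) (hf2 : MemLp f 2) :
    ∫⁻ ξ, ‖𝓕 f ξ‖ₑ ^ 2 = ∫⁻ x, ‖f x‖ₑ ^ 2 := by
  have h := eLpNorm_fourier hf hf2
  have h2 := congrArg (fun x => x ^ (2 : ℝ)) h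
  have e := fun k : ℝ → ℂ => eLpNorm_nnreal_pow_eq_lintegral (f := k) (μ := (volume : Measure ℝ))
    (p := 2) (by norm_num)
  simp only [NNReal.coe_ofNat, ENNReal.coe_ofNat] at e
  rw [e, e] at h2
  simpa using h2

theorem ae_eq_of_fourier_eq {f g : ℝ → ℂ} (hf : Integrable f) (hf2 : MemLp f 2)
    (hg : Integrable g) (hg2 : MemLp g 2) (h : 𝓕 f =ᵐ[volume] 𝓕 g) : f =ᵐ[volume] g := by
  have h1 : (𝓕 (hf2.toLp f) : Lp ℂ 2 (volume : Measure ℝ)) = 𝓕 (hg2.toLp g) := by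
    apply Lp.ext
    exact (fourier_toLp_ae_eq hf hf2).trans (h.trans (fourier_toLp_ae_eq hg hg2).symm)
  have h2 : hf2.toLp f = hg2.toLp g := by
    have := congrArg (fun k : Lp ℂ 2 (volume : Measure ℝ) => 𝓕⁻ k) h1
    simpa using this
  exact (MemLp.toLp_eq_toLp_iff hf2 hg2).1 h2

theorem fourierInv_toLp_ae_eq {f : ℝ → ℂ} (hf : Integrable f) (hf2 : MemLp f 2) :
    ((𝓕⁻ (hf2.toLp f) : Lp ℂ 2 (volume : Measure ℝ)) : ℝ → ℂ) =ᵐ[volume] 𝓕⁻ f := by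
  have hfn : Integrable (fun x => f (-x)) := hf.comp_neg
  have hfinv : 𝓕⁻ f = 𝓕 (fun x => f (-x)) := Real.fourierInv_eq_fourier_comp_neg f
  have hcont : Continuous (𝓕⁻ f) := by
    rw [hfinv]
    exact VectorFourier.fourierIntegral_continuous Real.continuous_fourierChar
      (innerSL ℝ).continuous₂ hfn
  refine ae_eq_of_integral_contDiff_smul_eq
    ((Lp.memLp _).locallyIntegrable (by norm_num)) hcont.locallyIntegrable ?_
  intro φ hφ hφc
  have hφ' : ContDiff ℝ ∞ (fun x => (φ x : ℂ)) := Complex.ofRealCLM.contDiff.comp hφ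
  have hφc' : HasCompactSupport (fun x => (φ x : ℂ)) := hφc.comp_left Complex.ofReal_zero
  let s : SchwartzMap ℝ ℂ := hφc'.toSchwartzMap hφ'
  have hs : ∀ x, s x = φ x := fun x => rfl
  have h2 := congrArg (fun D => D s) (Lp.fourierInv_toTemperedDistribution_eq (hf2.toLp f))
  simp only [TemperedDistribution.fourierInv_apply, Lp.toTemperedDistribution_apply] at h2
  have h3 : ∫ x, (𝓕⁻ s : SchwartzMap ℝ ℂ) x • (hf2.toLp f) x
      = ∫ x, (𝓕 (fun x => (φ x : ℂ))) x • f (-x) := by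
    rw [← integral_neg_eq_self]
    refine integral_congr_ae ?_
    filter_upwards [(Measure.measurePreserving_neg (volume : Measure ℝ)).quasiMeasurePreserving.ae
      hf2.coeFn_toLp] with x hx
    rw [hx, SchwartzMap.fourierInv_coe, Real.fourierInv_eq_fourier_neg, neg_neg]
    rfl
  have hφi : Integrable (fun x => (φ x : ℂ)) := hφ'.continuous.integrable_of_hasCompactSupport hφc'
  have h4 := VectorFourier.integral_fourierIntegral_smul_eq_flip (L := innerₗ ℝ)
    (μ := (volume : Measure ℝ)) (ν := (volume : Measure ℝ)) Real.continuous_fourierChar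
    (by exact (innerSL ℝ).continuous₂) hφi hfn
  have h5 : ∫ x, (𝓕 (fun x => (φ x : ℂ))) x • f (-x) = ∫ x, (φ x : ℂ) • 𝓕⁻ f x := by
    have : (innerₗ ℝ).flip = innerₗ ℝ := by ext; simp
    rw [this] at h4
    rw [hfinv]
    exact h4
  rw [h3, h5] at h2
  simpa [hs] using h2.symm

/-- An `L¹ ∩ L²` function with integrable Fourier transform is a.e. equal to a continuous one. -/
theorem exists_continuous_ae_eq {f : ℝ → ℂ} (hf : Integrable f) (hf2 : MemLp f 2)
    (h : Integrable (𝓕 f)) : ∃ g : ℝ → ℂ, Continuous g ∧ f =ᵐ[volume] g := by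
  refine ⟨𝓕⁻ (𝓕 f), ?_, ?_⟩
  · have : Continuous (𝓕 (𝓕 f)) := VectorFourier.fourierIntegral_continuous
      Real.continuous_fourierChar (innerSL ℝ).continuous₂ h
    have h2 : 𝓕⁻ (𝓕 f) = fun x => 𝓕 (𝓕 f) (-x) := by
      ext x; rw [Real.fourierInv_eq_fourier_neg]
    rw [h2]; fun_prop
  · have h1 := fourierInv_toLp_ae_eq h (memLp_fourier hf hf2)
    have h2 : (memLp_fourier hf hf2).toLp (𝓕 f) = 𝓕 (hf2.toLp f) := by
      apply Lp.ext
      exact (MemLp.coeFn_toLp _).trans (fourier_toLp_ae_eq hf hf2).symm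
    rw [h2] at h1
    simp only [fourierInv_fourier_eq] at h1
    exact hf2.coeFn_toLp.symm.trans h1

/-- If `(1 + 2πiξ) 𝓕 f` is square integrable then `f + f'` is an `L²` function, in the weak sense. -/
theorem exists_weakDeriv_of_fourier {f : ℝ → ℂ} (hf : Integrable f) (hf2 : MemLp f 2)
    (h : MemLp (fun ξ : ℝ => (1 + 2 * Real.pi * Complex.I * ξ) * 𝓕 f ξ) 2) :
    ∃ g : ℝ → ℂ, MemLp g 2 ∧ ∀ φ : ℝ → ℝ, ContDiff ℝ ∞ φ → HasCompactSupport φ →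
      ∫ x, (φ x : ℂ) * g x = ∫ x, ((φ x - deriv φ x : ℝ) : ℂ) * f x := by
  refine ⟨(𝓕⁻ (h.toLp _) : Lp ℂ 2 (volume : Measure ℝ)), Lp.memLp _, fun φ hφ hφc => ?_⟩
  have hφ' : ContDiff ℝ ∞ (fun x => (φ x : ℂ)) := Complex.ofRealCLM.contDiff.comp hφ
  have hφc' : HasCompactSupport (fun x => (φ x : ℂ)) := hφc.comp_left Complex.ofReal_zero
  have hd : ∀ x, deriv (fun x => (φ x : ℂ)) x = ((deriv φ x : ℝ) : ℂ) := fun x =>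
    ((hφ.differentiable (by simp) x).hasDerivAt.ofReal_comp).deriv
  have hdc : HasCompactSupport (deriv (fun x => (φ x : ℂ))) := hφc'.deriv
  have hdcont : Continuous (deriv (fun x => (φ x : ℂ))) := hφ'.continuous_deriv (by simp)
  have i1 := hφ'.continuous.integrable_of_hasCompactSupport (μ := volume) hφc'
  have i2 := hdcont.integrable_of_hasCompactSupport (μ := volume) hdc
  have m1 : MemLp (fun x => (φ x : ℂ)) 2 volume := hφ'.continuous.memLp_of_hasCompactSupport hφc'
  have m2 : MemLp (deriv (fun x => (φ x : ℂ))) 2 volume := hdcont.memLp_of_hasCompactSupport hdc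
  have key := Lp.inner_fourier_eq (m1.toLp _) (𝓕⁻ (h.toLp _) : Lp ℂ 2 (volume : Measure ℝ))
  rw [fourier_fourierInv_eq, L2.inner_def, L2.inner_def] at key
  have pl := integral_conj_fourier_mul_fourier (i1.sub i2) (m1.sub m2) hf hf2
  have hsub : ∀ ξ, 𝓕 ((fun x => (φ x : ℂ)) - deriv (fun x => (φ x : ℂ))) ξ
      = (1 - 2 * Real.pi * Complex.I * ξ) * 𝓕 (fun x => (φ x : ℂ)) ξ := by
    intro ξ
    have h1 : 𝓕 ((fun x => (φ x : ℂ)) - deriv (fun x => (φ x : ℂ))) ξ =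
        𝓕 (fun x => (φ x : ℂ)) ξ - 𝓕 (deriv (fun x => (φ x : ℂ))) ξ := by
      simp only [Real.fourier_eq, Pi.sub_apply, smul_sub]
      exact integral_sub ((Real.fourierIntegral_convergent_iff ξ).2 i1)
        ((Real.fourierIntegral_convergent_iff ξ).2 i2)
    rw [h1, Real.fourier_deriv i1 (hφ'.differentiable (by simp)) i2]
    simp only [smul_eq_mul]; ring
  calc _ = _ := integral_congr_ae ?_
    _ = _ := key.symm
    _ = _ := integral_congr_ae ?_
    _ = _ := pl
    _ = _ := integral_congr_ae ?_
  · filter_upwards [m1.coeFn_toLp] with x h1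
    rw [h1]; simp [mul_comm]
  · filter_upwards [fourier_toLp_ae_eq i1 m1, h.coeFn_toLp] with x h1 h2
    rw [h1, h2, hsub]
    have h2' : (starRingEnd ℂ) (2 : ℂ) = 2 := Complex.conj_ofNat 2
    simp [h2']; ring
  · filter_upwards with x
    simp [hd]

/-! ### Gagliardo energies -/

/-- The square of the Gagliardo seminorm of order `θ` on `S`, as an extended nonnegative real. -/
def gag {E : Type*} [NormedAddCommGroup E] (θ : ℝ) (S : Set ℝ) (f : ℝ → E) : ℝ≥0∞ :=
  ∫⁻ t in S, ∫⁻ s in S, ‖f t - f s‖ₑ ^ 2 * ‖t - s‖ₑ ^ (-(1 + 2 * θ))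

theorem gag_congr_ae {E : Type*} [NormedAddCommGroup E] {θ : ℝ} {S : Set ℝ} {f g : ℝ → E}
    (h : f =ᵐ[volume.restrict S] g) : gag θ S f = gag θ S g := by
  unfold gag
  refine lintegral_congr_ae ?_
  filter_upwards [h] with t ht
  refine lintegral_congr_ae ?_
  filter_upwards [h] with s hs
  rw [ht, hs]

theorem enorm_rpow_of_pos {x : ℝ} (hx : 0 < x) (p : ℝ) : ‖x‖ₑ ^ p = ENNReal.ofReal (x ^ p) := by
  rw [Real.enorm_eq_ofReal hx.le, ENNReal.ofReal_rpow_of_pos hx]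

theorem enorm_rpow_antitone {x y p : ℝ} (h : |x| ≤ |y|) (hp : 0 ≤ p) :
    ‖y‖ₑ ^ (-p) ≤ ‖x‖ₑ ^ (-p) := by
  rw [ENNReal.rpow_neg, ENNReal.rpow_neg, ENNReal.inv_le_inv]
  refine ENNReal.rpow_le_rpow ?_ hp
  rw [Real.enorm_eq_ofReal_abs, Real.enorm_eq_ofReal_abs]
  exact ENNReal.ofReal_le_ofReal h

theorem lintegral_Ioi_enorm_rpow {θ t : ℝ} (hθ : 0 < θ) (ht : 0 < t) :
    ∫⁻ x in Ioi t, ‖x‖ₑ ^ (-(1 + 2 * θ)) = ENNReal.ofReal (1 / (2 * θ)) * ‖t‖ₑ ^ (-(2 * θ)) := by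
  have h1 : ∫⁻ x in Ioi t, ‖x‖ₑ ^ (-(1 + 2 * θ))
      = ∫⁻ x in Ioi t, ENNReal.ofReal (x ^ (-(1 + 2 * θ))) :=
    setLIntegral_congr_fun measurableSet_Ioi fun x hx => enorm_rpow_of_pos (ht.trans hx) _
  rw [h1, ← ofReal_integral_eq_lintegral_ofReal, integral_Ioi_rpow_of_lt (by linarith) ht,
    enorm_rpow_of_pos ht, ← ENNReal.ofReal_mul (by positivity)]
  · congr 1
    have : -(1 + 2 * θ) + 1 = -(2 * θ) := by ring
    rw [this]; field_simp
  · exact integrableOn_Ioi_rpow_of_lt (by linarith) ht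
  · filter_upwards [ae_restrict_mem measurableSet_Ioi] with x hx
    exact Real.rpow_nonneg (ht.trans hx).le _

theorem lintegral_Iio_kernel {θ t : ℝ} (hθ : 0 < θ) (ht : 0 < t) :
    ∫⁻ s in Iio 0, ‖t - s‖ₑ ^ (-(1 + 2 * θ))
      = ENNReal.ofReal (1 / (2 * θ)) * ‖t‖ₑ ^ (-(2 * θ)) := by
  rw [← lintegral_Ioi_enorm_rpow hθ ht, ← lintegral_indicator measurableSet_Iio,
    ← lintegral_indicator measurableSet_Ioi,
    ← lintegral_sub_left_eq_self ((Ioi t).indicator fun x => ‖x‖ₑ ^ (-(1 + 2 * θ))) t]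
  refine lintegral_congr fun s => ?_
  by_cases hs : s < 0
  · rw [indicator_of_mem (by exact hs), indicator_of_mem (by rw [mem_Ioi]; linarith)]
  · rw [indicator_of_notMem (by exact hs), indicator_of_notMem (by rw [mem_Ioi]; linarith)]

theorem lintegral_even {f : ℝ → ℝ≥0∞} (hf : ∀ x, f (-x) = f x) :
    ∫⁻ x, f x = 2 * ∫⁻ x in Ioi 0, f x := by
  have h1 : ∫⁻ x in Iio 0, f x = ∫⁻ x in Ioi 0, f x := by
    rw [← lintegral_indicator measurableSet_Iio, ← lintegral_indicator measurableSet_Ioi,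
      ← lintegral_neg_eq_self]
    refine lintegral_congr fun s => ?_
    by_cases hs : 0 < s
    · rw [indicator_of_mem (by simpa using hs), indicator_of_mem (by exact hs), hf]
    · rw [indicator_of_notMem (by simpa using hs), indicator_of_notMem (by exact hs)]
  rw [← lintegral_add_compl f (measurableSet_Iic (a := (0:ℝ))), compl_Iic,
    setLIntegral_congr Iio_ae_eq_Iic.symm, h1, two_mul]

theorem lintegral_eq_enorm_mul_lintegral_comp {a : ℝ} (ha : a ≠ 0) (f : ℝ → ℝ≥0∞) (hf : Measurable f) :
    ∫⁻ x, f x = ‖a‖ₑ * ∫⁻ x, f (a * x) := by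
  conv_lhs => rw [← Real.smul_map_volume_mul_left ha]
  rw [lintegral_smul_measure, lintegral_map hf (by fun_prop), Real.enorm_eq_ofReal_abs]
  rfl

/-- The constant relating the Gagliardo energy on the line to the Fourier side. -/
def gagConst (θ : ℝ) : ℝ≥0∞ :=
  ∫⁻ x : ℝ, ‖(1 : ℂ) - Complex.exp ((2 * Real.pi * x : ℝ) * Complex.I)‖ₑ ^ 2 *
    ‖x‖ₑ ^ (-(1 + 2 * θ))

theorem gagConst_ne_top {θ : ℝ} (hθ : 0 < θ) (hθ1 : θ < 1) : gagConst θ ≠ ⊤ := by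
  unfold gagConst
  rw [lintegral_even]
  swap
  · intro x
    rw [enorm_neg]
    congr 2
    rw [← enorm_norm, ← enorm_norm (1 - _)]
    congr 1
    have : (1 : ℂ) - Complex.exp ((2 * Real.pi * -x : ℝ) * Complex.I)
      = (starRingEnd ℂ) (1 - Complex.exp ((2 * Real.pi * x : ℝ) * Complex.I)) := by
      rw [map_sub, ← Complex.exp_conj]; simp [Complex.conj_ofNat]
    rw [this, Complex.norm_conj]
  refine ENNReal.mul_ne_top (by norm_num) (ne_of_lt ?_)
  have hb : ∀ x : ℝ, ‖(1 : ℂ) - Complex.exp ((2 * Real.pi * x : ℝ) * Complex.I)‖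
      ≤ 2 * Real.pi * |x| := by
    intro x
    rw [norm_sub_rev]
    have := Real.norm_exp_I_mul_ofReal_sub_one_le (x := 2 * Real.pi * x)
    rw [mul_comm Complex.I] at this
    refine this.trans ?_
    rw [Real.norm_eq_abs, abs_mul, abs_of_pos Real.two_pi_pos]
  have hb2 : ∀ x : ℝ, ‖(1 : ℂ) - Complex.exp ((2 * Real.pi * x : ℝ) * Complex.I)‖ ≤ 2 := by
    intro x
    refine (norm_sub_le _ _).trans ?_
    rw [Complex.norm_exp_ofReal_mul_I, norm_one]; norm_num
  have hU : Ioi (0:ℝ) = Ioc 0 1 ∪ Ioi 1 := by rw [Ioc_union_Ioi_eq_Ioi (by norm_num)]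
  rw [hU]
  refine (lintegral_union_le _ _ _).trans_lt (ENNReal.add_lt_top.2 ⟨?_, ?_⟩)
  · calc _ ≤ ∫⁻ x in Ioc (0:ℝ) 1, ENNReal.ofReal ((2 * Real.pi) ^ 2 * x ^ (1 - 2 * θ)) := by
          refine setLIntegral_mono' measurableSet_Ioc fun x hx => ?_
          rw [enorm_rpow_of_pos hx.1, ← ofReal_norm, ← ENNReal.ofReal_pow (norm_nonneg _),
            ← ENNReal.ofReal_mul (by positivity)]
          refine ENNReal.ofReal_le_ofReal ?_
          have h1 : x ^ (1 - 2 * θ) = x ^ 2 * x ^ (-(1 + 2 * θ)) := by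
            rw [← Real.rpow_natCast, ← Real.rpow_add hx.1]; congr 1; push_cast; ring
          rw [h1, ← mul_assoc, ← mul_pow]
          have := Real.rpow_nonneg hx.1.le (-(1 + 2 * θ))
          have h2 := hb x
          rw [abs_of_pos hx.1] at h2
          gcongr
      _ < ⊤ := by
          have : IntegrableOn (fun x : ℝ => (2 * Real.pi) ^ 2 * x ^ (1 - 2 * θ)) (Ioc 0 1) := by
            refine Integrable.const_mul ?_ _
            have := intervalIntegral.intervalIntegrable_rpow' (a := 0) (b := 1)
              (r := 1 - 2 * θ) (by linarith)
            rwa [intervalIntegrable_iff_integrableOn_Ioc_of_le zero_le_one] at this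
          exact this.lintegral_lt_top
  · calc _ ≤ ∫⁻ x in Ioi (1:ℝ), ENNReal.ofReal 4 * ‖x‖ₑ ^ (-(1 + 2 * θ)) := by
          refine lintegral_mono fun x => ?_
          rw [← ofReal_norm (1 - Complex.exp _), ← ENNReal.ofReal_pow (norm_nonneg _)]
          gcongr
          nlinarith [hb2 x, norm_nonneg ((1 : ℂ) - Complex.exp ((2 * Real.pi * x : ℝ) * Complex.I))]
      _ < ⊤ := by
          rw [lintegral_const_mul _ (by fun_prop), lintegral_Ioi_enorm_rpow hθ one_pos]
          simp [ENNReal.mul_lt_top]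

theorem gagConst_ne_zero (θ : ℝ) : gagConst θ ≠ 0 := by
  unfold gagConst
  intro h
  rw [lintegral_eq_zero_iff (by fun_prop)] at h
  have h2 : ∀ᵐ x ∂(volume.restrict (Ioo (0:ℝ) 1)), False := by
    filter_upwards [ae_restrict_of_ae h, ae_restrict_mem measurableSet_Ioo] with x hx hx1
    simp only [Pi.zero_apply, mul_eq_zero, ne_eq, OfNat.ofNat_ne_zero, not_false_eq_true,
      pow_eq_zero_iff, enorm_eq_zero, ENNReal.rpow_eq_zero_iff, enorm_ne_top, false_and,
      or_false, Complex.ofReal_mul] at hx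
    rcases hx with hx | hx
    · have h3 := Complex.exp_eq_one_iff.1 (sub_eq_zero.1 hx).symm
      obtain ⟨n, hn⟩ := h3
      have h4 : x = n := by
        have := congrArg Complex.im hn
        simp at this
        have hp := Real.pi_pos
        nlinarith
      rw [h4] at hx1
      have a1 : (0:ℤ) < n := by exact_mod_cast hx1.1
      have a2 : n < (1:ℤ) := by exact_mod_cast hx1.2
      omega
    · exact hx1.1.ne' hx.1
  rw [ae_iff] at h2
  simp at h2

/-- The Fourier multiplier of the Gagliardo energy is homogeneous of degree `2θ`. -/
theorem lintegral_phase {θ : ℝ} (hθ : 0 < θ) (ξ : ℝ) :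
    ∫⁻ h : ℝ, ‖(1 : ℂ) - Complex.exp ((2 * Real.pi * (ξ * h) : ℝ) * Complex.I)‖ₑ ^ 2 *
      ‖h‖ₑ ^ (-(1 + 2 * θ)) = ‖ξ‖ₑ ^ (2 * θ) * gagConst θ := by
  rcases eq_or_ne ξ 0 with rfl | hξ
  · simp [hθ]
  · unfold gagConst
    rw [lintegral_eq_enorm_mul_lintegral_comp hξ (fun x : ℝ => ‖(1 : ℂ) - Complex.exp ((2 * Real.pi * x : ℝ) *
      Complex.I)‖ₑ ^ 2 * ‖x‖ₑ ^ (-(1 + 2 * θ))) (by fun_prop), ← mul_assoc,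
      ← lintegral_const_mul _ (by fun_prop)]
    refine lintegral_congr fun h => ?_
    have h0 : ‖ξ‖ₑ ≠ 0 := by simpa using hξ
    rw [enorm_mul, ENNReal.mul_rpow_of_ne_top enorm_ne_top enorm_ne_top]
    have : ‖ξ‖ₑ ^ (2 * θ) * ‖ξ‖ₑ * ‖ξ‖ₑ ^ (-(1 + 2 * θ)) = 1 := by
      nth_rw 2 [← ENNReal.rpow_one ‖ξ‖ₑ]
      rw [← ENNReal.rpow_add _ _ h0 enorm_ne_top, ← ENNReal.rpow_add _ _ h0 enorm_ne_top]
      ring_nf; simp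
    calc _ = 1 * (‖(1 : ℂ) - Complex.exp ((2 * Real.pi * (ξ * h) : ℝ) * Complex.I)‖ₑ ^ 2 *
      ‖h‖ₑ ^ (-(1 + 2 * θ))) := (one_mul _).symm
      _ = _ := by rw [← this]; ring

/-- The Gagliardo energy on the line, computed on the Fourier side. -/
theorem gag_univ_eq {θ : ℝ} (hθ : 0 < θ) {f : ℝ → ℂ} (hf : Integrable f) (hf2 : MemLp f 2) :
    gag θ univ f = gagConst θ * ∫⁻ ξ, ‖ξ‖ₑ ^ (2 * θ) * ‖𝓕 f ξ‖ₑ ^ 2 := by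
  wlog hm : StronglyMeasurable f generalizing f
  · obtain ⟨g, hg, e⟩ := hf.aestronglyMeasurable
    have e2 : 𝓕 f = 𝓕 g := funext fun ξ => Real.fourier_congr_ae e ξ
    rw [gag_congr_ae (ae_restrict_of_ae e), e2]
    exact this (hf.congr e) ((memLp_congr_ae e).1 hf2) hg
  have hfm := hm.measurable
  have hcF : Continuous (𝓕 f) :=
    VectorFourier.fourierIntegral_continuous Real.continuous_fourierChar
      (innerSL ℝ).continuous₂ hf
  have step1 : gag θ univ f = ∫⁻ t : ℝ, ∫⁻ h : ℝ, ‖f t - f (t - h)‖ₑ ^ 2 *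
      ‖h‖ₑ ^ (-(1 + 2 * θ)) := by
    simp only [gag, Measure.restrict_univ]
    refine lintegral_congr fun t => ?_
    rw [← lintegral_sub_left_eq_self _ t]
    simp
  have step2 : ∀ h : ℝ, ∫⁻ t : ℝ, ‖f t - f (t - h)‖ₑ ^ 2 =
      ∫⁻ ξ : ℝ, ‖(1 : ℂ) - Complex.exp ((2 * Real.pi * (ξ * h) : ℝ) * Complex.I)‖ₑ ^ 2 *
        ‖𝓕 f ξ‖ₑ ^ 2 := by
    intro h
    have i2 : Integrable (fun t => f (t - h)) := hf.comp_sub_right h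
    have m2 : MemLp (fun t => f (t - h)) 2 :=
      hf2.comp_measurePreserving (measurePreserving_sub_right volume h)
    have := lintegral_fourier_sq (hf.sub i2) (hf2.sub m2)
    simp only [Pi.sub_apply] at this
    rw [← this]
    refine lintegral_congr fun ξ => ?_
    have e1 : 𝓕 (f - fun t => f (t - h)) ξ = 𝓕 f ξ - 𝓕 (fun t => f (t - h)) ξ := by
      simp only [Real.fourier_eq, Pi.sub_apply, smul_sub]
      exact integral_sub ((Real.fourierIntegral_convergent_iff ξ).2 hf)
        ((Real.fourierIntegral_convergent_iff ξ).2 i2)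
    have e2 : 𝓕 (fun t => f (t - h)) ξ
        = Complex.exp ((-(2 * Real.pi * (ξ * h)) : ℝ) * Complex.I) * 𝓕 f ξ := by
      simp only [Real.fourier_real_eq_integral_exp_smul]
      rw [← integral_sub_right_eq_self (fun v => Complex.exp (↑(-2 * Real.pi * v * ξ) * Complex.I) • f v) h,
        ← integral_const_mul]
      refine integral_congr_ae (.of_forall fun t => ?_)
      simp only [smul_eq_mul]
      rw [← mul_assoc, ← Complex.exp_add]
      congr 2
      push_cast; ring
    rw [e1, e2, ← mul_pow, ← enorm_mul]
    congr 1
    rw [← ofReal_norm, ← ofReal_norm]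
    congr 1
    have : 𝓕 f ξ - Complex.exp ((-(2 * Real.pi * (ξ * h)) : ℝ) * Complex.I) * 𝓕 f ξ
      = -Complex.exp ((-(2 * Real.pi * (ξ * h)) : ℝ) * Complex.I) *
        ((1 - Complex.exp ((2 * Real.pi * (ξ * h) : ℝ) * Complex.I)) * 𝓕 f ξ) := by
      rw [mul_comm (1 - _), ← sub_eq_zero]
      have : Complex.exp ((-(2 * Real.pi * (ξ * h)) : ℝ) * Complex.I) *
        Complex.exp ((2 * Real.pi * (ξ * h) : ℝ) * Complex.I) = 1 := by
        rw [← Complex.exp_add]; simp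
      linear_combination (-(𝓕 f ξ)) * this
    rw [this, norm_mul, norm_neg, Complex.norm_exp_ofReal_mul_I, one_mul]
  rw [step1, lintegral_lintegral_swap (by fun_prop)]
  have step3 : ∀ h : ℝ, ∫⁻ t : ℝ, ‖f t - f (t - h)‖ₑ ^ 2 * ‖h‖ₑ ^ (-(1 + 2 * θ)) =
      ∫⁻ ξ : ℝ, ‖(1 : ℂ) - Complex.exp ((2 * Real.pi * (ξ * h) : ℝ) * Complex.I)‖ₑ ^ 2 *
        ‖h‖ₑ ^ (-(1 + 2 * θ)) * ‖𝓕 f ξ‖ₑ ^ 2 := by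
    intro h
    rw [lintegral_mul_const _ (by fun_prop), step2, ← lintegral_mul_const _ (by fun_prop)]
    exact lintegral_congr fun ξ => by ring
  simp_rw [step3]
  rw [lintegral_lintegral_swap (by fun_prop), ← lintegral_const_mul _ (by fun_prop)]
  refine lintegral_congr fun ξ => ?_
  rw [lintegral_mul_const _ (by fun_prop), lintegral_phase hθ]
  ring

/-! ### Exponentially damped fractional integrals on the line -/

/-- The kernel `t₊^(a-1) e^(-t) / Γ(a)` of the damped fractional integral of order `a`. -/
def fker (a t : ℝ) : ℝ := if 0 < t then t ^ (a - 1) * Real.exp (-t) / Real.Gamma a else 0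

/-- The damped fractional integral on the line: convolution with `fker a`. -/
def conv (a : ℝ) (g : ℝ → ℝ) (t : ℝ) : ℝ := ∫ s, fker a (t - s) * g s

theorem fker_nonneg {a : ℝ} (ha : 0 < a) (t : ℝ) : 0 ≤ fker a t := by
  unfold fker
  split_ifs with h
  · have := Real.Gamma_pos_of_pos ha
    positivity
  · exact le_rfl

@[fun_prop]
theorem measurable_fker (a : ℝ) : Measurable (fker a) := by
  unfold fker
  exact Measurable.ite measurableSet_Ioi (by fun_prop) measurable_const

theorem fker_eq_indicator (a : ℝ) :
    fker a = (Ioi 0).indicator fun t => t ^ (a - 1) * Real.exp (-t) / Real.Gamma a := by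
  ext t
  simp only [fker, indicator, mem_Ioi]

theorem integrable_fker {a : ℝ} (ha : 0 < a) : Integrable (fker a) := by
  rw [fker_eq_indicator, integrable_indicator_iff measurableSet_Ioi]
  have : IntegrableOn (fun x => Real.exp (-x) * x ^ (a - 1) / Real.Gamma a) (Ioi 0) :=
    (Real.GammaIntegral_convergent ha).div_const (Real.Gamma a)
  refine this.congr_fun (fun x hx => ?_) measurableSet_Ioi
  ring

theorem mul_fker {a : ℝ} (ha : 0 < a) (t : ℝ) : t * fker a t = a * fker (a + 1) t := by
  unfold fker
  split_ifs with h
  · rw [Real.Gamma_add_one ha.ne', add_sub_cancel_right, Real.rpow_sub_one h.ne']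
    have := (Real.Gamma_pos_of_pos ha).ne'
    field_simp
  · simp

theorem fourier_fker_eq_setIntegral (a ξ : ℝ) :
    𝓕 (fun t => (fker a t : ℂ)) ξ = ∫ t in Ioi (0:ℝ), ((t ^ (a - 1) / Real.Gamma a : ℝ) : ℂ) *
      Complex.exp (-((1 + 2 * Real.pi * Complex.I * ξ) * t)) := by
  rw [Real.fourier_real_eq_integral_exp_smul, ← setIntegral_eq_integral_of_forall_compl_eq_zero
    (s := Ioi 0)]
  · refine setIntegral_congr_fun measurableSet_Ioi fun t ht => ?_
    have ht' : (0:ℝ) < t := ht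
    simp only [fker, if_pos ht', smul_eq_mul]
    have : Complex.exp (-((1 + 2 * Real.pi * Complex.I * ξ) * t)) =
      Complex.exp (-2 * Real.pi * t * ξ * Complex.I) * Complex.exp (-t) := by
      rw [← Complex.exp_add]; congr 1; ring
    rw [this]; push_cast
    ring
  · intro t ht
    simp [fker, show ¬ (0 < t) from ht]

theorem integrableOn_fker_integrand {a : ℝ} (ha : 0 < a) (ξ : ℝ) :
    IntegrableOn (fun t : ℝ => ((t ^ (a - 1) / Real.Gamma a : ℝ) : ℂ) *
      Complex.exp (-((1 + 2 * Real.pi * Complex.I * ξ) * t))) (Ioi 0) := by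
  have h : IntegrableOn (fun x => Real.exp (-x) * x ^ (a - 1) / Real.Gamma a) (Ioi 0) :=
    (Real.GammaIntegral_convergent ha).div_const (Real.Gamma a)
  refine Integrable.mono h (by fun_prop) ?_
  filter_upwards [ae_restrict_mem measurableSet_Ioi] with t ht
  rw [norm_mul, Complex.norm_real, Complex.norm_exp, norm_div, norm_div, norm_mul]
  simp
  exact le_of_eq (by ring)

/-- Integration by parts in the Laplace integral of `t^a`. -/
theorem fourier_fker_add_one {a : ℝ} (ha : 0 < a) (ξ : ℝ) :
    (1 + 2 * Real.pi * Complex.I * ξ) * 𝓕 (fun t => (fker (a + 1) t : ℂ)) ξ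
      = 𝓕 (fun t => (fker a t : ℂ)) ξ := by
  set r : ℂ := 1 + 2 * Real.pi * Complex.I * ξ with hr
  have hG := (Real.Gamma_pos_of_pos ha).ne'
  have hG1 := Real.Gamma_add_one ha.ne'
  have hrre : r.re = 1 := by simp [hr]
  let f : ℝ → ℂ := fun t => ((t ^ a / Real.Gamma (a + 1) : ℝ) : ℂ) * Complex.exp (-(r * t))
  have hi1 := integrableOn_fker_integrand ha ξ
  have hi2 := integrableOn_fker_integrand (add_pos ha one_pos) ξ
  have hderiv : ∀ t ∈ Ioi (0:ℝ), HasDerivAt f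
      (((t ^ (a - 1) / Real.Gamma a : ℝ) : ℂ) * Complex.exp (-(r * t)) - r *
        (((t ^ (a + 1 - 1) / Real.Gamma (a + 1) : ℝ) : ℂ) * Complex.exp (-(r * t)))) t := by
    intro t ht
    have h1 : HasDerivAt (fun t : ℝ => ((t ^ a / Real.Gamma (a + 1) : ℝ) : ℂ))
        ((a * t ^ (a - 1) / Real.Gamma (a + 1) : ℝ) : ℂ) t :=
      (((Real.hasDerivAt_rpow_const (Or.inl (ne_of_gt ht))).div_const _)).ofReal_comp
    have h2 : HasDerivAt (fun t : ℝ => Complex.exp (-(r * t))) (Complex.exp (-(r * t)) * (-(r * 1))) t :=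
      (((Complex.hasDerivAt_exp _).comp t
        (((hasDerivAt_id t).ofReal_comp.const_mul r).neg)))
    refine (h1.mul h2).congr_deriv ?_
    rw [hG1, add_sub_cancel_right]
    push_cast
    have : (Real.Gamma a : ℂ) ≠ 0 := by exact_mod_cast hG
    have : (a : ℂ) ≠ 0 := by exact_mod_cast ha.ne'
    field_simp
    ring
  have h0 : ContinuousWithinAt f (Ici 0) 0 := by
    refine ContinuousAt.continuousWithinAt ?_
    have h : ContinuousAt (fun t : ℝ => t ^ a) 0 := Real.continuousAt_rpow_const _ _ (Or.inr ha.le)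
    have h' : ContinuousAt (fun t : ℝ => ((t ^ a / Real.Gamma (a + 1) : ℝ) : ℂ)) 0 :=
      Complex.continuous_ofReal.continuousAt.comp (h.div_const _)
    exact h'.mul (by fun_prop)
  have hlim : Filter.Tendsto f Filter.atTop (nhds 0) := by
    rw [tendsto_zero_iff_norm_tendsto_zero]
    have h := (tendsto_rpow_mul_exp_neg_mul_atTop_nhds_zero a 1 one_pos).div_const
      (Real.Gamma (a + 1))
    rw [zero_div] at h
    refine h.congr' ?_
    filter_upwards [Filter.eventually_gt_atTop 0] with t ht
    have hGp := Real.Gamma_pos_of_pos (add_pos ha one_pos)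
    simp only [f]
    rw [norm_mul, Complex.norm_real, Complex.norm_exp, Real.norm_of_nonneg (by positivity)]
    simp only [Complex.neg_re, Complex.mul_re, hrre, Complex.ofReal_re, Complex.ofReal_im,
      mul_zero, sub_zero]
    rw [neg_mul]
    ring
  have key := integral_Ioi_of_hasDerivAt_of_tendsto h0 hderiv (hi1.sub (hi2.const_mul r)) hlim
  have hf0 : f 0 = 0 := by simp [f, Real.zero_rpow ha.ne']
  have e := integral_sub hi1 (hi2.const_mul r)
  rw [hf0, sub_zero] at key
  rw [fourier_fker_eq_setIntegral, fourier_fker_eq_setIntegral, ← integral_const_mul]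
  exact (sub_eq_zero.1 (e.symm.trans key)).symm

theorem integral_fker {a : ℝ} (ha : 0 < a) : ∫ t, fker a t = 1 := by
  rw [fker_eq_indicator, integral_indicator measurableSet_Ioi, integral_div]
  have h : ∫ t in Ioi (0:ℝ), t ^ (a - 1) * Real.exp (-t) = Real.Gamma a := by
    rw [Real.Gamma_eq_integral ha]
    exact integral_congr_ae (.of_forall fun t => mul_comm _ _)
  rw [h, div_self (Real.Gamma_pos_of_pos ha).ne']

theorem one_add_mem_slitPlane (ξ : ℝ) :
    (1 + 2 * Real.pi * Complex.I * ξ : ℂ) ∈ Complex.slitPlane := by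
  left; simp

theorem one_add_ne_zero (ξ : ℝ) : (1 + 2 * Real.pi * Complex.I * ξ : ℂ) ≠ 0 :=
  Complex.slitPlane_ne_zero (one_add_mem_slitPlane ξ)

/-- The damped kernel has Fourier transform `(1 + 2πiξ)^(-a)`. The product of the transform with
`(1 + 2πiξ)^a` has derivative zero, by `fourier_fker_add_one`. -/
theorem fourier_fker {a : ℝ} (ha : 0 < a) (ξ : ℝ) :
    𝓕 (fun t => (fker a t : ℂ)) ξ = (1 + 2 * Real.pi * Complex.I * ξ) ^ (-a : ℂ) := by
  have hi : Integrable (fun t => (fker a t : ℂ)) := (integrable_fker ha).ofReal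
  have hi' : Integrable (fun t => t • (fker a t : ℂ)) := by
    have h : Integrable (fun t => ((a * fker (a + 1) t : ℝ) : ℂ)) :=
      ((integrable_fker (add_pos ha one_pos)).const_mul a).ofReal
    refine h.congr (.of_forall fun t => ?_)
    simp only [← mul_fker ha]
    simp
  have hd : ∀ ξ, HasDerivAt (𝓕 (fun t => (fker a t : ℂ)))
      (-2 * Real.pi * Complex.I * a * 𝓕 (fun t => (fker (a + 1) t : ℂ)) ξ) ξ := by
    intro ξ
    have h := Real.hasDerivAt_fourier hi hi' ξ
    have e : 𝓕 (fun t : ℝ => (-2 * Real.pi * Complex.I * t) • (fker a t : ℂ)) ξ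
        = -2 * Real.pi * Complex.I * a * 𝓕 (fun t => (fker (a + 1) t : ℂ)) ξ := by
      simp only [Real.fourier_real_eq_integral_exp_smul]
      rw [← integral_const_mul]
      refine integral_congr_ae (.of_forall fun t => ?_)
      have hm : (t : ℂ) * (fker a t : ℂ) = a * (fker (a + 1) t : ℂ) := by
        exact_mod_cast mul_fker ha t
      simp only [smul_eq_mul]
      linear_combination (Complex.exp (↑(-2 * Real.pi * t * ξ) * Complex.I) *
        (-2 * Real.pi * Complex.I)) * hm
    rwa [e] at h
  have hc : ∀ ξ : ℝ, HasDerivAt (fun ξ : ℝ => (1 + 2 * Real.pi * Complex.I * ξ : ℂ) ^ (a : ℂ))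
      (a * (1 + 2 * Real.pi * Complex.I * ξ : ℂ) ^ ((a : ℂ) - 1) * (2 * Real.pi * Complex.I)) ξ := by
    intro ξ
    have h1 : HasDerivAt (fun ξ : ℝ => (1 + 2 * Real.pi * Complex.I * ξ : ℂ))
        (2 * Real.pi * Complex.I) ξ := by
      simpa using ((hasDerivAt_id ξ).ofReal_comp.const_mul (2 * Real.pi * Complex.I)).const_add 1
    exact (Complex.hasStrictDerivAt_cpow_const (one_add_mem_slitPlane ξ)).hasDerivAt.comp ξ h1
  have hconst : ∀ ξ : ℝ, 𝓕 (fun t => (fker a t : ℂ)) ξ * (1 + 2 * Real.pi * Complex.I * ξ) ^ (a : ℂ)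
      = 𝓕 (fun t => (fker a t : ℂ)) 0 * (1 + 2 * Real.pi * Complex.I * (0 : ℝ)) ^ (a : ℂ) := by
    intro ξ
    refine is_const_of_deriv_eq_zero (f := fun ξ : ℝ => 𝓕 (fun t => (fker a t : ℂ)) ξ *
      (1 + 2 * Real.pi * Complex.I * ξ) ^ (a : ℂ))
      (fun ξ => ((hd ξ).mul (hc ξ)).differentiableAt) (fun ξ => ?_) ξ 0
    refine ((hd ξ).mul (hc ξ)).deriv.trans ?_
    rw [← fourier_fker_add_one ha ξ,
      Complex.cpow_sub _ _ (one_add_ne_zero ξ), Complex.cpow_one]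
    have := one_add_ne_zero ξ
    field_simp
    ring
  have h0 : 𝓕 (fun t => (fker a t : ℂ)) 0 = 1 := by
    rw [Real.fourier_real_eq_integral_exp_smul]
    simp only [mul_zero, Complex.ofReal_zero, zero_mul, Complex.exp_zero, one_smul]
    rw [integral_complex_ofReal, integral_fker ha, Complex.ofReal_one]
  have h := hconst ξ
  rw [h0] at h
  simp only [Complex.ofReal_zero, mul_zero, add_zero, Complex.one_cpow, mul_one] at h
  rw [Complex.cpow_neg]
  exact eq_inv_of_mul_eq_one_left h

theorem lintegral_fker {a : ℝ} (ha : 0 < a) : ∫⁻ t, ‖fker a t‖ₑ = 1 := by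
  have h2 := ofReal_integral_eq_lintegral_ofReal (integrable_fker ha)
    (.of_forall (fker_nonneg ha))
  rw [integral_fker ha, ENNReal.ofReal_one] at h2
  rw [h2]
  exact lintegral_congr fun t => Real.enorm_eq_ofReal (fker_nonneg ha t)

theorem conv_eq_convolution (a : ℝ) (g : ℝ → ℝ) :
    conv a g = convolution g (fker a) (ContinuousLinearMap.mul ℝ ℝ) volume := by
  ext t
  simp [conv, convolution, mul_comm]

theorem integrable_conv {a : ℝ} (ha : 0 < a) {g : ℝ → ℝ} (hg : Integrable g) :
    Integrable (conv a g) := by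
  rw [conv_eq_convolution]
  exact hg.integrable_convolution _ (integrable_fker ha)

theorem conv_congr_ae {a : ℝ} {g h : ℝ → ℝ} (e : g =ᵐ[volume] h) : conv a g = conv a h := by
  ext t
  refine integral_congr_ae ?_
  filter_upwards [e] with s hs
  rw [hs]

theorem fourier_conv {a : ℝ} (ha : 0 < a) {g : ℝ → ℝ} (hg : Integrable g) (ξ : ℝ) :
    𝓕 (fun t => (conv a g t : ℂ)) ξ
      = (1 + 2 * Real.pi * Complex.I * ξ) ^ (-a : ℂ) * 𝓕 (fun t => (g t : ℂ)) ξ := by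
  have i1 : Integrable (fun t => (g t : ℂ)) := hg.ofReal
  have i2 : Integrable (fun t => (fker a t : ℂ)) := (integrable_fker ha).ofReal
  rw [← fourier_fker ha, mul_comm, ← Real.fourier_mul_convolution_eq i1 i2]
  refine congrArg (fun k : ℝ → ℂ => (𝓕 k : ℝ → ℂ) ξ) (funext fun t => ?_)
  simp only [conv, convolution, ContinuousLinearMap.mul_apply']
  rw [← integral_complex_ofReal]
  refine integral_congr_ae (.of_forall fun s => ?_)
  simp [mul_comm]

/-- Young's inequality for the kernel `fker a`, of integral one, by the Cauchy-Schwarz inequality. -/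
theorem lintegral_conv_sq_le {a : ℝ} (ha : 0 < a) {g : ℝ → ℝ} (hg : Measurable g) :
    ∫⁻ t, ‖conv a g t‖ₑ ^ 2 ≤ ∫⁻ t, ‖g t‖ₑ ^ 2 := by
  have key : ∀ t, ‖conv a g t‖ₑ ^ 2 ≤ ∫⁻ s, ‖fker a (t - s)‖ₑ * ‖g s‖ₑ ^ 2 := by
    intro t
    have h1 : ‖conv a g t‖ₑ ≤ ∫⁻ s, ‖fker a (t - s)‖ₑ * ‖g s‖ₑ := by
      refine (enorm_integral_le_lintegral_enorm _).trans_eq ?_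
      simp_rw [enorm_mul]
    have h2 : ∫⁻ s, ‖fker a (t - s)‖ₑ * ‖g s‖ₑ =
        ∫⁻ s, (‖fker a (t - s)‖ₑ * ‖g s‖ₑ ^ 2) ^ (1 / 2 : ℝ) * ‖fker a (t - s)‖ₑ ^ (1 / 2 : ℝ) := by
      refine lintegral_congr fun s => ?_
      rw [← ENNReal.mul_rpow_of_nonneg _ _ (by norm_num)]
      have : ‖fker a (t - s)‖ₑ * ‖g s‖ₑ ^ 2 * ‖fker a (t - s)‖ₑ
        = (‖fker a (t - s)‖ₑ * ‖g s‖ₑ) ^ (2 : ℝ) := by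
        rw [ENNReal.rpow_two]; ring
      rw [this, ← ENNReal.rpow_mul]; norm_num
    have h3 := ENNReal.lintegral_mul_norm_pow_le (μ := volume)
      (f := fun s => ‖fker a (t - s)‖ₑ * ‖g s‖ₑ ^ 2)
      (g := fun s => ‖fker a (t - s)‖ₑ) (by fun_prop) (by fun_prop) (p := 1 / 2) (q := 1 / 2)
      (by norm_num) (by norm_num) (by norm_num)
    rw [lintegral_sub_left_eq_self (fun s => ‖fker a s‖ₑ) t, lintegral_fker ha,
      ENNReal.one_rpow, mul_one, ← h2] at h3
    calc _ ≤ ((∫⁻ s, ‖fker a (t - s)‖ₑ * ‖g s‖ₑ ^ 2) ^ (1 / 2 : ℝ)) ^ 2 := by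
          gcongr; exact h1.trans h3
      _ = _ := by rw [← ENNReal.rpow_two, ← ENNReal.rpow_mul]; norm_num
  calc _ ≤ ∫⁻ t, ∫⁻ s, ‖fker a (t - s)‖ₑ * ‖g s‖ₑ ^ 2 := lintegral_mono key
    _ = ∫⁻ s, ∫⁻ t, ‖fker a (t - s)‖ₑ * ‖g s‖ₑ ^ 2 :=
      lintegral_lintegral_swap (by fun_prop)
    _ = _ := by
      refine lintegral_congr fun s => ?_
      rw [lintegral_mul_const _ (by fun_prop), lintegral_sub_right_eq_self (fun t => ‖fker a t‖ₑ),
        lintegral_fker ha, one_mul]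

theorem memLp_two_iff {E : Type*} [NormedAddCommGroup E] {μ : Measure ℝ} {f : ℝ → E} :
    MemLp f 2 μ ↔ AEStronglyMeasurable f μ ∧ ∫⁻ t, ‖f t‖ₑ ^ 2 ∂μ < ⊤ := by
  refine and_congr_right fun _ => ?_
  rw [eLpNorm_lt_top_iff_lintegral_rpow_enorm_lt_top (by norm_num) (by norm_num)]
  simp

theorem memLp_conv {a : ℝ} (ha : 0 < a) {g : ℝ → ℝ} (hg : Integrable g) (hg2 : MemLp g 2) :
    MemLp (conv a g) 2 := by
  rw [memLp_two_iff]
  refine ⟨(integrable_conv ha hg).1, ?_⟩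
  obtain ⟨k, hk, e⟩ := hg.aestronglyMeasurable
  rw [conv_congr_ae e]
  refine (lintegral_conv_sq_le ha hk.measurable).trans_lt ?_
  exact (memLp_two_iff.1 ((memLp_congr_ae e).1 hg2)).2

theorem ae_eq_of_ofReal_ae_eq {f g : ℝ → ℝ} {μ : Measure ℝ}
    (h : (fun t => (f t : ℂ)) =ᵐ[μ] fun t => (g t : ℂ)) : f =ᵐ[μ] g := by
  filter_upwards [h] with t ht
  exact_mod_cast ht

/-- Exponents add under composition since the multipliers are powers of `1 + 2πiξ`. -/
theorem conv_conv {a b : ℝ} (ha : 0 < a) (hb : 0 < b) {g : ℝ → ℝ} (hg : Integrable g)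
    (hg2 : MemLp g 2) : conv a (conv b g) =ᵐ[volume] conv (a + b) g := by
  have i1 := integrable_conv hb hg
  have m1 := memLp_conv hb hg hg2
  refine ae_eq_of_ofReal_ae_eq (ae_eq_of_fourier_eq (integrable_conv ha i1).ofReal
    (memLp_conv ha i1 m1).ofReal (integrable_conv (add_pos ha hb) hg).ofReal
    (memLp_conv (add_pos ha hb) hg hg2).ofReal (.of_forall fun ξ => ?_))
  rw [fourier_conv ha i1, fourier_conv hb hg, fourier_conv (add_pos ha hb) hg, ← mul_assoc,
    ← Complex.cpow_add _ _ (one_add_ne_zero ξ)]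
  congr 2
  push_cast; ring

theorem conv_eq_zero_of_nonpos (a : ℝ) {g : ℝ → ℝ} (hg : ∀ t ≤ 0, g t = 0) {t : ℝ} (ht : t ≤ 0) :
    conv a g t = 0 := by
  unfold conv
  rw [← integral_zero ℝ ℝ]
  refine integral_congr_ae (.of_forall fun s => ?_)
  rcases le_or_gt s 0 with hs | hs
  · simp [hg s hs]
  · simp [fker, show ¬ (0 < t - s) by linarith]

/-- The damped fractional integral is causal. -/
theorem conv_congr_of_le (a : ℝ) {g h : ℝ → ℝ} {T : ℝ} (e : ∀ t < T, g t = h t) {t : ℝ}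
    (ht : t ≤ T) : conv a g t = conv a h t := by
  refine integral_congr_ae (.of_forall fun s => ?_)
  rcases lt_or_ge s t with hs | hs
  · simp only [e s (by linarith)]
  · simp [fker, show ¬ (0 < t - s) by linarith]

/-- The function `e^(-t) g(t)` on `(0, T)`, extended by zero. -/
def tilt (T : ℝ) (g : ℝ → ℝ) : ℝ → ℝ := (Ioo 0 T).indicator fun t => Real.exp (-t) * g t

theorem tilt_of_nonpos (T : ℝ) (g : ℝ → ℝ) {t : ℝ} (ht : t ≤ 0) : tilt T g t = 0 :=
  indicator_of_notMem (fun h => absurd h.1 (not_lt.2 ht)) _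

theorem exp_mul_memLp {T : ℝ} {p : ℝ≥0∞} {g : ℝ → ℝ} (c : ℝ) (hg : MemLp g p (vol T)) :
    MemLp (fun t => Real.exp (c * t) * g t) p (vol T) := by
  refine MemLp.mono (g := fun t => Real.exp (|c| * T) * g t) (hg.const_mul _)
    ((by fun_prop : Continuous fun t => Real.exp (c * t)).aestronglyMeasurable.mul hg.1) ?_
  filter_upwards [ae_restrict_mem measurableSet_Ioo] with t ht
  rw [norm_mul, norm_mul]
  refine mul_le_mul_of_nonneg_right ?_ (norm_nonneg _)
  rw [Real.norm_eq_abs, Real.norm_eq_abs, Real.abs_exp, Real.abs_exp]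
  exact Real.exp_le_exp.2 (mul_le_mul (le_abs_self c) ht.2.le ht.1.le (abs_nonneg c))

theorem memLp_tilt {T : ℝ} {g : ℝ → ℝ} (hg : MemLp g 2 (vol T)) : MemLp (tilt T g) 2 := by
  unfold tilt
  rw [memLp_indicator_iff_restrict measurableSet_Ioo]
  simpa using exp_mul_memLp (-1) hg

theorem integrable_of_memLp {T : ℝ} {g : ℝ → ℝ} (hg : MemLp g 2 (vol T)) :
    Integrable g (vol T) := hg.integrable (by norm_num)

theorem integrable_tilt {T : ℝ} {g : ℝ → ℝ} (hg : MemLp g 2 (vol T)) : Integrable (tilt T g) := by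
  unfold tilt
  rw [integrable_indicator_iff measurableSet_Ioo]
  have := exp_mul_memLp (-1) hg
  simp only [neg_mul, one_mul] at this
  exact integrable_of_memLp this

/-- On `(0, T)` the Riemann-Liouville integral is conjugate to the damped fractional integral. -/
theorem rlIntegral_eq_conv {T a : ℝ} (ha : a ≠ 0) (g : ℝ → ℝ) {t : ℝ} (ht : t ∈ Ioo 0 T) :
    rlIntegral a g t = Real.exp t * conv a (tilt T g) t := by
  unfold rlIntegral conv
  rw [if_neg ha, intervalIntegral.integral_of_le ht.1.le, integral_Ioc_eq_integral_Ioo,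
    ← integral_indicator measurableSet_Ioo, ← integral_const_mul]
  refine integral_congr_ae (.of_forall fun s => ?_)
  by_cases hs : s ∈ Ioo 0 t
  · have hsT : s ∈ Ioo 0 T := ⟨hs.1, hs.2.trans ht.2⟩
    simp only [tilt]
    rw [indicator_of_mem hs, indicator_of_mem hsT, fker, if_pos (by linarith [hs.2])]
    have : Real.exp t * (Real.exp (-(t - s)) * Real.exp (-s)) = 1 := by
      rw [← Real.exp_add, ← Real.exp_add, ← Real.exp_zero]; congr 1; ring
    linear_combination (-((t - s) ^ (a - 1) / Real.Gamma a * g s)) * this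
  · rw [indicator_of_notMem hs]
    rcases le_or_gt s 0 with h | h
    · simp [tilt_of_nonpos T g h]
    · have : ¬ (0 < t - s) := fun h2 => hs ⟨h, by linarith⟩
      simp [fker, this]

theorem rlIntegral_zero (g : ℝ → ℝ) : rlIntegral 0 g = g := by ext; simp [rlIntegral]

theorem tilt_congr_ae {T : ℝ} {g h : ℝ → ℝ} (e : g =ᵐ[vol T] h) : tilt T g =ᵐ[volume] tilt T h := by
  rw [Filter.EventuallyEq, ae_restrict_iff' measurableSet_Ioo] at e
  filter_upwards [e] with t ht
  by_cases h : t ∈ Ioo 0 T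
  · simp only [tilt, indicator_of_mem h, ht h]
  · simp only [tilt, indicator_of_notMem h]

theorem rlIntegral_congr_ae {T a : ℝ} {g h : ℝ → ℝ} (e : g =ᵐ[vol T] h) :
    rlIntegral a g =ᵐ[vol T] rlIntegral a h := by
  rcases eq_or_ne a 0 with rfl | ha
  · simpa [rlIntegral_zero] using e
  · filter_upwards [ae_restrict_mem measurableSet_Ioo] with t ht
    rw [rlIntegral_eq_conv ha g ht, rlIntegral_eq_conv ha h ht, conv_congr_ae (tilt_congr_ae e)]

theorem memLp_rlIntegral {T a : ℝ} (ha : 0 ≤ a) {g : ℝ → ℝ} (hg : MemLp g 2 (vol T)) :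
    MemLp (rlIntegral a g) 2 (vol T) := by
  rcases ha.eq_or_lt with rfl | ha
  · rwa [rlIntegral_zero]
  · have h1 := exp_mul_memLp 1 ((memLp_conv ha (integrable_tilt hg) (memLp_tilt hg)).restrict
      (Ioo 0 T))
    refine (memLp_congr_ae ?_).1 h1
    filter_upwards [ae_restrict_mem measurableSet_Ioo] with t ht
    rw [rlIntegral_eq_conv ha.ne' g ht, one_mul]

/-- The semigroup property of Riemann-Liouville integrals. -/
theorem rlIntegral_rlIntegral {T a b : ℝ} (ha : 0 ≤ a) (hb : 0 ≤ b) {g : ℝ → ℝ}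
    (hg : MemLp g 2 (vol T)) :
    rlIntegral a (rlIntegral b g) =ᵐ[vol T] rlIntegral (a + b) g := by
  rcases ha.eq_or_lt with rfl | ha
  · simp [rlIntegral_zero]
  rcases hb.eq_or_lt with rfl | hb
  · simp [rlIntegral_zero]
  filter_upwards [ae_restrict_mem measurableSet_Ioo,
    ae_restrict_of_ae (conv_conv ha hb (integrable_tilt hg) (memLp_tilt hg))] with t ht h
  rw [rlIntegral_eq_conv ha.ne' _ ht, rlIntegral_eq_conv (add_pos ha hb).ne' g ht, ← h]
  congr 1
  refine conv_congr_of_le a (T := T) (fun s hs => ?_) ht.2.le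
  rcases le_or_gt s 0 with h0 | h0
  · rw [tilt_of_nonpos T _ h0, conv_eq_zero_of_nonpos b (fun t ht => tilt_of_nonpos T g ht) h0]
  · have hs' : s ∈ Ioo 0 T := ⟨h0, hs⟩
    rw [tilt, indicator_of_mem hs', rlIntegral_eq_conv hb.ne' g hs', ← mul_assoc, ← Real.exp_add]
    simp

/-! ### Fractional integrals belong to the fractional spaces -/

theorem memSlobodeckij_iff {T θ : ℝ} {u : ℝ → ℝ} :
    MemSlobodeckij T θ u ↔ MemLp u 2 (vol T) ∧ gag θ (Ioo 0 T) u < ⊤ := by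
  unfold MemSlobodeckij gag
  have : ∀ t s : ℝ, ENNReal.ofReal (|u t - u s| ^ 2 / |t - s| ^ (1 + 2 * θ))
      = ‖u t - u s‖ₑ ^ 2 * ‖t - s‖ₑ ^ (-(1 + 2 * θ)) := by
    intro t s
    rcases eq_or_ne t s with rfl | h
    · simp
    · have h' : 0 < |t - s| := abs_pos.2 (sub_ne_zero.2 h)
      rw [← enorm_norm (t - s), Real.norm_eq_abs, enorm_rpow_of_pos h', Real.enorm_eq_ofReal_abs,
        ← ENNReal.ofReal_pow (abs_nonneg _), ← ENNReal.ofReal_mul (by positivity),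
        Real.rpow_neg h'.le]
      rfl
  simp_rw [this]

theorem integrable_ofReal {f : ℝ → ℝ} (h : Integrable f) : Integrable (fun t => (f t : ℂ)) :=
  h.ofReal

theorem memLp_ofReal {f : ℝ → ℝ} (h : MemLp f 2) : MemLp (fun t => (f t : ℂ)) 2 := h.ofReal

theorem gag_ofReal (θ : ℝ) (S : Set ℝ) (f : ℝ → ℝ) :
    gag θ S (fun t => (f t : ℂ)) = gag θ S f := by
  unfold gag
  refine lintegral_congr fun t => lintegral_congr fun s => ?_
  rw [← Complex.ofReal_sub, ← enorm_norm (_ : ℂ), Complex.norm_real, enorm_norm]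

theorem gag_mono_set {E : Type*} [NormedAddCommGroup E] {θ : ℝ} {S S' : Set ℝ} (h : S ⊆ S')
    (f : ℝ → E) : gag θ S f ≤ gag θ S' f :=
  (lintegral_mono_set h).trans (lintegral_mono fun _ => lintegral_mono_set h)

theorem abs_le_norm_one_add (ξ : ℝ) : |ξ| ≤ ‖(1 + 2 * Real.pi * Complex.I * ξ : ℂ)‖ := by
  have h := Complex.abs_im_le_norm (1 + 2 * Real.pi * Complex.I * ξ : ℂ)
  have h2 : (1 + 2 * Real.pi * Complex.I * ξ : ℂ).im = 2 * Real.pi * ξ := by simp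
  rw [h2, abs_mul, abs_of_pos Real.two_pi_pos] at h
  refine le_trans ?_ h
  nlinarith [abs_nonneg ξ, Real.pi_gt_three]

theorem norm_cpow_ofReal_neg (z : ℂ) (a : ℝ) : ‖z ^ (-a : ℂ)‖ = ‖z‖ ^ (-a) := by
  rw [← Complex.ofReal_neg, Complex.norm_cpow_real]

/-- The multiplier `|ξ|^θ (1 + 2πiξ)^(-θ)` is bounded, so damped fractional integrals of order `θ`
of `L²` functions have finite Gagliardo energy on the line. -/
theorem gag_conv_lt_top {θ : ℝ} (hθ : 0 < θ) (hθ1 : θ < 1) {g : ℝ → ℝ} (hg : Integrable g)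
    (hg2 : MemLp g 2) : gag θ univ (conv θ g) < ⊤ := by
  rw [← gag_ofReal, gag_univ_eq hθ (integrable_ofReal (integrable_conv hθ hg))
    (memLp_ofReal (memLp_conv hθ hg hg2))]
  refine ENNReal.mul_lt_top (gagConst_ne_top hθ hθ1).lt_top ?_
  have h := (memLp_two_iff.1 (memLp_fourier (integrable_ofReal hg) (memLp_ofReal hg2))).2
  refine (lintegral_mono fun ξ => ?_).trans_lt h
  rw [fourier_conv hθ hg, enorm_mul, mul_pow, ← mul_assoc]
  refine mul_le_of_le_one_left zero_le ?_
  have hpos : 0 < ‖(1 + 2 * Real.pi * Complex.I * ξ : ℂ)‖ := norm_pos_iff.2 (one_add_ne_zero ξ)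
  rw [← ofReal_norm (_ ^ (-θ : ℂ)), norm_cpow_ofReal_neg, Real.enorm_eq_ofReal_abs,
    ENNReal.ofReal_rpow_of_nonneg (abs_nonneg _) (by linarith),
    ← ENNReal.ofReal_pow (by positivity), ← ENNReal.ofReal_mul (by positivity),
    ENNReal.ofReal_le_one, ← Real.rpow_natCast, ← Real.rpow_mul hpos.le]
  calc |ξ| ^ (2 * θ) * _ ≤ ‖(1 + 2 * Real.pi * Complex.I * ξ : ℂ)‖ ^ (2 * θ) * _ :=
        mul_le_mul_of_nonneg_right (Real.rpow_le_rpow (abs_nonneg _) (abs_le_norm_one_add ξ)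
          (by linarith)) (by positivity)
    _ = 1 := by rw [← Real.rpow_add hpos]; norm_num; ring_nf; simp

/-- The part of the Gagliardo energy that pairs `(0, T)` with the negative half line, where the
function vanishes, is a weighted `L²` norm. -/
theorem lintegral_weight_lt_top {θ T : ℝ} (hθ : 0 < θ) {f : ℝ → ℝ} (hf : ∀ t < 0, f t = 0)
    (h : gag θ univ f < ⊤) : ∫⁻ t in Ioo 0 T, ‖f t‖ₑ ^ 2 * ‖t‖ₑ ^ (-(2 * θ)) < ⊤ := by
  have h1 : ENNReal.ofReal (1 / (2 * θ)) * ∫⁻ t in Ioo 0 T, ‖f t‖ₑ ^ 2 * ‖t‖ₑ ^ (-(2 * θ))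
      ≤ gag θ univ f := by
    rw [← lintegral_const_mul' _ _ ENNReal.ofReal_ne_top]
    refine le_trans ?_ (lintegral_mono_set (subset_univ (Ioo 0 T)))
    refine setLIntegral_mono' measurableSet_Ioo fun t ht => ?_
    refine le_trans ?_ (lintegral_mono_set (subset_univ (Iio 0)))
    calc _ = ‖f t‖ₑ ^ 2 * ∫⁻ s in Iio 0, ‖t - s‖ₑ ^ (-(1 + 2 * θ)) := by
          rw [lintegral_Iio_kernel hθ ht.1]; ring
      _ = ∫⁻ s in Iio 0, ‖f t‖ₑ ^ 2 * ‖t - s‖ₑ ^ (-(1 + 2 * θ)) := by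
          rw [lintegral_const_mul _ (by fun_prop)]
      _ ≤ _ := by
          refine setLIntegral_mono' measurableSet_Iio fun s hs => ?_
          rw [hf s hs, sub_zero]
  exact ENNReal.lt_top_of_mul_ne_top_right (h1.trans_lt h).ne (by simpa using hθ)

/-- For `θ > 1/2` the multiplier `(1 + 2πiξ)^(-θ)` is square integrable, so the transform of a damped
fractional integral is integrable. -/
theorem exists_continuous_ae_eq_conv {θ : ℝ} (hθ : 1 / 2 < θ) {g : ℝ → ℝ} (hg : Integrable g)
    (hg2 : MemLp g 2) (h0 : ∀ t ≤ 0, g t = 0) :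
    ∃ k : ℝ → ℝ, Continuous k ∧ conv θ g =ᵐ[volume] k ∧ k 0 = 0 := by
  have hθ0 : 0 < θ := by linarith
  have hi : Integrable (𝓕 (fun t => (conv θ g t : ℂ))) := by
    have e : 𝓕 (fun t => (conv θ g t : ℂ)) = (fun ξ : ℝ =>
        (1 + 2 * Real.pi * Complex.I * ξ : ℂ) ^ (-θ : ℂ)) * 𝓕 (fun t => (g t : ℂ)) :=
      funext fun ξ => fourier_conv hθ0 hg ξ
    rw [e]
    refine MemLp.integrable_mul (p := 2) (q := 2) ?_ (memLp_fourier (integrable_ofReal hg) (memLp_ofReal hg2))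
    have hm : Measurable (fun ξ : ℝ => (1 + 2 * Real.pi * Complex.I * ξ : ℂ) ^ (-θ : ℂ)) := by
      fun_prop
    rw [memLp_two_iff_integrable_sq_norm hm.aestronglyMeasurable]
    have hr : Integrable (fun ξ : ℝ => (1 + ‖ξ‖ ^ 2) ^ (-(2 * θ) / 2)) :=
      integrable_rpow_neg_one_add_norm_sq (by simp; linarith)
    refine hr.mono (hm.norm.pow_const 2).aestronglyMeasurable (.of_forall fun ξ => ?_)
    rw [norm_cpow_ofReal_neg, ← Real.rpow_natCast, ← Real.rpow_mul (norm_nonneg _),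
      Real.norm_of_nonneg (by positivity), Real.norm_of_nonneg (by positivity)]
    have hn : ‖(1 + 2 * Real.pi * Complex.I * ξ : ℂ)‖ ^ 2 = 1 + (2 * Real.pi * ξ) ^ 2 := by
      rw [← Complex.normSq_eq_norm_sq, Complex.normSq_apply]; simp; ring
    have e2 : -θ * (2 : ℕ) = 2 * (-θ) := by push_cast; ring
    rw [e2, Real.rpow_mul (norm_nonneg _), Real.rpow_two, hn]
    have e3 : -(2 * θ) / 2 = -θ := by ring
    rw [e3]
    refine Real.rpow_le_rpow_of_nonpos (by positivity) ?_ (by linarith)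
    rw [Real.norm_eq_abs, sq_abs]
    have h4 : 1 ≤ (2 * Real.pi) ^ 2 := by nlinarith [Real.pi_gt_three]
    rw [mul_pow]
    nlinarith [sq_nonneg ξ]
  obtain ⟨k, hk, e⟩ := exists_continuous_ae_eq (integrable_ofReal (integrable_conv hθ0 hg))
    (memLp_ofReal (memLp_conv hθ0 hg hg2)) hi
  refine ⟨fun t => (k t).re, by fun_prop, ?_, ?_⟩
  · filter_upwards [e] with t ht
    rw [← ht]; simp
  · -- `k` vanishes a.e. on the negative half line, hence everywhere on its closure
    have h1 : k =ᵐ[volume.restrict (Iio 0)] fun _ => 0 := by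
      filter_upwards [ae_restrict_of_ae e, ae_restrict_mem measurableSet_Iio] with t ht ht0
      rw [← ht, conv_eq_zero_of_nonpos θ h0 (le_of_lt ht0)]; simp
    have h2 : EqOn k (fun _ => 0) (Iio 0) :=
      Measure.eqOn_open_of_ae_eq h1 isOpen_Iio hk.continuousOn continuousOn_const
    have h3 : EqOn k (fun _ => 0) (closure (Iio 0)) :=
      h2.closure hk continuous_const
    have : k 0 = 0 := h3 (by simp)
    simp [this]

theorem lintegral_Ioo_enorm_sub_rpow_le {T p s : ℝ} (hs : s ∈ Ioo 0 T) :
    ∫⁻ t in Ioo 0 T, ‖t - s‖ₑ ^ p ≤ 2 * ∫⁻ x in Ioo 0 T, ‖x‖ₑ ^ p := by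
  have h1 : ∫⁻ t in Ioo 0 T, ‖t - s‖ₑ ^ p ≤ ∫⁻ x, (Ioo (-T) T).indicator (fun x => ‖x‖ₑ ^ p) x := by
    rw [← lintegral_indicator measurableSet_Ioo,
      ← lintegral_sub_right_eq_self ((Ioo (-T) T).indicator (fun x => ‖x‖ₑ ^ p)) s]
    refine lintegral_mono fun t => ?_
    by_cases ht : t ∈ Ioo 0 T
    · rw [indicator_of_mem ht, indicator_of_mem]
      exact ⟨by linarith [ht.1, hs.2], by linarith [ht.2, hs.1]⟩
    · rw [indicator_of_notMem ht]; exact zero_le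
  refine h1.trans_eq ?_
  rw [lintegral_even]
  · congr 1
    rw [setLIntegral_indicator measurableSet_Ioo]
    congr 2
    ext x
    simp only [mem_inter_iff, mem_Ioo, mem_Ioi]
    exact ⟨fun h => ⟨h.2, h.1.2⟩, fun h => ⟨⟨by linarith [h.1, h.2], h.2⟩, h.1⟩⟩
  · intro x
    simp only [indicator, mem_Ioo, enorm_neg]
    congr 1
    exact propext ⟨fun h => ⟨by linarith [h.2], by linarith [h.1]⟩,
      fun h => ⟨by linarith [h.2], by linarith [h.1]⟩⟩

theorem lintegral_Ioo_enorm_rpow_lt_top {T p : ℝ} (hp : -1 < p) :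
    ∫⁻ x in Ioo 0 T, ‖x‖ₑ ^ p < ⊤ := by
  rcases le_or_gt T 0 with hT | hT
  · simp [Ioo_eq_empty (not_lt.2 hT)]
  have h1 : ∫⁻ x in Ioo 0 T, ‖x‖ₑ ^ p = ∫⁻ x in Ioo 0 T, ENNReal.ofReal (x ^ p) :=
    setLIntegral_congr_fun measurableSet_Ioo fun x hx => enorm_rpow_of_pos hx.1 _
  rw [h1]
  have := intervalIntegral.intervalIntegrable_rpow' (a := 0) (b := T) hp
  rw [intervalIntegrable_iff_integrableOn_Ioo_of_le hT.le] at this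
  exact this.lintegral_lt_top

theorem enorm_add_sq_le {E : Type*} [NormedAddCommGroup E] (x y : E) :
    ‖x + y‖ₑ ^ 2 ≤ 2 * ‖x‖ₑ ^ 2 + 2 * ‖y‖ₑ ^ 2 := by
  rw [← ofReal_norm, ← ofReal_norm, ← ofReal_norm, ← ENNReal.ofReal_pow (norm_nonneg _),
    ← ENNReal.ofReal_pow (norm_nonneg _), ← ENNReal.ofReal_pow (norm_nonneg _)]
  have e : (2 : ℝ≥0∞) = ENNReal.ofReal 2 := by simp
  rw [e, ← ENNReal.ofReal_mul (by norm_num), ← ENNReal.ofReal_mul (by norm_num),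
    ← ENNReal.ofReal_add (by positivity) (by positivity)]
  refine ENNReal.ofReal_le_ofReal ?_
  nlinarith [norm_add_le x y, norm_nonneg (x + y), sq_nonneg (‖x‖ - ‖y‖)]

/-- The commutator term `(p t - p s) f s` has finite energy since `|t - s|^(1-2θ)` is integrable. -/
theorem gag_mul_lt_top {T θ : ℝ} (hθ1 : θ < 1) {f p : ℝ → ℝ} (hf : MemLp f 2 (vol T))
    (h : gag θ (Ioo 0 T) f < ⊤) {K : NNReal} (hp : LipschitzOnWith K p (Icc 0 T)) :
    gag θ (Ioo 0 T) (fun t => p t * f t) < ⊤ := by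
  wlog hm : StronglyMeasurable f generalizing f
  · obtain ⟨k, hk, e⟩ := hf.aestronglyMeasurable
    have := this ((memLp_congr_ae e).1 hf) ((gag_congr_ae e).symm ▸ h) hk
    rw [gag_congr_ae (g := fun t => p t * k t)]
    · exact this
    · filter_upwards [e] with t ht
      rw [ht]
  have hfm := hm.measurable
  obtain ⟨M, hM⟩ := isCompact_Icc.exists_bound_of_continuousOn hp.continuousOn
  have hM' : ∀ t ∈ Ioo 0 T, ‖p t‖ₑ ≤ ENNReal.ofReal M := fun t ht => by
    rw [← ofReal_norm]; exact ENNReal.ofReal_le_ofReal (hM t (Ioo_subset_Icc_self ht))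
  have key : ∀ t ∈ Ioo 0 T, ∀ s ∈ Ioo 0 T,
      ‖p t * f t - p s * f s‖ₑ ^ 2 * ‖t - s‖ₑ ^ (-(1 + 2 * θ)) ≤
      2 * ENNReal.ofReal M ^ 2 * (‖f t - f s‖ₑ ^ 2 * ‖t - s‖ₑ ^ (-(1 + 2 * θ))) +
      2 * (K : ℝ≥0∞) ^ 2 * (‖t - s‖ₑ ^ (1 - 2 * θ) * ‖f s‖ₑ ^ 2) := by
    intro t ht s hs
    rcases eq_or_ne t s with rfl | hts
    · simp
    have h0 : ‖t - s‖ₑ ≠ 0 := by simpa [sub_eq_zero] using hts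
    have e1 : p t * f t - p s * f s = p t * (f t - f s) + (p t - p s) * f s := by ring
    have e2 : ‖t - s‖ₑ ^ (1 - 2 * θ) = ‖t - s‖ₑ ^ 2 * ‖t - s‖ₑ ^ (-(1 + 2 * θ)) := by
      rw [← ENNReal.rpow_two, ← ENNReal.rpow_add _ _ h0 enorm_ne_top]; congr 1; ring
    have hL : ‖p t - p s‖ₑ ≤ K * ‖t - s‖ₑ := by
      have := hp (Ioo_subset_Icc_self ht) (Ioo_subset_Icc_self hs)
      rwa [edist_eq_enorm_sub, edist_eq_enorm_sub] at this
    rw [e1, e2]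
    calc _ ≤ (2 * ‖p t * (f t - f s)‖ₑ ^ 2 + 2 * ‖(p t - p s) * f s‖ₑ ^ 2) *
            ‖t - s‖ₑ ^ (-(1 + 2 * θ)) := by gcongr; exact enorm_add_sq_le _ _
      _ ≤ (2 * (ENNReal.ofReal M * ‖f t - f s‖ₑ) ^ 2 + 2 * (K * ‖t - s‖ₑ * ‖f s‖ₑ) ^ 2) *
            ‖t - s‖ₑ ^ (-(1 + 2 * θ)) := by
          rw [enorm_mul, enorm_mul]
          gcongr
          exact hM' t ht
      _ = _ := by ring
  have hle : gag θ (Ioo 0 T) (fun t => p t * f t) ≤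
      2 * ENNReal.ofReal M ^ 2 * gag θ (Ioo 0 T) f +
      2 * (K : ℝ≥0∞) ^ 2 * ∫⁻ t in Ioo 0 T, ∫⁻ s in Ioo 0 T,
        (‖t - s‖ₑ ^ (1 - 2 * θ) * ‖f s‖ₑ ^ 2) := by
    unfold gag
    rw [← lintegral_const_mul' _ _ (by finiteness), ← lintegral_const_mul' _ _ (by finiteness),
      ← lintegral_add_left (by fun_prop)]
    refine setLIntegral_mono' measurableSet_Ioo fun t ht => ?_
    rw [← lintegral_const_mul' _ _ (by finiteness), ← lintegral_const_mul' _ _ (by finiteness),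
      ← lintegral_add_left (by fun_prop)]
    exact setLIntegral_mono' measurableSet_Ioo fun s hs => key t ht s hs
  refine hle.trans_lt (ENNReal.add_lt_top.2 ⟨ENNReal.mul_lt_top (by finiteness) h,
    ENNReal.mul_lt_top (by finiteness) ?_⟩)
  rw [lintegral_lintegral_swap (by fun_prop)]
  calc _ ≤ ∫⁻ s in Ioo 0 T, (2 * ∫⁻ x in Ioo 0 T, ‖x‖ₑ ^ (1 - 2 * θ)) * ‖f s‖ₑ ^ 2 := by
        refine setLIntegral_mono' measurableSet_Ioo fun s hs => ?_
        rw [lintegral_mul_const _ (by fun_prop)]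
        gcongr
        exact lintegral_Ioo_enorm_sub_rpow_le hs
    _ < ⊤ := by
        rw [lintegral_const_mul _ (by fun_prop)]
        refine ENNReal.mul_lt_top (ENNReal.mul_lt_top (by norm_num)
          (lintegral_Ioo_enorm_rpow_lt_top (by linarith))) (memLp_two_iff.1 hf).2

theorem HasInitialValue.congr_ae {T c : ℝ} {u v : ℝ → ℝ} (e : u =ᵐ[vol T] v)
    (h : HasInitialValue T u c) : HasInitialValue T v c := by
  obtain ⟨g, hg, hu, h0⟩ := h
  exact ⟨g, hg, e.symm.trans hu, h0⟩

/-- The weighted integral in the definition of `H_{1/2}`, written with extended norms. -/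
theorem lintegral_weight_half_eq (T : ℝ) (u : ℝ → ℝ) :
    ∫⁻ t in Ioo 0 T, ENNReal.ofReal (|u t| ^ 2 / t)
      = ∫⁻ t in Ioo 0 T, ‖u t‖ₑ ^ 2 * ‖t‖ₑ ^ (-(2 * (1 / 2 : ℝ))) := by
  refine setLIntegral_congr_fun measurableSet_Ioo fun t ht => ?_
  have : -(2 * (1 / 2 : ℝ)) = -1 := by norm_num
  rw [this, enorm_rpow_of_pos ht.1, Real.enorm_eq_ofReal_abs, ← ENNReal.ofReal_pow (abs_nonneg _),
    ← ENNReal.ofReal_mul (by positivity), Real.rpow_neg_one]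
  rfl

theorem memHFrac_congr_ae {T θ : ℝ} {u v : ℝ → ℝ} (e : u =ᵐ[vol T] v) (h : MemHFrac T θ u) :
    MemHFrac T θ v := by
  obtain ⟨h1, h2, h3, h4⟩ := h
  refine ⟨(memLp_congr_ae e).1 h1, fun h0 => ?_, fun h0 => ?_, fun h0 => (h4 h0).congr_ae e⟩
  · have := h2 h0
    rw [memSlobodeckij_iff] at this ⊢
    rwa [← memLp_congr_ae e, ← gag_congr_ae e]
  · rw [← lintegral_congr_ae (f := fun t => ENNReal.ofReal (|u t| ^ 2 / t))]
    · exact h3 h0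
    · filter_upwards [e] with t ht
      rw [ht]

/-- Multiplication by Lipschitz functions preserves `H_θ(0, T)`, for `θ < 1`. -/
theorem memHFrac_mul {T θ : ℝ} (hθ1 : θ < 1) {f p : ℝ → ℝ} (hf : MemHFrac T θ f)
    {K : NNReal} (hp : LipschitzOnWith K p (Icc 0 T)) : MemHFrac T θ (fun t => p t * f t) := by
  obtain ⟨h1, h2, h3, h4⟩ := hf
  obtain ⟨M, hM⟩ := isCompact_Icc.exists_bound_of_continuousOn hp.continuousOn
  have hL : MemLp (fun t => p t * f t) 2 (vol T) := by
    refine MemLp.mono (g := fun t => M * f t) (h1.const_mul _)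
      ((hp.continuousOn.mono Ioo_subset_Icc_self).aestronglyMeasurable measurableSet_Ioo |>.mul
        h1.1) ?_
    filter_upwards [ae_restrict_mem measurableSet_Ioo] with t ht
    rw [norm_mul, norm_mul]
    gcongr
    exact (hM t (Ioo_subset_Icc_self ht)).trans (le_abs_self M)
  refine ⟨hL, fun h0 => ?_, fun h0 => ?_, fun h0 => ?_⟩
  · rw [memSlobodeckij_iff]
    exact ⟨hL, gag_mul_lt_top hθ1 h1 ((memSlobodeckij_iff).1 (h2 h0)).2 hp⟩
  · have h := h3 h0
    rw [lintegral_weight_half_eq] at h ⊢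
    calc _ ≤ ∫⁻ t in Ioo 0 T, ENNReal.ofReal M ^ 2 * (‖f t‖ₑ ^ 2 * ‖t‖ₑ ^ (-(2 * (1 / 2 : ℝ)))) := by
          refine setLIntegral_mono' measurableSet_Ioo fun t ht => ?_
          rw [enorm_mul, mul_pow, ← mul_assoc]
          gcongr
          rw [← ofReal_norm]; exact ENNReal.ofReal_le_ofReal (hM t (Ioo_subset_Icc_self ht))
      _ < ⊤ := by
          rw [lintegral_const_mul' _ _ (by finiteness)]
          exact ENNReal.mul_lt_top (by finiteness) h
  · obtain ⟨g, hg, e, hg0⟩ := h4 h0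
    refine ⟨fun t => p t * g t, hp.continuousOn.mul hg, ?_, by simp [hg0]⟩
    filter_upwards [e] with t ht
    rw [ht]

theorem lipschitzOnWith_exp_mul (T c : ℝ) :
    ∃ K : NNReal, LipschitzOnWith K (fun t => Real.exp (c * t)) (Icc 0 T) := by
  have h : ContDiffOn ℝ 1 (fun t => Real.exp (c * t)) (Icc 0 T) := by fun_prop
  exact h.exists_lipschitzOnWith one_ne_zero (convex_Icc 0 T) isCompact_Icc

/-- `J^θ` maps `L²(0, T)` into `H_θ(0, T)`. -/
theorem memHFrac_rlIntegral {T θ : ℝ} (hθ : 0 ≤ θ) (hθ1 : θ < 1) {g : ℝ → ℝ}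
    (hg : MemLp g 2 (vol T)) : MemHFrac T θ (rlIntegral θ g) := by
  rcases hθ.eq_or_lt with rfl | hθ
  · rw [rlIntegral_zero]
    exact ⟨hg, fun h => absurd h (lt_irrefl _), fun h => by norm_num at h, fun h => by norm_num at h⟩
  have i := integrable_tilt hg
  have m := memLp_tilt hg
  have hz : ∀ t ≤ 0, tilt T g t = 0 := fun t ht => tilt_of_nonpos T g ht
  have hgag := gag_conv_lt_top hθ hθ1 i m
  have mc := (memLp_conv hθ i m).restrict (Ioo 0 T)
  have h : MemHFrac T θ (conv θ (tilt T g)) := by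
    refine ⟨mc, fun h0 => ?_, fun h0 => ?_, fun h0 => ?_⟩
    · exact (memSlobodeckij_iff).2 ⟨mc, (gag_mono_set (subset_univ _) _).trans_lt hgag⟩
    · rw [lintegral_weight_half_eq, ← h0]
      exact lintegral_weight_lt_top hθ (fun t ht => conv_eq_zero_of_nonpos θ hz ht.le) hgag
    · obtain ⟨k, hk, e, hk0⟩ := exists_continuous_ae_eq_conv h0 i m hz
      exact ⟨k, hk.continuousOn, ae_restrict_of_ae e, hk0⟩
  obtain ⟨K, hK⟩ := lipschitzOnWith_exp_mul T 1
  refine memHFrac_congr_ae ?_ (memHFrac_mul hθ1 h hK)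
  filter_upwards [ae_restrict_mem measurableSet_Ioo] with t ht
  rw [rlIntegral_eq_conv hθ.ne' g ht, one_mul]

/-! ### Weak derivatives and primitives -/

theorem absolutelyContinuous_primitive {a b : ℝ} {g : ℝ → ℝ} (hg : IntervalIntegrable g volume a b)
    (c : ℝ) : AbsolutelyContinuousOnInterval (fun t => c + ∫ s in a..t, g s) a b := by
  have h1 : AbsolutelyContinuousOnInterval (fun _ : ℝ => c) a b :=
    ((LipschitzWith.const c).lipschitzOnWith (s := uIcc a b)).absolutelyContinuousOnInterval
  exact h1.add (hg.absolutelyContinuousOnInterval_intervalIntegral left_mem_uIcc)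

theorem ae_deriv_primitive {a b : ℝ} {g : ℝ → ℝ} (hg : IntervalIntegrable g volume a b) (c : ℝ) :
    ∀ᵐ x, x ∈ uIcc a b → deriv (fun t => c + ∫ s in a..t, g s) x = g x := by
  filter_upwards [hg.ae_hasDerivAt_integral] with x hx hxm
  exact ((hx hxm a left_mem_uIcc).const_add c).deriv

/-- The product rule for primitives, in integrated form. -/
theorem integral_primitive_mul_primitive {a b c d : ℝ} {f g : ℝ → ℝ}
    (hf : IntervalIntegrable f volume a b) (hg : IntervalIntegrable g volume a b) :
    ∫ x in a..b, (f x * (d + ∫ s in a..x, g s) + (c + ∫ s in a..x, f s) * g x)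
      = (c + ∫ s in a..b, f s) * (d + ∫ s in a..b, g s) - c * d := by
  have h := (absolutelyContinuous_primitive hf c).integral_deriv_mul_eq_sub
    (absolutelyContinuous_primitive hg d)
  simp only [intervalIntegral.integral_same, add_zero] at h
  rw [← h]
  refine intervalIntegral.integral_congr_ae ?_
  filter_upwards [ae_deriv_primitive hf c, ae_deriv_primitive hg d] with x h1 h2 hx
  rw [h1 (uIoc_subset_uIcc hx), h2 (uIoc_subset_uIcc hx)]

theorem integral_primitive_mul_deriv {a b : ℝ} (hab : a ≤ b) {g : ℝ → ℝ}
    (hg : IntegrableOn g (Ioo a b)) (c : ℝ) {φ : ℝ → ℝ} (hφ : ContDiff ℝ ∞ φ)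
    (hs : tsupport φ ⊆ Ioo a b) :
    ∫ t in Ioo a b, (c + ∫ s in a..t, g s) * deriv φ t = - ∫ t in Ioo a b, g t * φ t := by
  have hg' : IntervalIntegrable g volume a b :=
    (intervalIntegrable_iff_integrableOn_Ioo_of_le hab).2 hg
  have hφac : AbsolutelyContinuousOnInterval φ a b :=
    ContDiffOn.absolutelyContinuousOnInterval (hφ.of_le (by simp)).contDiffOn
  have h := (absolutelyContinuous_primitive hg' c).integral_mul_deriv_eq_deriv_mul hφac
  have ha : φ a = 0 := image_eq_zero_of_notMem_tsupport fun h => absurd (hs h).1 (lt_irrefl _)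
  have hb : φ b = 0 := image_eq_zero_of_notMem_tsupport fun h => absurd (hs h).2 (lt_irrefl _)
  rw [ha, hb, mul_zero, mul_zero, sub_zero, zero_sub] at h
  rw [← integral_Ioc_eq_integral_Ioo, ← intervalIntegral.integral_of_le hab, h,
    ← integral_Ioc_eq_integral_Ioo, ← intervalIntegral.integral_of_le hab]
  congr 1
  refine intervalIntegral.integral_congr_ae ?_
  filter_upwards [ae_deriv_primitive hg' c] with x hx hxm
  rw [hx (uIoc_subset_uIcc hxm)]

theorem integrable_mul_of_hasCompactSupport {U : Set ℝ} {f φ : ℝ → ℝ}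
    (hf : LocallyIntegrableOn f U)
    (hφ : Continuous φ) (hφc : HasCompactSupport φ) (hs : tsupport φ ⊆ U) :
    IntegrableOn (fun t => f t * φ t) U := by
  have h1 : IntegrableOn f (tsupport φ) := hf.integrableOn_compact_subset hs hφc
  have h2 : IntegrableOn (fun t => f t * φ t) (tsupport φ) :=
    h1.mul_continuousOn hφ.continuousOn hφc
  have h3 : Integrable (fun t => f t * φ t) := by
    rw [← integrableOn_iff_integrable_of_support_subset (s := tsupport φ)]
    · exact h2
    · exact (Function.support_mul_subset_right _ _).trans (subset_tsupport φ)
  exact h3.integrableOn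

/-- The lemma of du Bois-Reymond: a function whose weak derivative vanishes is constant. -/
theorem ae_eq_const_of_integral_mul_deriv_eq_zero {a b : ℝ} (hab : a < b) {h : ℝ → ℝ}
    (hh : LocallyIntegrableOn h (Ioo a b))
    (h0 : ∀ φ : ℝ → ℝ, ContDiff ℝ ∞ φ → HasCompactSupport φ → tsupport φ ⊆ Ioo a b →
      ∫ t in Ioo a b, h t * deriv φ t = 0) :
    ∃ c, h =ᵐ[volume.restrict (Ioo a b)] fun _ => c := by
  -- a test function of integral one
  obtain ⟨χ, hχs, hχc, hχ, hχ1⟩ : ∃ χ : ℝ → ℝ, tsupport χ ⊆ Ioo a b ∧ HasCompactSupport χ ∧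
      ContDiff ℝ ∞ χ ∧ ∫ t, χ t = 1 := by
    let m := (a + b) / 2
    obtain ⟨f, hfs, hfc, hf, hr, hf1⟩ := exists_contDiff_tsupport_subset (n := ⊤)
      (Ioo_mem_nhds (show a < m by simp only [m]; linarith) (show m < b by simp only [m]; linarith))
    have hpos : 0 < ∫ t, f t := by
      refine hf.continuous.integral_pos_of_hasCompactSupport_nonneg_nonzero hfc (x := m)
        (fun t => (hr (mem_range_self t)).1) ?_
      rw [hf1]; exact one_ne_zero
    refine ⟨fun t => f t / ∫ t, f t, ?_, ?_, hf.div_const _, ?_⟩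
    · refine (tsupport_mul_subset_left (f := f) (g := fun _ => (∫ t, f t)⁻¹)).trans hfs
    · exact hfc.mul_right (f' := fun _ => (∫ t, f t)⁻¹)
    · rw [integral_div, div_self hpos.ne']
  set c := ∫ t in Ioo a b, h t * χ t with hc
  refine ⟨c, ?_⟩
  have key : ∀ᵐ x, x ∈ Ioo a b → h x - c = 0 := by
    refine isOpen_Ioo.ae_eq_zero_of_integral_contDiff_smul_eq_zero
      (hh.sub (locallyIntegrableOn_const c)) ?_
    intro ψ hψ hψc hψs
    let I := ∫ t, ψ t
    let ρ : ℝ → ℝ := fun t => ψ t - I * χ t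
    have hρ : ContDiff ℝ ∞ ρ := hψ.sub (contDiff_const.mul hχ)
    let φ : ℝ → ℝ := fun t => ∫ s in a..t, ρ s
    have hφd : ∀ t, HasDerivAt φ (ρ t) t := fun t =>
      intervalIntegral.integral_hasDerivAt_right (hρ.continuous.intervalIntegrable _ _)
        (hρ.continuous.stronglyMeasurableAtFilter _ _) hρ.continuous.continuousAt
    have hφ' : deriv φ = ρ := funext fun t => (hφd t).deriv
    have hφ : ContDiff ℝ ∞ φ := by
      rw [contDiff_infty_iff_deriv]
      exact ⟨fun t => (hφd t).differentiableAt, by rwa [hφ']⟩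
    -- the supports lie in a compact subinterval
    obtain ⟨a', b', ha', hb', hK⟩ : ∃ a' b', a < a' ∧ b' < b ∧ tsupport ψ ∪ tsupport χ ⊆ Icc a' b' := by
      have hKc : IsCompact (tsupport ψ ∪ tsupport χ) := hψc.isCompact.union hχc.isCompact
      have hne : (tsupport ψ ∪ tsupport χ).Nonempty := by
        by_contra hcon
        rw [not_nonempty_iff_eq_empty, union_empty_iff] at hcon
        have : χ = 0 := tsupport_eq_empty_iff.1 hcon.2
        rw [this] at hχ1
        simp at hχ1
      obtain ⟨x, hx, hx'⟩ := hKc.exists_isLeast hne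
      obtain ⟨y, hy, hy'⟩ := hKc.exists_isGreatest hne
      have hsub := union_subset hψs hχs
      exact ⟨x, y, (hsub hx).1, (hsub hy).2, fun z hz => ⟨hx' hz, hy' hz⟩⟩
    have hρ0 : ∀ t, t ∉ Icc a' b' → ρ t = 0 := by
      intro t ht
      have h1 : ψ t = 0 := image_eq_zero_of_notMem_tsupport fun h => ht (hK (Or.inl h))
      have h2 : χ t = 0 := image_eq_zero_of_notMem_tsupport fun h => ht (hK (Or.inr h))
      simp [ρ, h1, h2]
    have hiψ := hψ.continuous.integrable_of_hasCompactSupport (μ := volume) hψc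
    have hiχ := hχ.continuous.integrable_of_hasCompactSupport (μ := volume) hχc
    have hρi : ∫ t, ρ t = 0 := by
      rw [integral_sub hiψ (hiχ.const_mul I), integral_const_mul, hχ1]
      simp [I]
    have hφ0 : ∀ t, t ∉ Icc a' b' → φ t = 0 := by
      intro t ht
      rcases lt_or_ge t a' with h | h
      · refine (intervalIntegral.integral_congr (g := fun _ => (0:ℝ)) fun s hs => ?_).trans (by simp)
        refine hρ0 s fun hs' => ?_
        have := hs.2
        have h3 : max a t < a' := max_lt ha' h
        linarith [hs'.1]
      · have hbt : b' < t := not_le.1 fun h' => ht ⟨h, h'⟩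
        rcases le_or_gt t a with hta | hta
        · linarith
        simp only [φ]
        rw [intervalIntegral.integral_of_le hta.le, setIntegral_eq_integral_of_forall_compl_eq_zero,
          hρi]
        intro s hs
        refine hρ0 s fun hs' => hs ⟨by linarith [hs'.1], by linarith [hs'.2]⟩
    have hφs : tsupport φ ⊆ Icc a' b' := closure_minimal
      (fun t ht => by by_contra hcon; exact ht (hφ0 t hcon)) isClosed_Icc
    have hφc : HasCompactSupport φ := isCompact_Icc.of_isClosed_subset (isClosed_tsupport φ) hφs
    have hz := h0 φ hφ hφc (hφs.trans fun t ht => ⟨by linarith [ht.1], by linarith [ht.2]⟩)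
    rw [hφ'] at hz
    have i1 := integrable_mul_of_hasCompactSupport hh hψ.continuous hψc hψs
    have i2 := integrable_mul_of_hasCompactSupport hh hχ.continuous hχc hχs
    have e1 : ∫ t in Ioo a b, h t * ρ t = (∫ t in Ioo a b, h t * ψ t) - I * c := by
      rw [hc, ← integral_const_mul, ← integral_sub i1 (i2.const_mul I)]
      exact integral_congr_ae (.of_forall fun t => by simp only [ρ]; ring)
    rw [e1] at hz
    have e2 : ∫ t, ψ t • (h t - c) = ∫ t in Ioo a b, ψ t • (h t - c) := by
      rw [setIntegral_eq_integral_of_forall_compl_eq_zero]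
      intro t ht
      rw [image_eq_zero_of_notMem_tsupport fun h => ht (hψs h), zero_smul]
    have e3 : ∫ t in Ioo a b, ψ t = I := by
      rw [setIntegral_eq_integral_of_forall_compl_eq_zero]
      intro t ht
      exact image_eq_zero_of_notMem_tsupport fun h => ht (hψs h)
    rw [e2, ← hz, ← e3, mul_comm (∫ t in Ioo a b, ψ t), ← integral_const_mul,
      ← integral_sub i1 (hiψ.integrableOn.const_mul c)]
    exact integral_congr_ae (.of_forall fun t => by simp only [smul_eq_mul]; ring)
  rw [Filter.EventuallyEq, ae_restrict_iff' measurableSet_Ioo]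
  filter_upwards [key] with x hx hxm
  linarith [hx hxm]

theorem tsupport_deriv_subset_of {φ : ℝ → ℝ} {U : Set ℝ} (h : tsupport φ ⊆ U) :
    tsupport (deriv φ) ⊆ U := tsupport_deriv_subset.trans h

theorem exists_ae_eq_primitive {a b : ℝ} (hab : a < b) {f g : ℝ → ℝ}
    (hf : LocallyIntegrableOn f (Ioo a b)) (hg : IntegrableOn g (Ioo a b))
    (h0 : ∀ φ : ℝ → ℝ, ContDiff ℝ ∞ φ → HasCompactSupport φ → tsupport φ ⊆ Ioo a b →
      ∫ t in Ioo a b, f t * deriv φ t = - ∫ t in Ioo a b, g t * φ t) :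
    ∃ c, f =ᵐ[volume.restrict (Ioo a b)] fun t => c + ∫ s in a..t, g s := by
  have hg' : IntervalIntegrable g volume a b :=
    (intervalIntegrable_iff_integrableOn_Ioo_of_le hab.le).2 hg
  have hcont : ContinuousOn (fun t => ∫ s in a..t, g s) (Ioo a b) := by
    have := (absolutelyContinuous_primitive hg' 0).continuousOn
    simp only [zero_add, uIcc_of_le hab.le] at this
    exact this.mono Ioo_subset_Icc_self
  have hpl : LocallyIntegrableOn (fun t => ∫ s in a..t, g s) (Ioo a b) :=
    hcont.locallyIntegrableOn measurableSet_Ioo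
  obtain ⟨c, hc⟩ := ae_eq_const_of_integral_mul_deriv_eq_zero hab (hf.sub hpl)
    (fun φ hφ hφc hφs => by
      have hd : Continuous (deriv φ) := hφ.continuous_deriv (by simp)
      have hds : tsupport (deriv φ) ⊆ Ioo a b := tsupport_deriv_subset_of hφs
      have i1 := integrable_mul_of_hasCompactSupport hf hd hφc.deriv hds
      have i2 := integrable_mul_of_hasCompactSupport hpl hd hφc.deriv hds
      have e := integral_primitive_mul_deriv hab.le hg 0 hφ hφs
      simp only [zero_add] at e
      have e2 := integral_sub i1 i2
      rw [h0 φ hφ hφc hφs, e, sub_self] at e2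
      rw [← e2]
      exact integral_congr_ae (.of_forall fun t => by simp only [Pi.sub_apply]; ring))
  refine ⟨c, ?_⟩
  filter_upwards [hc] with t ht
  simp only [Pi.sub_apply] at ht
  linarith

theorem rlIntegral_one (g : ℝ → ℝ) (t : ℝ) : rlIntegral 1 g t = ∫ s in (0:ℝ)..t, g s := by
  simp [rlIntegral]

theorem continuousOn_primitive {T : ℝ} (hT : 0 ≤ T) {g : ℝ → ℝ} (hg : IntegrableOn g (Ioo 0 T))
    (c : ℝ) : ContinuousOn (fun t => c + ∫ s in (0:ℝ)..t, g s) (Icc 0 T) := by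
  have hg' : IntervalIntegrable g volume 0 T :=
    (intervalIntegrable_iff_integrableOn_Ioo_of_le hT).2 hg
  have := (absolutelyContinuous_primitive hg' c).continuousOn
  rwa [uIcc_of_le hT] at this

theorem eqOn_Icc_of_ae_eq {T : ℝ} (hT : 0 < T) {f g : ℝ → ℝ} (hf : ContinuousOn f (Icc 0 T))
    (hg : ContinuousOn g (Icc 0 T)) (h : f =ᵐ[vol T] g) : EqOn f g (Icc 0 T) := by
  have h1 := Measure.eqOn_open_of_ae_eq h isOpen_Ioo (hf.mono Ioo_subset_Icc_self)
    (hg.mono Ioo_subset_Icc_self)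
  have hcl : closure (Ioo 0 T) = Icc 0 T := closure_Ioo hT.ne
  rw [← hcl] at hf hg ⊢
  exact h1.of_subset_closure hf hg subset_closure subset_rfl

namespace IsWeakDeriv

variable {T : ℝ} {j : ℕ} {u v w : ℝ → ℝ}

theorem congr_ae {u' w' : ℝ → ℝ} (h : IsWeakDeriv T j u w) (hu : u =ᵐ[vol T] u')
    (hw : w =ᵐ[vol T] w') : IsWeakDeriv T j u' w' := by
  obtain ⟨h1, h2, h3⟩ := h
  have loc : ∀ {f g : ℝ → ℝ}, f =ᵐ[vol T] g → LocallyIntegrableOn f (Ioo 0 T) →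
      LocallyIntegrableOn g (Ioo 0 T) := by
    intro f g e hf
    rw [locallyIntegrableOn_iff isOpen_Ioo.isLocallyClosed] at hf ⊢
    intro k hk hkc
    refine (hf k hk hkc).congr ?_
    exact ae_restrict_of_ae_restrict_of_subset hk e
  refine ⟨loc hu h1, loc hw h2, fun φ a b c => ?_⟩
  have e1 : ∫ t in Ioo 0 T, u t * iteratedDeriv j φ t = ∫ t in Ioo 0 T, u' t * iteratedDeriv j φ t :=
    integral_congr_ae (by filter_upwards [hu] with t ht; rw [ht])
  have e2 : ∫ t in Ioo 0 T, w t * φ t = ∫ t in Ioo 0 T, w' t * φ t :=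
    integral_congr_ae (by filter_upwards [hw] with t ht; rw [ht])
  rw [← e1, ← e2]
  exact h3 φ a b c

theorem zero (hu : LocallyIntegrableOn u (Ioo 0 T)) : IsWeakDeriv T 0 u u :=
  ⟨hu, hu, fun φ _ _ _ => by simp⟩

/-- Weak derivatives are unique. -/
theorem ae_eq (h : IsWeakDeriv T j u v) (h' : IsWeakDeriv T j u w) : v =ᵐ[vol T] w := by
  have key : ∀ᵐ x, x ∈ Ioo 0 T → v x - w x = 0 := by
    refine isOpen_Ioo.ae_eq_zero_of_integral_contDiff_smul_eq_zero (h.2.1.sub h'.2.1) ?_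
    intro ψ hψ hψc hψs
    have e1 := h.2.2 ψ hψ hψc hψs
    rw [h'.2.2 ψ hψ hψc hψs] at e1
    have e2 := mul_left_cancel₀ (pow_ne_zero j (by norm_num : (-1 : ℝ) ≠ 0)) e1
    have i1 := integrable_mul_of_hasCompactSupport h.2.1 hψ.continuous hψc hψs
    have i2 := integrable_mul_of_hasCompactSupport h'.2.1 hψ.continuous hψc hψs
    rw [← setIntegral_eq_integral_of_forall_compl_eq_zero (s := Ioo 0 T)]
    · have e3 : ∫ t in Ioo 0 T, ψ t • (v t - w t)
          = (∫ t in Ioo 0 T, v t * ψ t) - ∫ t in Ioo 0 T, w t * ψ t := by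
        rw [← integral_sub i1 i2]
        exact integral_congr_ae (.of_forall fun t => by simp only [smul_eq_mul]; ring)
      rw [e3, e2, sub_self]
    · intro t ht
      rw [image_eq_zero_of_notMem_tsupport fun h => ht (hψs h), zero_smul]
  rw [Filter.EventuallyEq, ae_restrict_iff' measurableSet_Ioo]
  filter_upwards [key] with x hx hxm
  linarith [hx hxm]

theorem succ (h : IsWeakDeriv T j u v) (h' : IsWeakDeriv T 1 v w) :
    IsWeakDeriv T (j + 1) u w := by
  refine ⟨h.1, h'.2.1, fun φ hφ hφc hφs => ?_⟩
  have hd : ContDiff ℝ ∞ (deriv φ) := (contDiff_infty_iff_deriv.1 hφ).2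
  have e1 := h.2.2 (deriv φ) hd hφc.deriv (tsupport_deriv_subset_of hφs)
  have e2 := h'.2.2 φ hφ hφc hφs
  rw [iteratedDeriv_one, pow_one] at e2
  rw [iteratedDeriv_succ', e1, e2]
  ring

theorem of_succ (h : IsWeakDeriv T j u v) (h' : IsWeakDeriv T (j + 1) u w) :
    IsWeakDeriv T 1 v w := by
  refine ⟨h.2.1, h'.2.1, fun φ hφ hφc hφs => ?_⟩
  have hd : ContDiff ℝ ∞ (deriv φ) := (contDiff_infty_iff_deriv.1 hφ).2
  have e1 := h.2.2 (deriv φ) hd hφc.deriv (tsupport_deriv_subset_of hφs)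
  have e2 := h'.2.2 φ hφ hφc hφs
  rw [iteratedDeriv_succ', e1, pow_succ, mul_assoc] at e2
  have e3 := mul_left_cancel₀ (pow_ne_zero j (by norm_num : (-1 : ℝ) ≠ 0)) e2
  rw [iteratedDeriv_one, e3, pow_one]

theorem exists_ae_eq_primitive (hT : 0 < T) (h : IsWeakDeriv T 1 u w)
    (hw : IntegrableOn w (Ioo 0 T)) :
    ∃ c, u =ᵐ[vol T] fun t => c + ∫ s in (0:ℝ)..t, w s := by
  refine FracODE.exists_ae_eq_primitive hT h.1 hw fun φ hφ hφc hφs => ?_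
  have := h.2.2 φ hφ hφc hφs
  rwa [iteratedDeriv_one, pow_one, neg_one_mul] at this

theorem ae_eq_rlIntegral_one (hT : 0 < T) (h : IsWeakDeriv T 1 u w)
    (hw : IntegrableOn w (Ioo 0 T)) (h0 : HasInitialValue T u 0) :
    u =ᵐ[vol T] rlIntegral 1 w := by
  obtain ⟨c, hc⟩ := h.exists_ae_eq_primitive hT hw
  obtain ⟨g, hg, e, hg0⟩ := h0
  have heq := eqOn_Icc_of_ae_eq hT hg (continuousOn_primitive hT.le hw c) (e.symm.trans hc)
  have h1 := heq (left_mem_Icc.2 hT.le)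
  simp only [hg0, intervalIntegral.integral_same, add_zero] at h1
  filter_upwards [hc] with t ht
  rw [ht, rlIntegral_one, ← h1, zero_add]

theorem of_primitive (hT : 0 < T) {g : ℝ → ℝ} (hg : IntegrableOn g (Ioo 0 T)) (c : ℝ) :
    IsWeakDeriv T 1 (fun t => c + ∫ s in (0:ℝ)..t, g s) g := by
  refine ⟨((continuousOn_primitive hT.le hg c).mono Ioo_subset_Icc_self).locallyIntegrableOn
    measurableSet_Ioo, hg.locallyIntegrableOn, fun φ hφ hφc hφs => ?_⟩
  rw [iteratedDeriv_one, pow_one, neg_one_mul, integral_primitive_mul_deriv hT.le hg c hφ hφs]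

theorem of_rlIntegral_one (hT : 0 < T) {g : ℝ → ℝ} (hg : IntegrableOn g (Ioo 0 T)) :
    IsWeakDeriv T 1 (rlIntegral 1 g) g := by
  refine (of_primitive hT hg 0).congr_ae (.of_forall fun t => ?_) Filter.EventuallyEq.rfl
  simp only [rlIntegral_one, zero_add]

end IsWeakDeriv

theorem hasInitialValue_rlIntegral_one {T : ℝ} (hT : 0 < T) {g : ℝ → ℝ}
    (hg : IntegrableOn g (Ioo 0 T)) : HasInitialValue T (rlIntegral 1 g) 0 :=
  ⟨_, continuousOn_primitive hT.le hg 0, .of_forall fun t => by simp [rlIntegral_one], by simp⟩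

/-! ### Hardy inequalities in fractional spaces -/

/-- Fatou's lemma for a sequence with uniformly bounded integrals. -/
theorem lintegral_le_of_tendsto {μ : Measure ℝ} {F : ℕ → ℝ → ℝ≥0∞} {G : ℝ → ℝ≥0∞} {C : ℝ≥0∞}
    (hF : ∀ n, Measurable (F n))
    (hlim : ∀ᵐ t ∂μ, Filter.Tendsto (fun n => F n t) Filter.atTop (nhds (G t)))
    (hC : ∀ n, ∫⁻ t, F n t ∂μ ≤ C) : ∫⁻ t, G t ∂μ ≤ C := by
  calc ∫⁻ t, G t ∂μ = ∫⁻ t, Filter.liminf (fun n => F n t) Filter.atTop ∂μ := by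
        refine lintegral_congr_ae ?_
        filter_upwards [hlim] with t ht
        exact ht.liminf_eq.symm
    _ ≤ Filter.liminf (fun n => ∫⁻ t, F n t ∂μ) Filter.atTop := lintegral_liminf_le hF
    _ ≤ C := by
        refine (Filter.liminf_le_liminf (Filter.Eventually.of_forall hC)).trans ?_
        simp

theorem setLIntegral_Ioo_comp_mul_left {r x y : ℝ} (hr : 0 < r) {g : ℝ → ℝ≥0∞}
    (hg : Measurable g) :
    ‖r‖ₑ * ∫⁻ t in Ioo x y, g (r * t) = ∫⁻ s in Ioo (r * x) (r * y), g s := by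
  rw [← lintegral_indicator measurableSet_Ioo, ← lintegral_indicator measurableSet_Ioo,
    lintegral_eq_enorm_mul_lintegral_comp hr.ne' _ (hg.indicator measurableSet_Ioo)]
  congr 1
  refine lintegral_congr fun t => ?_
  simp only [indicator, mem_Ioo, mul_lt_mul_iff_right₀ hr]

theorem setLIntegral_comp_mul_left_weight {r x y p : ℝ} (hr : 0 < r) {g : ℝ → ℝ≥0∞}
    (hg : Measurable g) :
    ∫⁻ t in Ioo x y, g (r * t) * ‖t‖ₑ ^ p
      = ‖r‖ₑ ^ (-(1 + p)) * ∫⁻ s in Ioo (r * x) (r * y), g s * ‖s‖ₑ ^ p := by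
  have h0 : ‖r‖ₑ ≠ 0 := by simpa using hr.ne'
  rw [← setLIntegral_Ioo_comp_mul_left hr (by fun_prop : Measurable fun s => g s * ‖s‖ₑ ^ p),
    ← mul_assoc, ← lintegral_const_mul _ (by fun_prop)]
  refine lintegral_congr fun t => ?_
  rw [enorm_mul, ENNReal.mul_rpow_of_ne_top enorm_ne_top enorm_ne_top]
  have : ‖r‖ₑ ^ (-(1 + p)) * ‖r‖ₑ * ‖r‖ₑ ^ p = 1 := by
    nth_rw 2 [← ENNReal.rpow_one ‖r‖ₑ]
    rw [← ENNReal.rpow_add _ _ h0 enorm_ne_top, ← ENNReal.rpow_add _ _ h0 enorm_ne_top]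
    ring_nf; simp
  calc _ = 1 * (g (r * t) * ‖t‖ₑ ^ p) := (one_mul _).symm
    _ = _ := by rw [← this]; ring

/-- Averaging the Gagliardo energy over dilations: some dilation factor `r` in a given interval
makes the weighted distance of `f` and `f(r ·)` finite. -/
theorem exists_dilation {T θ a b : ℝ} (hθ : 0 < θ) (hab : a < b) {f : ℝ → ℝ}
    (hf : Measurable f) (h : gag θ (Ioo 0 T) f < ⊤) :
    ∃ r ∈ Ioo a b, ∫⁻ t in Ioo 0 T,
      (Ioo 0 T).indicator (fun s => ‖f t - f s‖ₑ ^ 2) (r * t) * ‖t‖ₑ ^ (-(2 * θ)) < ⊤ := by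
  have hG : Measurable (fun p : ℝ × ℝ => (Ioo 0 T).indicator (fun s => ‖f p.1 - f s‖ₑ ^ 2) p.2) := by
    have e : (fun p : ℝ × ℝ => (Ioo 0 T).indicator (fun s => ‖f p.1 - f s‖ₑ ^ 2) p.2)
        = (Prod.snd ⁻¹' Ioo 0 T).indicator (fun p : ℝ × ℝ => ‖f p.1 - f p.2‖ₑ ^ 2) := by
      ext p; simp only [indicator, mem_preimage]
    rw [e]
    exact Measurable.indicator (by fun_prop) (measurable_snd measurableSet_Ioo)
  set G : ℝ → ℝ → ℝ≥0∞ := fun t => (Ioo 0 T).indicator (fun s => ‖f t - f s‖ₑ ^ 2) with hGdef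
  have hG' : Measurable (Function.uncurry G) := hG
  set c := max 1 b with hc
  have hcpos : 0 < c := lt_max_of_lt_left one_pos
  have main : ∫⁻ r in Ioo a b, ∫⁻ t in Ioo 0 T, G t (r * t) * ‖t‖ₑ ^ (-(2 * θ)) < ⊤ := by
    rw [lintegral_lintegral_swap]
    swap
    · have : Measurable (fun p : ℝ × ℝ => G p.2 (p.1 * p.2)) :=
        hG'.comp (measurable_snd.prodMk (measurable_fst.mul measurable_snd))
      exact (this.mul (by fun_prop)).aemeasurable
    have hle : ∀ t ∈ Ioo 0 T, ∫⁻ r in Ioo a b, G t (r * t) * ‖t‖ₑ ^ (-(2 * θ)) ≤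
        ‖c‖ₑ ^ (1 + 2 * θ) * ∫⁻ s in Ioo 0 T, ‖f t - f s‖ₑ ^ 2 * ‖t - s‖ₑ ^ (-(1 + 2 * θ)) := by
      intro t ht
      have h0 : ‖t‖ₑ ≠ 0 := by simpa using ht.1.ne'
      have hGt : Measurable (G t) := hG'.comp measurable_prodMk_left
      have e1 : ∫⁻ r in Ioo a b, G t (r * t)
          = ‖t‖ₑ ^ (-1 : ℝ) * ∫⁻ s in Ioo (t * a) (t * b), G t s := by
        rw [← setLIntegral_Ioo_comp_mul_left ht.1 hGt, ← mul_assoc, ENNReal.rpow_neg_one,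
          ENNReal.inv_mul_cancel h0 enorm_ne_top, one_mul]
        simp_rw [mul_comm t]
      have hGm : Measurable fun r => G t (r * t) := hGt.comp (measurable_id.mul_const t)
      rw [lintegral_mul_const _ hGm, e1, mul_comm, ← mul_assoc,
        ← ENNReal.rpow_add _ _ h0 enorm_ne_top, ← lintegral_const_mul _ hGt,
        ← lintegral_const_mul' _ _ (by finiteness), ← lintegral_indicator measurableSet_Ioo,
        ← lintegral_indicator measurableSet_Ioo]
      refine lintegral_mono fun s => ?_
      by_cases hs : s ∈ Ioo (t * a) (t * b)
      · rw [indicator_of_mem hs]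
        by_cases hs' : s ∈ Ioo 0 T
        · rw [indicator_of_mem hs']
          simp only [hGdef]
          rw [indicator_of_mem hs']
          have h1 : |t - s| ≤ |c * t| := by
            rw [abs_of_pos (mul_pos hcpos ht.1), abs_le]
            have h2 : t * b ≤ c * t := by
              rw [mul_comm]; exact mul_le_mul_of_nonneg_right (le_max_right _ _) ht.1.le
            have h3 : 1 * t ≤ c * t := mul_le_mul_of_nonneg_right (le_max_left _ _) ht.1.le
            constructor
            · linarith [hs.2, ht.1]
            · linarith [hs'.1]
          have h2 := enorm_rpow_antitone h1 (by linarith : 0 ≤ 1 + 2 * θ)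
          rw [enorm_mul, ENNReal.mul_rpow_of_ne_top enorm_ne_top enorm_ne_top] at h2
          have hc0 : ‖c‖ₑ ≠ 0 := by simpa using hcpos.ne'
          have h3 : ‖c‖ₑ ^ (1 + 2 * θ) * ‖c‖ₑ ^ (-(1 + 2 * θ)) = 1 := by
            rw [← ENNReal.rpow_add _ _ hc0 enorm_ne_top]; simp
          have e3 : -(2 * θ) + -1 = -(1 + 2 * θ) := by ring
          rw [e3]
          calc _ = ‖c‖ₑ ^ (1 + 2 * θ) * ‖f t - f s‖ₑ ^ 2 *
                (‖c‖ₑ ^ (-(1 + 2 * θ)) * ‖t‖ₑ ^ (-(1 + 2 * θ))) := by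
                calc _ = 1 * (‖t‖ₑ ^ (-(1 + 2 * θ)) * ‖f t - f s‖ₑ ^ 2) := (one_mul _).symm
                  _ = _ := by rw [← h3]; ring
            _ ≤ ‖c‖ₑ ^ (1 + 2 * θ) * ‖f t - f s‖ₑ ^ 2 * ‖t - s‖ₑ ^ (-(1 + 2 * θ)) := by gcongr
            _ = _ := by ring
        · simp only [hGdef]
          rw [indicator_of_notMem hs', mul_zero]
          exact zero_le
      · rw [indicator_of_notMem hs]; exact zero_le
    refine (setLIntegral_mono' measurableSet_Ioo hle).trans_lt ?_
    rw [lintegral_const_mul' _ _ (ENNReal.rpow_ne_top_of_nonneg (by linarith) enorm_ne_top)]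
    exact ENNReal.mul_lt_top (ENNReal.rpow_lt_top_of_nonneg (by linarith) enorm_ne_top) h
  by_contra hcon
  push Not at hcon
  have : ∫⁻ r in Ioo a b, ∫⁻ t in Ioo 0 T, G t (r * t) * ‖t‖ₑ ^ (-(2 * θ)) = ⊤ := by
    rw [setLIntegral_congr_fun (g := fun _ => ⊤) measurableSet_Ioo
      fun r hr => top_le_iff.1 (hcon r hr)]
    simp [ENNReal.top_mul, hab]
  exact main.ne this

theorem exists_dilation_small {p : ℝ} (hp : 0 < p) :
    ∃ b : ℝ, 0 < b ∧ b < 1 ∧ ∀ r ∈ Ioo 0 b, 2 * ‖r‖ₑ ^ p ≤ 1 / 2 := by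
  have hb : (0:ℝ) < (1 / 4 : ℝ) ^ (1 / p) := by positivity
  refine ⟨(1 / 4 : ℝ) ^ (1 / p), hb, Real.rpow_lt_one (by norm_num) (by norm_num) (by positivity),
    fun r hr => ?_⟩
  rw [enorm_rpow_of_pos hr.1]
  have h : r ^ p ≤ 1 / 4 := by
    calc r ^ p ≤ ((1 / 4 : ℝ) ^ (1 / p)) ^ p := Real.rpow_le_rpow hr.1.le hr.2.le hp.le
      _ = 1 / 4 := by rw [← Real.rpow_mul (by norm_num), one_div_mul_cancel hp.ne', Real.rpow_one]
  calc 2 * ENNReal.ofReal (r ^ p) ≤ ENNReal.ofReal 2 * ENNReal.ofReal (1 / 4) := by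
        rw [show (2 : ℝ≥0∞) = ENNReal.ofReal 2 by simp]
        gcongr
    _ = ENNReal.ofReal (1 / 2) := by rw [← ENNReal.ofReal_mul (by norm_num)]; norm_num
    _ = 1 / 2 := by rw [ENNReal.ofReal_div_of_pos (by norm_num)]; simp

/-- Hardy's inequality for `θ > 1/2`: compare `f(t)` with `f(rⁿ t) → 0` for a small `r`. -/
theorem hardy_of_half_lt {T θ : ℝ} (hθ : 1 / 2 < θ) {f : ℝ → ℝ} (hf : Measurable f)
    (h : gag θ (Ioo 0 T) f < ⊤)
    (h0 : Filter.Tendsto f (nhdsWithin 0 (Ioo 0 T)) (nhds 0)) :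
    ∫⁻ t in Ioo 0 T, ‖f t‖ₑ ^ 2 * ‖t‖ₑ ^ (-(2 * θ)) < ⊤ := by
  obtain ⟨b, hb0, hb1, hb⟩ := exists_dilation_small (p := 2 * θ - 1) (by linarith)
  obtain ⟨r, hr, hfin⟩ := exists_dilation (by linarith) (half_lt_self hb0) hf h
  have hr0 : 0 < r := (half_pos hb0).trans hr.1
  have hr1 : r < 1 := hr.2.trans hb1
  let I : ℕ → ℝ≥0∞ := fun n => ∫⁻ t in Ioo 0 T, ‖f t - f (r ^ n * t)‖ₑ ^ 2 * ‖t‖ₑ ^ (-(2 * θ))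
  have hI1 : I 1 < ⊤ := by
    refine lt_of_eq_of_lt (setLIntegral_congr_fun measurableSet_Ioo fun t ht => ?_) hfin
    have : r * t ∈ Ioo 0 T := ⟨mul_pos hr0 ht.1, by nlinarith [ht.1, ht.2]⟩
    simp only [pow_one]
    rw [indicator_of_mem this]
  have hstep : ∀ n, I (n + 1) ≤ 2 * I 1 + (1 / 2) * I n := by
    intro n
    have hm : Measurable fun s => ‖f s - f (r ^ n * s)‖ₑ ^ 2 := by fun_prop
    have e := setLIntegral_comp_mul_left_weight (x := 0) (y := T) (p := -(2 * θ)) hr0 hm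
    have e2 : -(1 + -(2 * θ)) = 2 * θ - 1 := by ring
    rw [e2, mul_zero] at e
    calc I (n + 1) ≤ ∫⁻ t in Ioo 0 T, (2 * (‖f t - f (r ^ 1 * t)‖ₑ ^ 2 * ‖t‖ₑ ^ (-(2 * θ))) +
            2 * (‖f (r * t) - f (r ^ n * (r * t))‖ₑ ^ 2 * ‖t‖ₑ ^ (-(2 * θ)))) := by
          refine lintegral_mono fun t => ?_
          have : f t - f (r ^ (n + 1) * t)
              = (f t - f (r ^ 1 * t)) + (f (r * t) - f (r ^ n * (r * t))) := by
            rw [pow_one, ← mul_assoc, ← pow_succ]; ring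
          rw [this]
          calc _ ≤ (2 * ‖f t - f (r ^ 1 * t)‖ₑ ^ 2 + 2 * ‖f (r * t) - f (r ^ n * (r * t))‖ₑ ^ 2) *
                ‖t‖ₑ ^ (-(2 * θ)) := by gcongr; exact enorm_add_sq_le _ _
            _ = _ := by ring
      _ = 2 * I 1 + 2 * (‖r‖ₑ ^ (2 * θ - 1) *
            ∫⁻ s in Ioo 0 (r * T), ‖f s - f (r ^ n * s)‖ₑ ^ 2 * ‖s‖ₑ ^ (-(2 * θ))) := by
          rw [lintegral_add_left (by fun_prop), lintegral_const_mul _ (by fun_prop),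
            lintegral_const_mul _ (by fun_prop), e]
      _ ≤ 2 * I 1 + (1 / 2) * I n := by
          rw [← mul_assoc]
          refine add_le_add_right (mul_le_mul' (hb r ⟨hr0, hr.2⟩) (lintegral_mono_set ?_)) _
          rintro s ⟨h1, h2⟩
          have : 0 < r * T := h1.trans h2
          have hT : 0 < T := pos_of_mul_pos_right this hr0.le
          exact ⟨h1, h2.trans (by nlinarith)⟩
  have hbd : ∀ n, I n ≤ 4 * I 1 := by
    intro n
    induction n with
    | zero => simp [I]
    | succ n ih =>
      calc I (n + 1) ≤ 2 * I 1 + (1 / 2) * I n := hstep n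
        _ ≤ 2 * I 1 + (1 / 2) * (4 * I 1) := by gcongr
        _ = 4 * I 1 := by
          have h4 : (1 / 2 : ℝ≥0∞) * 4 = 2 := by
            rw [show (4 : ℝ≥0∞) = 2 * 2 by norm_num, ← mul_assoc, one_div,
              ENNReal.inv_mul_cancel (by norm_num) (by norm_num), one_mul]
          rw [← mul_assoc, h4, ← add_mul]; norm_num
  refine lt_of_le_of_lt (lintegral_le_of_tendsto (C := 4 * I 1)
    (F := fun n t => ‖f t - f (r ^ n * t)‖ₑ ^ 2 * ‖t‖ₑ ^ (-(2 * θ))) (fun n => by fun_prop) ?_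
    hbd) (ENNReal.mul_lt_top (by norm_num) hI1)
  filter_upwards [ae_restrict_mem measurableSet_Ioo] with t ht
  have h1 : Filter.Tendsto (fun n : ℕ => r ^ n * t) Filter.atTop (nhdsWithin 0 (Ioo 0 T)) := by
    rw [tendsto_nhdsWithin_iff]
    refine ⟨?_, .of_forall fun n => ⟨by have := ht.1; positivity, ?_⟩⟩
    · simpa using (tendsto_pow_atTop_nhds_zero_of_lt_one hr0.le hr1).mul_const t
    · have := pow_le_one₀ hr0.le hr1.le (n := n)
      nlinarith [ht.1, ht.2]
  have h2 : Filter.Tendsto (fun n : ℕ => ‖f t - f (r ^ n * t)‖ₑ ^ 2) Filter.atTop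
      (nhds (‖f t‖ₑ ^ 2)) := by
    have h3 := (h0.comp h1).const_sub (f t)
    rw [sub_zero] at h3
    exact ((ENNReal.continuous_pow 2).tendsto _).comp h3.enorm
  refine ENNReal.Tendsto.mul_const h2 (Or.inr ?_)
  rw [enorm_rpow_of_pos ht.1]; exact ENNReal.ofReal_ne_top

/-- Hardy's inequality for `θ < 1/2`: compare `f(t)` with `f(r t)` for a large `r` and absorb. -/
theorem hardy_of_lt_half {T θ : ℝ} (hθ0 : 0 < θ) (hθ : θ < 1 / 2) {f : ℝ → ℝ} (hf : Measurable f)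
    (hf2 : MemLp f 2 (vol T)) (h : gag θ (Ioo 0 T) f < ⊤) :
    ∫⁻ t in Ioo 0 T, ‖f t‖ₑ ^ 2 * ‖t‖ₑ ^ (-(2 * θ)) < ⊤ := by
  rcases le_or_gt T 0 with hT | hT
  · simp [Ioo_eq_empty (not_lt.2 hT)]
  obtain ⟨b, hb0, hb1, hb⟩ := exists_dilation_small (p := 1 - 2 * θ) (by linarith)
  obtain ⟨r, hr, hfin⟩ := exists_dilation hθ0 (lt_add_one b⁻¹) hf h
  have hr0 : 0 < r := (inv_pos.2 hb0).trans hr.1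
  have hr1 : 1 < r := ((one_lt_inv₀ hb0).2 hb1).trans hr.1
  have hrb : 2 * ‖r‖ₑ ^ (2 * θ - 1) ≤ 1 / 2 := by
    have h1 := hb r⁻¹ ⟨inv_pos.2 hr0, inv_lt_of_inv_lt₀ hb0 hr.1⟩
    rw [enorm_inv hr0.ne', ENNReal.inv_rpow, ← ENNReal.rpow_neg] at h1
    rwa [neg_sub] at h1
  have hw : ∀ {x t : ℝ}, 0 < x → x ≤ t → ‖t‖ₑ ^ (-(2 * θ)) ≤ ‖x‖ₑ ^ (-(2 * θ)) := by
    intro x t hx hxt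
    exact enorm_rpow_antitone (by rwa [abs_of_pos hx, abs_of_pos (hx.trans_le hxt)]) (by linarith)
  have hwt : ∀ {x : ℝ}, 0 < x → ‖x‖ₑ ^ (-(2 * θ)) ≠ ⊤ := fun hx => by
    rw [enorm_rpow_of_pos hx]; exact ENNReal.ofReal_ne_top
  have hL := (memLp_two_iff.1 hf2).2
  set I := ∫⁻ t in Ioo 0 T, (Ioo 0 T).indicator (fun s => ‖f t - f s‖ₑ ^ 2) (r * t) *
    ‖t‖ₑ ^ (-(2 * θ)) with hI
  set L := ‖T / r‖ₑ ^ (-(2 * θ)) * ∫⁻ t in Ioo 0 T, ‖f t‖ₑ ^ 2 with hLdef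
  have hLtop : L < ⊤ := ENNReal.mul_lt_top (hwt (div_pos hT hr0)).lt_top hL
  have hTr : T / r < T := div_lt_self hT hr1
  let X : ℝ → ℝ≥0∞ := fun ε => ∫⁻ t in Ioo ε T, ‖f t‖ₑ ^ 2 * ‖t‖ₑ ^ (-(2 * θ))
  have hX : ∀ ε, 0 < ε → X ε ≤ 2 * (2 * I + L) := by
    intro ε hε
    have hXfin : X ε < ⊤ := by
      calc X ε ≤ ∫⁻ t in Ioo ε T, ‖ε‖ₑ ^ (-(2 * θ)) * ‖f t‖ₑ ^ 2 := by
            refine setLIntegral_mono' measurableSet_Ioo fun t ht => ?_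
            rw [mul_comm]
            exact mul_le_mul' (hw hε ht.1.le) le_rfl
        _ ≤ ∫⁻ t in Ioo 0 T, ‖ε‖ₑ ^ (-(2 * θ)) * ‖f t‖ₑ ^ 2 :=
            lintegral_mono_set (Ioo_subset_Ioo_left hε.le)
        _ < ⊤ := by
            rw [lintegral_const_mul' _ _ (hwt hε)]
            exact ENNReal.mul_lt_top (hwt hε).lt_top hL
    have h1 : X ε ≤ (∫⁻ t in Ioo ε (T / r), ‖f t‖ₑ ^ 2 * ‖t‖ₑ ^ (-(2 * θ))) + L := by
      calc X ε ≤ (∫⁻ t in Ioo ε (T / r), ‖f t‖ₑ ^ 2 * ‖t‖ₑ ^ (-(2 * θ))) +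
            ∫⁻ t in Ico (T / r) T, ‖f t‖ₑ ^ 2 * ‖t‖ₑ ^ (-(2 * θ)) := by
            refine le_trans (lintegral_mono_set ?_) (lintegral_union_le _ _ _)
            intro t ht
            rcases lt_or_ge t (T / r) with h' | h'
            · exact Or.inl ⟨ht.1, h'⟩
            · exact Or.inr ⟨h', ht.2⟩
        _ ≤ _ := by
            gcongr
            calc _ ≤ ∫⁻ t in Ico (T / r) T, ‖T / r‖ₑ ^ (-(2 * θ)) * ‖f t‖ₑ ^ 2 := by
                  refine setLIntegral_mono' measurableSet_Ico fun t ht => ?_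
                  rw [mul_comm]
                  exact mul_le_mul' (hw (div_pos hT hr0) ht.1) le_rfl
              _ ≤ ∫⁻ t in Ioo 0 T, ‖T / r‖ₑ ^ (-(2 * θ)) * ‖f t‖ₑ ^ 2 :=
                  lintegral_mono_set fun t ht => ⟨(div_pos hT hr0).trans_le ht.1, ht.2⟩
              _ = L := by rw [lintegral_const_mul' _ _ (hwt (div_pos hT hr0))]
    have h2 : ∫⁻ t in Ioo ε (T / r), ‖f t‖ₑ ^ 2 * ‖t‖ₑ ^ (-(2 * θ)) ≤ 2 * I + (1 / 2) * X ε := by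
      have hm : Measurable fun s => ‖f s‖ₑ ^ 2 := by fun_prop
      have e := setLIntegral_comp_mul_left_weight (x := ε) (y := T / r) (p := -(2 * θ)) hr0 hm
      have e2 : -(1 + -(2 * θ)) = 2 * θ - 1 := by ring
      rw [e2, mul_div_cancel₀ T hr0.ne'] at e
      calc _ ≤ ∫⁻ t in Ioo ε (T / r), (2 * ((Ioo 0 T).indicator (fun s => ‖f t - f s‖ₑ ^ 2) (r * t) *
              ‖t‖ₑ ^ (-(2 * θ))) + 2 * (‖f (r * t)‖ₑ ^ 2 * ‖t‖ₑ ^ (-(2 * θ)))) := by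
            refine setLIntegral_mono' measurableSet_Ioo fun t ht => ?_
            have ht0 : 0 < t := hε.trans ht.1
            have hmem : r * t ∈ Ioo 0 T := ⟨mul_pos hr0 ht0, by
              have := (lt_div_iff₀ hr0).1 ht.2; linarith⟩
            rw [indicator_of_mem hmem]
            calc _ = ‖(f t - f (r * t)) + f (r * t)‖ₑ ^ 2 * ‖t‖ₑ ^ (-(2 * θ)) := by
                  rw [sub_add_cancel]
              _ ≤ (2 * ‖f t - f (r * t)‖ₑ ^ 2 + 2 * ‖f (r * t)‖ₑ ^ 2) * ‖t‖ₑ ^ (-(2 * θ)) := by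
                  gcongr; exact enorm_add_sq_le _ _
              _ = _ := by ring
        _ = 2 * (∫⁻ t in Ioo ε (T / r), (Ioo 0 T).indicator (fun s => ‖f t - f s‖ₑ ^ 2) (r * t) *
              ‖t‖ₑ ^ (-(2 * θ))) + 2 * (‖r‖ₑ ^ (2 * θ - 1) *
              ∫⁻ s in Ioo (r * ε) T, ‖f s‖ₑ ^ 2 * ‖s‖ₑ ^ (-(2 * θ))) := by
            rw [lintegral_add_right _ (by fun_prop), lintegral_const_mul' _ _ (by norm_num),
              lintegral_const_mul _ (by fun_prop), e]
        _ ≤ _ := by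
            rw [← mul_assoc 2 (‖r‖ₑ ^ (2 * θ - 1))]
            refine add_le_add (mul_le_mul_right (lintegral_mono_set ?_) _)
              (mul_le_mul' hrb (lintegral_mono_set ?_))
            · exact fun t ht => ⟨hε.trans ht.1, ht.2.trans hTr⟩
            · exact fun t ht => ⟨by nlinarith [ht.1], ht.2⟩
    have h3 : X ε ≤ (2 * I + L) + X ε / 2 := by
      calc X ε ≤ _ := h1
        _ ≤ 2 * I + (1 / 2) * X ε + L := by gcongr
        _ = _ := by rw [one_div, div_eq_mul_inv, mul_comm (X ε)]; ring
    -- absorb the last term, which is finite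
    have h4 : X ε / 2 ≤ 2 * I + L := by
      have h5 : X ε / 2 + X ε / 2 ≤ (2 * I + L) + X ε / 2 := by rwa [ENNReal.add_halves]
      exact (ENNReal.add_le_add_iff_right (ENNReal.div_ne_top hXfin.ne (by norm_num))).1 h5
    calc X ε = 2 * (X ε / 2) := (ENNReal.mul_div_cancel (by norm_num) (by norm_num)).symm
      _ ≤ _ := by gcongr
  refine lt_of_le_of_lt (lintegral_le_of_tendsto (C := 2 * (2 * I + L))
    (F := fun n => (Ioo (1 / ((n : ℝ) + 1)) T).indicator
      fun t => ‖f t‖ₑ ^ 2 * ‖t‖ₑ ^ (-(2 * θ))) (fun n => ?_) ?_ fun n => ?_) ?_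
  · exact Measurable.indicator (by fun_prop) measurableSet_Ioo
  · filter_upwards [ae_restrict_mem measurableSet_Ioo] with t ht
    refine tendsto_const_nhds.congr' ?_
    filter_upwards [(tendsto_one_div_add_atTop_nhds_zero_nat (𝕜 := ℝ)).eventually_lt_const ht.1]
      with n hn
    rw [indicator_of_mem (show t ∈ Ioo (1 / ((n : ℝ) + 1)) T from ⟨hn, ht.2⟩)]
  · rw [setLIntegral_indicator measurableSet_Ioo]
    exact (lintegral_mono_set inter_subset_left).trans (hX _ (by positivity))
  · exact ENNReal.mul_lt_top (by norm_num)
      (ENNReal.add_lt_top.2 ⟨ENNReal.mul_lt_top (by norm_num) hfin, hLtop⟩)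

/-- Functions in `H_θ(0, T)` are square integrable with the weight `t^(-2θ)`. -/
theorem MemHFrac.lintegral_weight_lt_top {T θ : ℝ} (hT : 0 < T) (hθ0 : 0 < θ) {f : ℝ → ℝ}
    (hf : MemHFrac T θ f) : ∫⁻ t in Ioo 0 T, ‖f t‖ₑ ^ 2 * ‖t‖ₑ ^ (-(2 * θ)) < ⊤ := by
  obtain ⟨h1, h2, h3, h4⟩ := hf
  have hg := (memSlobodeckij_iff.1 (h2 hθ0)).2
  have hcongr : ∀ {k : ℝ → ℝ}, f =ᵐ[vol T] k →
      ∫⁻ t in Ioo 0 T, ‖k t‖ₑ ^ 2 * ‖t‖ₑ ^ (-(2 * θ)) < ⊤ →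
      ∫⁻ t in Ioo 0 T, ‖f t‖ₑ ^ 2 * ‖t‖ₑ ^ (-(2 * θ)) < ⊤ := by
    intro k e hk
    refine lt_of_eq_of_lt (lintegral_congr_ae ?_) hk
    filter_upwards [e] with t ht
    rw [ht]
  rcases lt_trichotomy θ (1 / 2) with h | h | h
  · obtain ⟨k, hk, e⟩ := h1.aestronglyMeasurable
    exact hcongr e (hardy_of_lt_half hθ0 h hk.measurable ((memLp_congr_ae e).1 h1)
      ((gag_congr_ae e) ▸ hg))
  · have := h3 h
    rw [lintegral_weight_half_eq] at this
    rwa [h]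
  · obtain ⟨k, hk, e, hk0⟩ := h4 h
    have e' : f =ᵐ[vol T] (Icc 0 T).indicator k := by
      filter_upwards [e, ae_restrict_mem measurableSet_Ioo] with t ht htm
      rw [ht, indicator_of_mem (Ioo_subset_Icc_self htm)]
    refine hcongr e' (hardy_of_half_lt h ?_ ((gag_congr_ae e') ▸ hg) ?_)
    · classical
      rw [← piecewise_eq_indicator]
      exact hk.measurable_piecewise continuousOn_const measurableSet_Icc
    · have h5 := (hk 0 (left_mem_Icc.2 hT.le)).mono Ioo_subset_Icc_self
      rw [ContinuousWithinAt, hk0] at h5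
      refine h5.congr' ?_
      filter_upwards [self_mem_nhdsWithin] with t ht
      rw [indicator_of_mem (Ioo_subset_Icc_self ht)]

/-! ### Extension to the line -/

/-- The extension of `f` from `(0, T)` to the line: reflected at `T`, and zero outside
`(0, 2T)`. -/
def foldExt (T : ℝ) (f : ℝ → ℝ) (t : ℝ) : ℝ := (Ioo 0 T).indicator f (T - |T - t|)

theorem foldExt_of_lt {T : ℝ} (f : ℝ → ℝ) {t : ℝ} (ht : t < T) :
    foldExt T f t = (Ioo 0 T).indicator f t := by
  rw [foldExt, abs_of_pos (by linarith)]; congr 1; ring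

theorem foldExt_reflect (T : ℝ) (f : ℝ → ℝ) (t : ℝ) : foldExt T f (2 * T - t) = foldExt T f t := by
  have : T - (2 * T - t) = -(T - t) := by ring
  rw [foldExt, foldExt, this, abs_neg]

theorem measurable_foldExt (T : ℝ) {f : ℝ → ℝ} (hf : Measurable f) : Measurable (foldExt T f) :=
  (hf.indicator measurableSet_Ioo).comp
    (by fun_prop : Measurable fun t : ℝ => T - |T - t|)

theorem foldExt_eq_zero {T : ℝ} (f : ℝ → ℝ) {t : ℝ} (ht : t ∉ Ioo 0 (2 * T)) :
    foldExt T f t = 0 := by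
  refine indicator_of_notMem (fun h => ht ?_) _
  have h2 : |T - t| < T := by linarith [h.1]
  rw [abs_lt] at h2
  exact ⟨by linarith [h2.2], by linarith [h2.1]⟩

theorem lintegral_eq_fold (T : ℝ) (H : ℝ → ℝ≥0∞) :
    ∫⁻ t, H t = (∫⁻ t in Iio T, H t) + ∫⁻ t in Iio T, H (2 * T - t) := by
  have h1 : ∫⁻ t in Iio T, H (2 * T - t) = ∫⁻ t in Ioi T, H t := by
    rw [← lintegral_indicator measurableSet_Iio, ← lintegral_indicator measurableSet_Ioi,
      ← lintegral_sub_left_eq_self ((Ioi T).indicator H) (2 * T)]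
    refine lintegral_congr fun t => ?_
    by_cases ht : t < T
    · rw [indicator_of_mem (by exact ht), indicator_of_mem (by rw [mem_Ioi]; linarith)]
    · rw [indicator_of_notMem (by exact ht), indicator_of_notMem (by rw [mem_Ioi]; linarith)]
  rw [h1, ← lintegral_add_compl H (measurableSet_Iic (a := T)), compl_Iic,
    setLIntegral_congr Iio_ae_eq_Iic.symm]

theorem lintegral_foldExt_sq (T : ℝ) (f : ℝ → ℝ) :
    ∫⁻ t, ‖foldExt T f t‖ₑ ^ 2 = 2 * ∫⁻ t in Ioo 0 T, ‖f t‖ₑ ^ 2 := by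
  rw [lintegral_eq_fold T]
  simp_rw [foldExt_reflect]
  rw [← two_mul]
  congr 1
  have h1 : ∫⁻ t in Iio T, ‖foldExt T f t‖ₑ ^ 2
      = ∫⁻ t in Iio T, (Ioo 0 T).indicator (fun t => ‖f t‖ₑ ^ 2) t := by
    refine setLIntegral_congr_fun measurableSet_Iio fun t ht => ?_
    simp only [foldExt_of_lt f (show t < T from ht), indicator]
    split_ifs <;> simp
  rw [h1, setLIntegral_indicator measurableSet_Ioo, inter_eq_left.2 fun t ht => ht.2]

theorem memLp_foldExt {T : ℝ} {f : ℝ → ℝ} (hf : Measurable f) (hf2 : MemLp f 2 (vol T)) :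
    MemLp (foldExt T f) 2 := by
  rw [memLp_two_iff, lintegral_foldExt_sq]
  exact ⟨(measurable_foldExt T hf).aestronglyMeasurable,
    ENNReal.mul_lt_top (by norm_num) (memLp_two_iff.1 hf2).2⟩

theorem integrable_foldExt {T : ℝ} {f : ℝ → ℝ} (hf : Measurable f) (hf2 : MemLp f 2 (vol T)) :
    Integrable (foldExt T f) := by
  have h1 : Integrable (foldExt T f) (volume.restrict (Ioo 0 (2 * T))) :=
    ((memLp_foldExt hf hf2).restrict _).integrable (by norm_num)
  rw [← integrableOn_iff_integrable_of_support_subset (s := Ioo 0 (2 * T))]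
  · exact h1
  · intro t ht
    by_contra hcon
    exact ht (foldExt_eq_zero f hcon)

/-- Folding the line onto a half line contracts distances, so the energy of the extension is
controlled by that of the zero extension to the half line. -/
theorem gag_foldExt_le {T θ : ℝ} (hθ : 0 < θ) {f : ℝ → ℝ} (hf : Measurable f) :
    gag θ univ (foldExt T f) ≤ 4 * gag θ (Iio T) (foldExt T f) := by
  have hF := measurable_foldExt T hf
  set F := foldExt T f
  have hrefl : ∀ t, F (2 * T - t) = F t := foldExt_reflect T f
  set k : ℝ → ℝ → ℝ≥0∞ := fun t s => ‖F t - F s‖ₑ ^ 2 * ‖t - s‖ₑ ^ (-(1 + 2 * θ)) with hk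
  have hk1 : ∀ t < T, ∀ s < T, k t (2 * T - s) ≤ k t s := by
    intro t ht s hs
    simp only [hk, hrefl]
    gcongr ‖F t - F s‖ₑ ^ 2 * ?_
    refine enorm_rpow_antitone ?_ (by linarith)
    rw [abs_of_neg (by linarith : t - (2 * T - s) < 0), abs_le]
    constructor <;> linarith
  have hk2 : ∀ t s, k (2 * T - t) (2 * T - s) = k t s := by
    intro t s
    simp only [hk, hrefl]
    rw [← enorm_neg (t - s)]
    congr 3; ring
  have hk3 : ∀ t < T, ∀ s < T, k (2 * T - t) s ≤ k t s := by
    intro t ht s hs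
    have := hk1 t ht s hs
    rw [← hk2 t (2 * T - s)] at this
    simpa using this
  have hinner : ∀ t < T, ∫⁻ s, k t s ≤ 2 * ∫⁻ s in Iio T, k t s := by
    intro t ht
    rw [lintegral_eq_fold T, two_mul (∫⁻ s in Iio T, k t s)]
    exact add_le_add le_rfl (setLIntegral_mono' measurableSet_Iio fun s hs => hk1 t ht s hs)
  have hinner2 : ∀ t < T, ∫⁻ s, k (2 * T - t) s ≤ 2 * ∫⁻ s in Iio T, k t s := by
    intro t ht
    rw [lintegral_eq_fold T, two_mul (∫⁻ s in Iio T, k t s)]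
    refine add_le_add (setLIntegral_mono' measurableSet_Iio fun s hs => hk3 t ht s hs) ?_
    simp_rw [hk2]; exact le_rfl
  calc gag θ univ F = ∫⁻ t, ∫⁻ s, k t s := by simp only [gag, Measure.restrict_univ, hk]
    _ ≤ (∫⁻ t in Iio T, 2 * ∫⁻ s in Iio T, k t s) + ∫⁻ t in Iio T, 2 * ∫⁻ s in Iio T, k t s := by
        rw [lintegral_eq_fold T]
        exact add_le_add (setLIntegral_mono' measurableSet_Iio hinner)
          (setLIntegral_mono' measurableSet_Iio hinner2)
    _ = 4 * gag θ (Iio T) F := by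
        rw [lintegral_const_mul' _ _ (by norm_num), ← two_mul, ← mul_assoc]
        norm_num [gag, hk]

theorem gag_foldExt_lt_top {T θ : ℝ} (hθ : 0 < θ) {f : ℝ → ℝ} (hf : Measurable f)
    (hg : gag θ (Ioo 0 T) f < ⊤)
    (hw : ∫⁻ t in Ioo 0 T, ‖f t‖ₑ ^ 2 * ‖t‖ₑ ^ (-(2 * θ)) < ⊤) :
    gag θ univ (foldExt T f) < ⊤ := by
  refine (gag_foldExt_le hθ hf).trans_lt (ENNReal.mul_lt_top (by norm_num) ?_)
  have hF := measurable_foldExt T hf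
  have hF1 : ∀ t ∈ Ioo 0 T, foldExt T f t = f t := fun t ht => by
    rw [foldExt_of_lt f ht.2, indicator_of_mem ht]
  have hF0 : ∀ t ∈ Iic (0:ℝ), foldExt T f t = 0 := fun t ht =>
    foldExt_eq_zero f fun h => absurd h.1 (not_lt.2 ht)
  have hg' : gag θ (Ioo 0 T) (foldExt T f) < ⊤ := by
    rwa [gag_congr_ae (g := f)]
    filter_upwards [ae_restrict_mem measurableSet_Ioo] with t ht using hF1 t ht
  set F := foldExt T f
  set k : ℝ → ℝ → ℝ≥0∞ := fun t s => ‖F t - F s‖ₑ ^ 2 * ‖t - s‖ₑ ^ (-(1 + 2 * θ)) with hk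
  have hkm : Measurable (Function.uncurry k) := by
    simp only [hk, Function.uncurry_def]; fun_prop
  have hsplit : ∀ H : ℝ → ℝ≥0∞, ∫⁻ t in Iio T, H t ≤ (∫⁻ t in Iic 0, H t) + ∫⁻ t in Ioo 0 T, H t := by
    intro H
    refine le_trans (lintegral_mono_set fun t ht => ?_) (lintegral_union_le _ _ _)
    rcases le_or_gt t 0 with h | h
    · exact Or.inl h
    · exact Or.inr ⟨h, ht⟩
  have hcross : ∫⁻ t in Ioo 0 T, ∫⁻ s in Iic 0, k t s < ⊤ := by
    have : ∫⁻ t in Ioo 0 T, ∫⁻ s in Iic 0, k t s = ∫⁻ t in Ioo 0 T,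
        ENNReal.ofReal (1 / (2 * θ)) * (‖f t‖ₑ ^ 2 * ‖t‖ₑ ^ (-(2 * θ))) := by
      refine setLIntegral_congr_fun measurableSet_Ioo fun t ht => ?_
      have : ∫⁻ s in Iic 0, k t s = ∫⁻ s in Iic 0, ‖f t‖ₑ ^ 2 * ‖t - s‖ₑ ^ (-(1 + 2 * θ)) := by
        refine setLIntegral_congr_fun measurableSet_Iic fun s hs => ?_
        simp only [hk, hF1 t ht, hF0 s hs, sub_zero]
      simp only [this]
      rw [lintegral_const_mul _ (by fun_prop), setLIntegral_congr Iio_ae_eq_Iic.symm,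
        lintegral_Iio_kernel hθ ht.1]
      ring
    rw [this, lintegral_const_mul' _ _ ENNReal.ofReal_ne_top]
    exact ENNReal.mul_lt_top ENNReal.ofReal_lt_top hw
  have hcross' : ∫⁻ t in Iic 0, ∫⁻ s in Ioo 0 T, k t s < ⊤ := by
    rw [lintegral_lintegral_swap hkm.aemeasurable]
    refine lt_of_eq_of_lt (lintegral_congr fun s => lintegral_congr fun t => ?_) hcross
    simp only [hk]
    rw [← enorm_neg (F t - F s), ← enorm_neg (t - s), neg_sub, neg_sub]
  have hzero : ∫⁻ t in Iic 0, ∫⁻ s in Iic 0, k t s = 0 := by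
    rw [setLIntegral_congr_fun (g := fun _ => 0) measurableSet_Iic, lintegral_zero]
    intro t ht
    beta_reduce
    rw [setLIntegral_congr_fun (g := fun _ => 0) measurableSet_Iic, lintegral_zero]
    intro s hs
    simp [hk, hF0 t ht, hF0 s hs]
  have hmeas1 : Measurable fun t => ∫⁻ s in Iic 0, k t s := hkm.lintegral_prod_right'
  calc gag θ (Iio T) F = ∫⁻ t in Iio T, ∫⁻ s in Iio T, k t s := rfl
    _ ≤ ∫⁻ t in Iio T, ((∫⁻ s in Iic 0, k t s) + ∫⁻ s in Ioo 0 T, k t s) :=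
        lintegral_mono fun t => hsplit _
    _ ≤ (∫⁻ t in Iic 0, ((∫⁻ s in Iic 0, k t s) + ∫⁻ s in Ioo 0 T, k t s)) +
          ∫⁻ t in Ioo 0 T, ((∫⁻ s in Iic 0, k t s) + ∫⁻ s in Ioo 0 T, k t s) := hsplit _
    _ = (0 + ∫⁻ t in Iic 0, ∫⁻ s in Ioo 0 T, k t s) +
          ((∫⁻ t in Ioo 0 T, ∫⁻ s in Iic 0, k t s) + gag θ (Ioo 0 T) F) := by
        rw [lintegral_add_left hmeas1, lintegral_add_left hmeas1, hzero]
        rfl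
    _ < ⊤ := by
        rw [zero_add]
        exact ENNReal.add_lt_top.2 ⟨hcross', ENNReal.add_lt_top.2 ⟨hcross, hg'⟩⟩

/-! ### Functions in the fractional spaces are fractional integrals -/

/-- A function with finite Gagliardo energy of order `θ` on the line becomes weakly differentiable
after a damped fractional integration of order `1 - θ`. -/
theorem exists_weakDeriv_conv {θ : ℝ} (hθ : 0 < θ) (hθ1 : θ < 1) {F : ℝ → ℝ} (hF : Integrable F)
    (hF2 : MemLp F 2) (hg : gag θ univ F < ⊤) :
    ∃ g : ℝ → ℝ, MemLp g 2 ∧ ∀ φ : ℝ → ℝ, ContDiff ℝ ∞ φ → HasCompactSupport φ →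
      ∫ x, φ x * g x = ∫ x, (φ x - deriv φ x) * conv (1 - θ) F x := by
  have h1θ : 0 < 1 - θ := by linarith
  have iΦ := integrable_conv h1θ hF
  have mΦ := memLp_conv h1θ hF hF2
  have iF := integrable_ofReal hF
  have mF := memLp_ofReal hF2
  have hpos : ∀ ξ : ℝ, 0 < ‖(1 + 2 * Real.pi * Complex.I * ξ : ℂ)‖ := fun ξ =>
    norm_pos_iff.2 (one_add_ne_zero ξ)
  have hFm := memLp_fourier iF mF
  have hfin1 := (memLp_two_iff.1 hFm).2
  have hfin2 : ∫⁻ ξ, ‖ξ‖ₑ ^ (2 * θ) * ‖𝓕 (fun t => (F t : ℂ)) ξ‖ₑ ^ 2 < ⊤ := by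
    rw [← gag_ofReal, gag_univ_eq hθ iF mF] at hg
    exact ENNReal.lt_top_of_mul_ne_top_right hg.ne (gagConst_ne_zero θ)
  have hm : MemLp (fun ξ : ℝ => (1 + 2 * Real.pi * Complex.I * ξ) *
      𝓕 (fun t => (conv (1 - θ) F t : ℂ)) ξ) 2 := by
    have e : (fun ξ : ℝ => (1 + 2 * Real.pi * Complex.I * ξ) *
        𝓕 (fun t => (conv (1 - θ) F t : ℂ)) ξ) = fun ξ : ℝ =>
          (1 + 2 * Real.pi * Complex.I * ξ : ℂ) ^ (θ : ℂ) * 𝓕 (fun t => (F t : ℂ)) ξ := by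
      ext ξ
      rw [fourier_conv h1θ hF, ← mul_assoc]
      congr 1
      nth_rw 1 [← Complex.cpow_one (1 + 2 * Real.pi * Complex.I * ξ : ℂ)]
      rw [← Complex.cpow_add _ _ (one_add_ne_zero ξ)]
      congr 1; push_cast; ring
    rw [e, memLp_two_iff]
    refine ⟨(by fun_prop : Measurable fun ξ : ℝ =>
      (1 + 2 * Real.pi * Complex.I * ξ : ℂ) ^ (θ : ℂ)).aestronglyMeasurable.mul hFm.1, ?_⟩
    set C := ENNReal.ofReal ((1 + 2 * Real.pi) ^ (2 * θ)) with hC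
    calc _ ≤ ∫⁻ ξ, C * (‖𝓕 (fun t => (F t : ℂ)) ξ‖ₑ ^ 2 +
            ‖ξ‖ₑ ^ (2 * θ) * ‖𝓕 (fun t => (F t : ℂ)) ξ‖ₑ ^ 2) := by
          refine lintegral_mono fun ξ => ?_
          have hb : ‖(1 + 2 * Real.pi * Complex.I * ξ : ℂ) ^ (θ : ℂ)‖ₑ ^ 2
              ≤ C * (1 + ‖ξ‖ₑ ^ (2 * θ)) := by
            rw [← ofReal_norm (_ ^ (θ : ℂ)), Complex.norm_cpow_real, Real.enorm_eq_ofReal_abs,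
              ENNReal.ofReal_rpow_of_nonneg (abs_nonneg _) (by linarith),
              ← ENNReal.ofReal_pow (by positivity), ← ENNReal.ofReal_one,
              ← ENNReal.ofReal_add (by norm_num) (by positivity),
              ← ENNReal.ofReal_mul (by positivity)]
            refine ENNReal.ofReal_le_ofReal ?_
            rw [← Real.rpow_natCast, ← Real.rpow_mul (hpos ξ).le]
            have e2 : θ * (2 : ℕ) = 2 * θ := by push_cast; ring
            rw [e2]
            have hn : ‖(1 + 2 * Real.pi * Complex.I * ξ : ℂ)‖ ≤ 1 + 2 * Real.pi * |ξ| := by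
              refine (norm_add_le _ _).trans ?_
              simp [abs_of_pos Real.pi_pos]
            have hpi := Real.pi_pos
            have hnn : (0:ℝ) ≤ |ξ| ^ (2 * θ) := by positivity
            rcases le_total |ξ| 1 with h | h
            · calc _ ≤ (1 + 2 * Real.pi) ^ (2 * θ) :=
                    Real.rpow_le_rpow (norm_nonneg _) (hn.trans (by nlinarith)) (by linarith)
                _ ≤ _ := le_mul_of_one_le_right (by positivity) (by linarith)
            · calc _ ≤ ((1 + 2 * Real.pi) * |ξ|) ^ (2 * θ) :=
                    Real.rpow_le_rpow (norm_nonneg _) (hn.trans (by nlinarith)) (by linarith)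
                _ = (1 + 2 * Real.pi) ^ (2 * θ) * |ξ| ^ (2 * θ) :=
                    Real.mul_rpow (by positivity) (abs_nonneg _)
                _ ≤ _ := by gcongr; linarith
          rw [enorm_mul, mul_pow]
          calc _ ≤ C * (1 + ‖ξ‖ₑ ^ (2 * θ)) * ‖𝓕 (fun t => (F t : ℂ)) ξ‖ₑ ^ 2 := by gcongr
            _ = _ := by ring
      _ < ⊤ := by
          rw [lintegral_const_mul' _ _ ENNReal.ofReal_ne_top,
            lintegral_add_left' ((hFm.1.enorm).pow_const 2)]
          exact ENNReal.mul_lt_top ENNReal.ofReal_lt_top (ENNReal.add_lt_top.2 ⟨hfin1, hfin2⟩)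
  obtain ⟨G, hG, hG2⟩ := exists_weakDeriv_of_fourier (integrable_ofReal iΦ) (memLp_ofReal mΦ) hm
  refine ⟨fun x => (G x).re, hG.re, fun φ hφ hφc => ?_⟩
  have h := hG2 φ hφ hφc
  have hi : Integrable fun x => (φ x : ℂ) * G x := by
    refine MemLp.integrable_mul (p := 2) (q := 2) ?_ hG
    exact memLp_ofReal (hφ.continuous.memLp_of_hasCompactSupport hφc)
  have h2 := congrArg Complex.re h
  have e1 : (∫ x, (φ x : ℂ) * G x).re = ∫ x, ((φ x : ℂ) * G x).re := (integral_re hi).symm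
  have e2 : ∫ x, ((φ x - deriv φ x : ℝ) : ℂ) * (conv (1 - θ) F x : ℂ)
      = ((∫ x, (φ x - deriv φ x) * conv (1 - θ) F x : ℝ) : ℂ) := by
    rw [← integral_complex_ofReal]
    exact integral_congr_ae (.of_forall fun x => by simp)
  rw [e1, e2, Complex.ofReal_re] at h2
  simpa using h2

theorem mul_rlIntegral_one {T c t : ℝ} {p' h : ℝ → ℝ} (hp : IntegrableOn p' (Ioo 0 T))
    (hh : IntegrableOn h (Ioo 0 T)) (ht : t ∈ Ioo 0 T) :
    (c + ∫ s in (0:ℝ)..t, p' s) * rlIntegral 1 h t = rlIntegral 1 (fun s =>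
      p' s * rlIntegral 1 h s + (c + ∫ r in (0:ℝ)..s, p' r) * h s) t := by
  have sub : Ioo 0 t ⊆ Ioo 0 T := Ioo_subset_Ioo_right ht.2.le
  have i1 := (intervalIntegrable_iff_integrableOn_Ioo_of_le ht.1.le).2 (hp.mono_set sub)
  have i2 := (intervalIntegrable_iff_integrableOn_Ioo_of_le ht.1.le).2 (hh.mono_set sub)
  have := integral_primitive_mul_primitive (c := c) (d := 0) i1 i2
  simp only [zero_add, mul_zero, sub_zero] at this
  simp only [rlIntegral_one]
  exact this.symm

theorem exp_eq_primitive (t : ℝ) : Real.exp t = 1 + ∫ s in (0:ℝ)..t, Real.exp s := by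
  rw [integral_exp]; simp

/-- `H_θ(0, T)` is contained in the range of `J^θ` on `L²(0, T)`: `J^(1-θ) f` is a primitive of an
`L²` function, because this holds for the extension of the damped function to the line. -/
theorem exists_rlIntegral_of_memHFrac {T θ : ℝ} (hT : 0 < T) (hθ0 : 0 ≤ θ) (hθ1 : θ < 1)
    {f : ℝ → ℝ} (hf : MemHFrac T θ f) :
    ∃ g, MemLp g 2 (vol T) ∧ rlIntegral θ g =ᵐ[vol T] f := by
  rcases hθ0.eq_or_lt with rfl | hθ
  · exact ⟨f, hf.1, by rw [rlIntegral_zero]⟩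
  have h1θ : 0 < 1 - θ := by linarith
  -- the damped function, with a measurable representative
  obtain ⟨K, hK⟩ := lipschitzOnWith_exp_mul T (-1)
  have hf1 := memHFrac_mul hθ1 hf hK
  obtain ⟨f₁, hf₁m, e₁⟩ := hf1.1.aestronglyMeasurable
  have hf₁ := memHFrac_congr_ae e₁ hf1
  have hF2 := memLp_foldExt hf₁m.measurable hf₁.1
  have hF := integrable_foldExt hf₁m.measurable hf₁.1
  have hgag := gag_foldExt_lt_top hθ hf₁m.measurable (memSlobodeckij_iff.1 (hf₁.2.1 hθ)).2
    (hf₁.lintegral_weight_lt_top hT hθ)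
  have hF0 : ∀ t ≤ 0, foldExt T f₁ t = 0 := fun t ht =>
    foldExt_eq_zero f₁ fun h => absurd h.1 (not_lt.2 ht)
  obtain ⟨g, hg, hweak⟩ := exists_weakDeriv_conv hθ hθ1 hF hF2 hgag
  set Φ := conv (1 - θ) (foldExt T f₁) with hΦ
  have hΦi : Integrable Φ := integrable_conv h1θ hF
  have hΦ2 : MemLp Φ 2 := memLp_conv h1θ hF hF2
  have hΦ0 : ∀ t ≤ 0, Φ t = 0 := fun t ht => conv_eq_zero_of_nonpos _ hF0 ht
  have hh2 : MemLp (fun t => g t - Φ t) 2 := hg.sub hΦ2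
  have hhi : ∀ a b : ℝ, IntegrableOn (fun t => g t - Φ t) (Ioo a b) := fun a b =>
    (hh2.restrict (Ioo a b)).integrable (by norm_num)
  have hhii : ∀ a b : ℝ, IntervalIntegrable (fun t => g t - Φ t) volume a b := fun a b =>
    ⟨(hh2.restrict (Ioc a b)).integrable (by norm_num),
      (hh2.restrict (Ioc b a)).integrable (by norm_num)⟩
  -- `Φ` is a primitive on `(-1, T)`, and it vanishes on `(-1, 0)`
  obtain ⟨c, hc⟩ := exists_ae_eq_primitive (a := -1) (b := T) (by linarith)
    (hΦi.integrableOn.locallyIntegrableOn) (hhi (-1) T) (fun φ hφ hφc hφs => by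
      have h := hweak φ hφ hφc
      have m1 : MemLp φ 2 volume := hφ.continuous.memLp_of_hasCompactSupport hφc
      have m2 : MemLp (deriv φ) 2 volume :=
        (hφ.continuous_deriv (by simp)).memLp_of_hasCompactSupport hφc.deriv
      have i1 : Integrable fun x => φ x * g x := m1.integrable_mul hg
      have i2 : Integrable fun x => φ x * Φ x := m1.integrable_mul hΦ2
      have i3 : Integrable fun x => deriv φ x * Φ x := m2.integrable_mul hΦ2
      have e1 : ∫ t in Ioo (-1) T, Φ t * deriv φ t = ∫ t, deriv φ t * Φ t := by
        rw [setIntegral_eq_integral_of_forall_compl_eq_zero]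
        · exact integral_congr_ae (.of_forall fun t => mul_comm _ _)
        · intro t ht
          rw [image_eq_zero_of_notMem_tsupport fun h => ht (tsupport_deriv_subset_of hφs h),
            mul_zero]
      have e2 : ∫ t in Ioo (-1) T, (g t - Φ t) * φ t = ∫ t, (φ t * g t - φ t * Φ t) := by
        rw [setIntegral_eq_integral_of_forall_compl_eq_zero]
        · exact integral_congr_ae (.of_forall fun t => by ring)
        · intro t ht
          rw [image_eq_zero_of_notMem_tsupport fun h => ht (hφs h), mul_zero]
      have e3 : ∫ x, (φ x - deriv φ x) * Φ x = (∫ x, φ x * Φ x) - ∫ x, deriv φ x * Φ x := by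
        rw [← integral_sub i2 i3]
        exact integral_congr_ae (.of_forall fun t => by ring)
      rw [e3] at h
      rw [e1, e2, integral_sub i1 i2, h]
      ring)
  have hcont : Continuous fun t => c + ∫ s in (-1:ℝ)..t, (g s - Φ s) :=
    continuous_const.add (intervalIntegral.continuous_primitive hhii (-1))
  have hc0 : c + ∫ s in (-1:ℝ)..0, (g s - Φ s) = 0 := by
    have e : (fun t => c + ∫ s in (-1:ℝ)..t, (g s - Φ s)) =ᵐ[volume.restrict (Ioo (-1) 0)]
        fun _ => 0 := by
      filter_upwards [ae_restrict_of_ae_restrict_of_subset (Ioo_subset_Ioo_right hT.le) hc,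
        ae_restrict_mem measurableSet_Ioo] with t ht htm
      rw [← ht, hΦ0 t htm.2.le]
    have h2 := Measure.eqOn_open_of_ae_eq e isOpen_Ioo hcont.continuousOn continuousOn_const
    have h3 := h2.closure hcont continuous_const
    rw [closure_Ioo (by norm_num)] at h3
    exact h3 (right_mem_Icc.2 (by norm_num))
  have hΦJ : Φ =ᵐ[vol T] rlIntegral 1 fun t => g t - Φ t := by
    filter_upwards [ae_restrict_of_ae_restrict_of_subset
      (Ioo_subset_Ioo_left (by norm_num : (-1:ℝ) ≤ 0)) hc] with t ht
    rw [ht, rlIntegral_one, ← intervalIntegral.integral_add_adjacent_intervals (hhii (-1) 0)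
      (hhii 0 t), ← add_assoc, hc0, zero_add]
  -- hence `J^(1-θ) f` is a primitive on `(0, T)`
  set h : ℝ → ℝ := fun t => g t - Φ t with hh
  have hhT : MemLp h 2 (vol T) := hh2.restrict _
  let q : ℝ → ℝ := fun s => Real.exp s * rlIntegral 1 h s + Real.exp s * h s
  have hq : MemLp q 2 (vol T) := by
    have a1 := exp_mul_memLp 1 (memLp_rlIntegral zero_le_one hhT)
    have a2 := exp_mul_memLp 1 hhT
    simp only [one_mul] at a1 a2
    exact a1.add a2
  have hJf : rlIntegral (1 - θ) f =ᵐ[vol T] rlIntegral 1 q := by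
    filter_upwards [hΦJ, ae_restrict_mem measurableSet_Ioo] with t ht htm
    have e3 : conv (1 - θ) (tilt T f) t = Φ t := by
      have e4 : tilt T f =ᵐ[volume] (Ioo 0 T).indicator f₁ := by
        rw [Filter.EventuallyEq, ae_restrict_iff' measurableSet_Ioo] at e₁
        filter_upwards [e₁] with s hs
        by_cases hsm : s ∈ Ioo 0 T
        · rw [tilt, indicator_of_mem hsm, indicator_of_mem hsm, ← hs hsm, neg_one_mul]
        · rw [tilt, indicator_of_notMem hsm, indicator_of_notMem hsm]
      rw [conv_congr_ae e4, hΦ]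
      exact conv_congr_of_le _ (fun s hs => (foldExt_of_lt f₁ hs).symm) htm.2.le
    rw [rlIntegral_eq_conv h1θ.ne' f htm, e3, ht, exp_eq_primitive t,
      mul_rlIntegral_one (Real.continuous_exp.integrableOn_Icc.mono_set Ioo_subset_Icc_self)
        (integrable_of_memLp hhT) htm]
    refine congrArg (fun k => rlIntegral 1 k t) (funext fun s => ?_)
    rw [← exp_eq_primitive s]
  -- apply `J^θ` and differentiate
  refine ⟨q, hq, ?_⟩
  have a1 : rlIntegral 1 f =ᵐ[vol T] rlIntegral 1 (rlIntegral θ q) := by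
    have b1 := rlIntegral_rlIntegral hθ.le h1θ.le hf.1
    have b2 := rlIntegral_rlIntegral hθ.le zero_le_one hq
    have b3 := rlIntegral_rlIntegral zero_le_one hθ.le hq
    rw [add_sub_cancel] at b1
    rw [add_comm] at b3
    exact b1.symm.trans ((rlIntegral_congr_ae hJf).trans (b2.trans b3.symm))
  have d1 := IsWeakDeriv.of_rlIntegral_one hT (integrable_of_memLp hf.1)
  have d2 := IsWeakDeriv.of_rlIntegral_one hT (integrable_of_memLp (memLp_rlIntegral hθ.le hq))
  exact (d2.congr_ae a1.symm Filter.EventuallyEq.rfl).ae_eq d1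

/-! ### The scale of ranges of fractional integrals -/

/-- `f` agrees a.e. on `(0, T)` with the fractional integral of order `γ` of an `L²` function. -/
def MemRL (T γ : ℝ) (f : ℝ → ℝ) : Prop :=
  ∃ g, MemLp g 2 (vol T) ∧ rlIntegral γ g =ᵐ[vol T] f

theorem memHFrac_iff_memRL {T θ : ℝ} (hT : 0 < T) (hθ0 : 0 ≤ θ) (hθ1 : θ < 1) {f : ℝ → ℝ} :
    MemHFrac T θ f ↔ MemRL T θ f :=
  ⟨exists_rlIntegral_of_memHFrac hT hθ0 hθ1,
    fun ⟨_, hg, e⟩ => memHFrac_congr_ae e (memHFrac_rlIntegral hθ0 hθ1 hg)⟩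

/-- Additivity holds almost everywhere only: where the defining integrals diverge they are zero by
convention. -/
theorem rlIntegral_add_ae {T a : ℝ} (ha : 0 ≤ a) {g h : ℝ → ℝ} (hg : MemLp g 2 (vol T))
    (hh : MemLp h 2 (vol T)) :
    rlIntegral a (fun t => g t + h t) =ᵐ[vol T] fun t => rlIntegral a g t + rlIntegral a h t := by
  rcases ha.eq_or_lt with rfl | ha
  · simp [rlIntegral_zero]
  have c1 := (integrable_tilt hg).ae_convolution_exists (ContinuousLinearMap.mul ℝ ℝ)
    (integrable_fker ha)
  have c2 := (integrable_tilt hh).ae_convolution_exists (ContinuousLinearMap.mul ℝ ℝ)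
    (integrable_fker ha)
  filter_upwards [ae_restrict_mem measurableSet_Ioo, ae_restrict_of_ae c1, ae_restrict_of_ae c2]
    with t ht h1 h2
  rw [rlIntegral_eq_conv ha.ne' _ ht, rlIntegral_eq_conv ha.ne' _ ht,
    rlIntegral_eq_conv ha.ne' _ ht, ← mul_add]
  congr 1
  have h1' : Integrable fun s => fker a (t - s) * tilt T g s :=
    h1.congr (.of_forall fun s => mul_comm _ _)
  have h2' : Integrable fun s => fker a (t - s) * tilt T h s :=
    h2.congr (.of_forall fun s => mul_comm _ _)
  unfold conv
  rw [← integral_add h1' h2']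
  refine integral_congr_ae (.of_forall fun s => ?_)
  simp only [tilt, indicator]
  split_ifs <;> ring

namespace MemRL

variable {T γ δ : ℝ} {f g : ℝ → ℝ}

theorem congr_ae (hf : MemRL T γ f) (e : f =ᵐ[vol T] g) : MemRL T γ g := by
  obtain ⟨k, hk, h⟩ := hf
  exact ⟨k, hk, h.trans e⟩

theorem memLp (hγ : 0 ≤ γ) (hf : MemRL T γ f) : MemLp f 2 (vol T) := by
  obtain ⟨k, hk, h⟩ := hf
  exact (memLp_congr_ae h).1 (memLp_rlIntegral hγ hk)

theorem of_rlIntegral (hγ : 0 ≤ γ) (hδ : 0 ≤ δ) (hf : MemRL T δ f) :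
    MemRL T (γ + δ) (rlIntegral γ f) := by
  obtain ⟨k, hk, h⟩ := hf
  exact ⟨k, hk, (rlIntegral_rlIntegral hγ hδ hk).symm.trans (rlIntegral_congr_ae h)⟩

theorem exists_rlIntegral (hγ : 0 ≤ γ) (hδ : 0 ≤ δ) (hf : MemRL T (γ + δ) f) :
    ∃ k, MemRL T δ k ∧ f =ᵐ[vol T] rlIntegral γ k := by
  obtain ⟨k, hk, h⟩ := hf
  exact ⟨rlIntegral δ k, ⟨k, hk, Filter.EventuallyEq.rfl⟩,
    h.symm.trans (rlIntegral_rlIntegral hγ hδ hk).symm⟩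

theorem mono (hγ : 0 ≤ γ) (h : γ ≤ δ) (hf : MemRL T δ f) : MemRL T γ f := by
  obtain ⟨k, hk, e⟩ := hf
  refine ⟨rlIntegral (δ - γ) k, memLp_rlIntegral (by linarith) hk, ?_⟩
  have := rlIntegral_rlIntegral hγ (sub_nonneg.2 h) hk
  rw [add_sub_cancel] at this
  exact this.trans e

theorem add (hγ : 0 ≤ γ) (hf : MemRL T γ f) (hg : MemRL T γ g) :
    MemRL T γ (fun t => f t + g t) := by
  obtain ⟨k, hk, e⟩ := hf
  obtain ⟨l, hl, e'⟩ := hg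
  refine ⟨fun t => k t + l t, hk.add hl, (rlIntegral_add_ae hγ hk hl).trans ?_⟩
  filter_upwards [e, e'] with t h1 h2
  rw [h1, h2]

theorem zero (T γ : ℝ) : MemRL T γ (fun _ => 0) :=
  ⟨fun _ => 0, MemLp.zero, .of_forall fun t => by simp [rlIntegral]⟩

theorem sum {ι : Type*} (hγ : 0 ≤ γ) (s : Finset ι) {F : ι → ℝ → ℝ} (hF : ∀ i, MemRL T γ (F i)) :
    MemRL T γ (fun t => ∑ i ∈ s, F i t) := by
  classical
  induction s using Finset.induction_on with
  | empty => simpa using zero T γ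
  | insert a s ha ih =>
    simp_rw [Finset.sum_insert ha]
    exact (hF a).add hγ ih

end MemRL

theorem isWeakDeriv_rlIntegral_natCast {T : ℝ} (hT : 0 < T) (k : ℕ) {w : ℝ → ℝ}
    (hw : MemLp w 2 (vol T)) : IsWeakDeriv T k (rlIntegral k w) w := by
  induction k generalizing w with
  | zero =>
    rw [Nat.cast_zero, rlIntegral_zero]
    have hi : IntegrableOn w (Ioo 0 T) := integrable_of_memLp hw
    exact IsWeakDeriv.zero hi.locallyIntegrableOn
  | succ k ih =>
    have h1 := rlIntegral_rlIntegral (a := k) (Nat.cast_nonneg k) zero_le_one hw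
    have h2 := ih (memLp_rlIntegral zero_le_one hw)
    rw [Nat.cast_succ]
    exact (h2.congr_ae h1 Filter.EventuallyEq.rfl).succ
      (IsWeakDeriv.of_rlIntegral_one hT (integrable_of_memLp hw))

theorem memHNat_rlIntegral {T : ℝ} (hT : 0 < T) (n : ℕ) {w : ℝ → ℝ} (hw : MemLp w 2 (vol T)) :
    MemHNat T n (rlIntegral n w) := by
  have key : ∀ k ≤ n, IsWeakDeriv T k (rlIntegral n w) (rlIntegral ((n : ℝ) - k) w) := by
    intro k hk
    have hk' : (0:ℝ) ≤ n - k := sub_nonneg.2 (by exact_mod_cast hk)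
    have h1 := rlIntegral_rlIntegral (a := k) (Nat.cast_nonneg k) hk' hw
    rw [add_sub_cancel] at h1
    exact (isWeakDeriv_rlIntegral_natCast hT k (memLp_rlIntegral hk' hw)).congr_ae h1
      Filter.EventuallyEq.rfl
  refine ⟨⟨memLp_rlIntegral (Nat.cast_nonneg n) hw, fun k hk => ⟨_, memLp_rlIntegral
    (sub_nonneg.2 (by exact_mod_cast hk)) hw, key k hk⟩⟩, fun k hk => ⟨_, key k hk.le, ?_⟩⟩
  have hk' : (0:ℝ) ≤ n - k - 1 := by
    have : (k:ℝ) + 1 ≤ n := by exact_mod_cast hk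
    linarith
  have h1 := rlIntegral_rlIntegral zero_le_one hk' hw
  rw [add_sub_cancel] at h1
  exact (hasInitialValue_rlIntegral_one hT
    (integrable_of_memLp (memLp_rlIntegral hk' hw))).congr_ae h1

/-- The vanishing initial values are those of the successive primitives, so `u` is the `k`-fold
primitive of its `k`-th derivative. -/
theorem MemHNat.ae_eq_rlIntegral {T : ℝ} (hT : 0 < T) {n : ℕ} {u : ℝ → ℝ} (hu : MemHNat T n u)
    {k : ℕ} (hk : k ≤ n) {w : ℝ → ℝ} (hw : IsWeakDeriv T k u w) (hw2 : MemLp w 2 (vol T)) :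
    u =ᵐ[vol T] rlIntegral k w := by
  induction k generalizing w with
  | zero =>
    rw [Nat.cast_zero, rlIntegral_zero]
    exact (IsWeakDeriv.zero hw.1).ae_eq hw
  | succ k ih =>
    obtain ⟨v, hv2, hv⟩ := hu.1.2 k (by omega)
    obtain ⟨v', hv', h0⟩ := hu.2 k (by omega)
    have e1 := (hv.of_succ hw).ae_eq_rlIntegral_one hT (integrable_of_memLp hw2)
      (h0.congr_ae (hv'.ae_eq hv))
    have e2 := ih (by omega) hv hv2
    rw [Nat.cast_succ]
    exact e2.trans ((rlIntegral_congr_ae e1).trans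
      (rlIntegral_rlIntegral (Nat.cast_nonneg k) zero_le_one hw2))

/-- The space `H_γ(0, T)` is the range of `J^γ` on `L²(0, T)`. -/
theorem memH_iff_memRL {T γ : ℝ} (hT : 0 < T) (hγ : 0 ≤ γ) {u : ℝ → ℝ} :
    MemH T γ u ↔ MemRL T γ u := by
  have hfl : (⌊γ⌋₊ : ℝ) + Int.fract γ = γ := by
    rw [natCast_floor_eq_intCast_floor hγ, Int.floor_add_fract]
  have hθ0 := Int.fract_nonneg γ
  have hθ1 := Int.fract_lt_one γ
  constructor
  · rintro ⟨h1, w, hw, hwθ⟩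
    have e := h1.ae_eq_rlIntegral hT le_rfl hw hwθ.1
    have h2 := ((memHFrac_iff_memRL hT hθ0 hθ1).1 hwθ).of_rlIntegral (Nat.cast_nonneg ⌊γ⌋₊) hθ0
    rw [hfl] at h2
    exact h2.congr_ae e.symm
  · intro h
    rw [← hfl] at h
    obtain ⟨w, hw, e⟩ := h.exists_rlIntegral (Nat.cast_nonneg _) hθ0
    have hw2 := hw.memLp hθ0
    obtain ⟨⟨h1, h2⟩, h3⟩ := memHNat_rlIntegral hT ⌊γ⌋₊ hw2
    refine ⟨⟨⟨(memLp_congr_ae e.symm).1 h1, fun j hj => ?_⟩, fun k hk => ?_⟩, w,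
      (isWeakDeriv_rlIntegral_natCast hT _ hw2).congr_ae e.symm Filter.EventuallyEq.rfl,
      (memHFrac_iff_memRL hT hθ0 hθ1).2 hw⟩
    · obtain ⟨v, hv, hv'⟩ := h2 j hj
      exact ⟨v, hv, hv'.congr_ae e.symm Filter.EventuallyEq.rfl⟩
    · obtain ⟨v, hv, hv'⟩ := h3 k hk
      exact ⟨v, hv.congr_ae e.symm Filter.EventuallyEq.rfl, hv'⟩

/-! ### Multiplication by Sobolev functions -/

theorem MemSobolev.mono {T : ℝ} {k l : ℕ} {p : ℝ≥0∞} {u : ℝ → ℝ} (h : MemSobolev T k p u)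
    (hl : l ≤ k) : MemSobolev T l p u := ⟨h.1, fun j hj => h.2 j (hj.trans hl)⟩

/-- The weak derivative of a `W^{k+1,p}` function is in `W^{k,p}`: test the higher derivatives against
derivatives of test functions. -/
theorem MemSobolev.exists_deriv {T : ℝ} {k : ℕ} {p : ℝ≥0∞} {u : ℝ → ℝ}
    (h : MemSobolev T (k + 1) p u) : ∃ v, IsWeakDeriv T 1 u v ∧ MemSobolev T k p v := by
  obtain ⟨v, hv, hv'⟩ := h.2 1 (by omega)
  refine ⟨v, hv', hv, fun j hj => ?_⟩
  obtain ⟨w, hw, hw'⟩ := h.2 (j + 1) (by omega)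
  refine ⟨w, hw, hv'.2.1, hw'.2.1, fun φ hφ hφc hφs => ?_⟩
  have hj : ∀ j : ℕ, ContDiff ℝ ∞ (iteratedDeriv j φ) ∧ HasCompactSupport (iteratedDeriv j φ) ∧
      tsupport (iteratedDeriv j φ) ⊆ Ioo 0 T := by
    intro j
    induction j with
    | zero => simpa using ⟨hφ, hφc, hφs⟩
    | succ j ih =>
      rw [iteratedDeriv_succ]
      exact ⟨(contDiff_infty_iff_deriv.1 ih.1).2, ih.2.1.deriv, tsupport_deriv_subset_of ih.2.2⟩
  obtain ⟨a1, a2, a3⟩ := hj j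
  have e1 := hv'.2.2 _ a1 a2 a3
  have e2 := hw'.2.2 φ hφ hφc hφs
  rw [iteratedDeriv_one, ← iteratedDeriv_succ, e2, pow_one, pow_succ] at e1
  linarith

theorem lipschitzOnWith_primitive {T c : ℝ} {g : ℝ → ℝ} (hg : MemLp g ⊤ (vol T)) :
    ∃ K : NNReal, LipschitzOnWith K (fun t => c + ∫ s in (0:ℝ)..t, g s) (Icc 0 T) := by
  set C : ℝ := (eLpNorm g ⊤ (vol T)).toReal with hC
  have hb : ∀ᵐ x ∂(volume.restrict (Ioc 0 T)), ‖g x‖ ≤ C := by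
    rw [restrict_Ioo_eq_restrict_Ioc.symm]
    have h := ae_le_eLpNormEssSup (f := g) (μ := vol T)
    filter_upwards [h] with x hx
    rw [← eLpNorm_exponent_top] at hx
    simpa [hC] using ENNReal.toReal_mono hg.2.ne hx
  have hgi : IntegrableOn g (Ioo 0 T) := hg.integrable le_top
  have hii : ∀ t ∈ Icc 0 T, IntervalIntegrable g volume 0 t := by
    intro t ht
    rw [intervalIntegrable_iff_integrableOn_Ioo_of_le ht.1]
    exact hgi.mono_set (Ioo_subset_Ioo_right ht.2)
  refine ⟨C.toNNReal, LipschitzOnWith.of_dist_le_mul fun s hs t ht => ?_⟩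
  rw [Real.coe_toNNReal _ ENNReal.toReal_nonneg, dist_add_left, dist_eq_norm,
    intervalIntegral.integral_interval_sub_left (hii s hs) (hii t ht), Real.dist_eq]
  refine intervalIntegral.norm_integral_le_of_norm_le_const_ae ?_
  rw [ae_restrict_iff' measurableSet_Ioc] at hb
  filter_upwards [hb] with x hx hx'
  refine hx ⟨lt_of_le_of_lt (le_min ht.1 hs.1) hx'.1, hx'.2.trans (max_le ht.2 hs.2)⟩

theorem memRL_mul_of_lt_one {T γ : ℝ} (hT : 0 < T) (hγ : 0 ≤ γ) (hγ1 : γ < 1) {p f : ℝ → ℝ}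
    (hp : MemSobolev T ⌈γ⌉₊ ⊤ p) (hf : MemRL T γ f) : MemRL T γ (fun t => p t * f t) := by
  rcases hγ.eq_or_lt with rfl | hγ
  · refine ⟨fun t => p t * f t, ?_, by rw [rlIntegral_zero]⟩
    exact MemLp.mul (p := ⊤) (q := 2) (r := 2) (hf.memLp le_rfl) hp.1
  · have h1 : ⌈γ⌉₊ = 0 + 1 := by
      rw [Nat.ceil_eq_iff (by norm_num)]; constructor <;> norm_num <;> linarith
    rw [h1] at hp
    obtain ⟨v, hv, hv'⟩ := hp.exists_deriv
    have hvi : IntegrableOn v (Ioo 0 T) := hv'.1.integrable le_top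
    obtain ⟨c, hc⟩ := hv.exists_ae_eq_primitive hT hvi
    obtain ⟨K, hK⟩ := lipschitzOnWith_primitive (c := c) hv'.1
    have := memHFrac_mul hγ1 ((memHFrac_iff_memRL hT hγ.le hγ1).2 hf) hK
    refine ((memHFrac_iff_memRL hT hγ.le hγ1).1 this).congr_ae ?_
    filter_upwards [hc] with t ht
    rw [ht]

/-- Multiplication by a function in `W^{⌈γ⌉,∞}` preserves the range of `J^γ`. -/
theorem memRL_mul {T γ : ℝ} (hT : 0 < T) (hγ : 0 ≤ γ) {p f : ℝ → ℝ}
    (hp : MemSobolev T ⌈γ⌉₊ ⊤ p) (hf : MemRL T γ f) : MemRL T γ (fun t => p t * f t) := by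
  obtain ⟨n, hn⟩ : ∃ n : ℕ, γ < n + 1 := by
    obtain ⟨n, hn⟩ := exists_nat_gt γ
    exact ⟨n, by linarith⟩
  induction n generalizing γ p f with
  | zero => exact memRL_mul_of_lt_one hT hγ (by simpa using hn) hp hf
  | succ n ih =>
    rcases lt_or_ge γ 1 with h1 | h1
    · exact memRL_mul_of_lt_one hT hγ h1 hp hf
    have hγ' : 0 ≤ γ - 1 := by linarith
    have hn' : γ - 1 < n + 1 := by push_cast at hn; linarith
    have hceil : ⌈γ⌉₊ = ⌈γ - 1⌉₊ + 1 := by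
      rw [← Nat.ceil_add_one hγ', sub_add_cancel]
    obtain ⟨p', hp1, hp'⟩ := (hceil ▸ hp).exists_deriv
    have hpi : IntegrableOn p' (Ioo 0 T) := hp'.1.integrable le_top
    obtain ⟨c, hc⟩ := hp1.exists_ae_eq_primitive hT hpi
    obtain ⟨f₁, hf₁, e⟩ := MemRL.exists_rlIntegral (γ := 1) (δ := γ - 1) zero_le_one hγ'
      (by rwa [add_sub_cancel])
    have m1 : MemRL T (γ - 1) (fun t => p' t * f t) := ih hγ' hp' (hf.mono hγ' (by linarith)) hn'
    have m2 : MemRL T (γ - 1) (fun t => p t * f₁ t) := ih hγ' (hp.mono (by omega)) hf₁ hn'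
    have m3 := (m1.add hγ' m2).of_rlIntegral zero_le_one hγ'
    rw [add_sub_cancel] at m3
    have e2 : rlIntegral 1 (fun t => p' t * f t + p t * f₁ t) =ᵐ[vol T] rlIntegral 1 (fun s =>
        p' s * rlIntegral 1 f₁ s + (c + ∫ r in (0:ℝ)..s, p' r) * f₁ s) := by
      refine rlIntegral_congr_ae ?_
      filter_upwards [e, hc] with t h2 h3
      rw [h2, h3]
    refine m3.congr_ae (e2.trans ?_)
    filter_upwards [e, hc, ae_restrict_mem measurableSet_Ioo] with t h2 h3 ht
    rw [← mul_rlIntegral_one hpi (integrable_of_memLp (hf₁.memLp hγ')) ht, h2, h3]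

/-! ### Regularity of solutions -/

/-- Every application of the equation `v = J^α (P v + G)` raises the order of `v` by `α`, up to
the limit `α + β` set by the data. -/
theorem memRL_of_integral_equation {ι : Type*} [Fintype ι] {T α β : ℝ} (hT : 0 < T) (hα : 0 < α)
    (hβ : 0 ≤ β) {P : ι → ι → ℝ → ℝ} {v G : ι → ℝ → ℝ}
    (hP : ∀ i j, MemSobolev T ⌈β⌉₊ ⊤ (P i j)) (hv : ∀ i, MemRL T 0 (v i))
    (hG : ∀ i, MemRL T β (G i))
    (heq : ∀ i, rlIntegral α (fun t => (∑ j, P i j t * v j t) + G i t) =ᵐ[vol T] v i) (i : ι) :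
    MemRL T (α + β) (v i) := by
  have step : ∀ γ, 0 ≤ γ → γ ≤ β → (∀ i, MemRL T γ (v i)) → ∀ i, MemRL T (α + γ) (v i) := by
    intro γ hγ hγβ h i
    have h1 : MemRL T γ (fun t => (∑ j, P i j t * v j t) + G i t) :=
      MemRL.add hγ (MemRL.sum hγ _ fun j => memRL_mul hT hγ
        ((hP i j).mono (Nat.ceil_mono hγβ)) (h j)) ((hG i).mono hγ hγβ)
    exact (h1.of_rlIntegral hα.le hγ).congr_ae (heq i)
  have iter : ∀ n : ℕ, ∀ i, MemRL T (min (n * α) β) (v i) := by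
    intro n
    induction n with
    | zero => simpa [hβ] using hv
    | succ n ih =>
      intro i
      have hn : (0:ℝ) ≤ n * α := by positivity
      refine (step _ (le_min hn hβ) (min_le_right _ _) ih i).mono
        (le_min (by positivity) hβ) ?_
      push_cast
      rcases le_total (n * α) β with h | h
      · rw [min_eq_left h]; exact (min_le_left _ _).trans (by linarith)
      · rw [min_eq_right h]; exact (min_le_right _ _).trans (by linarith)
  obtain ⟨n, hn⟩ := exists_nat_gt (β / α)
  have hn' : β ≤ n * α := ((div_lt_iff₀ hα).1 hn).le
  refine step β hβ le_rfl (fun i => ?_) i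
  have := iter n i
  rwa [min_eq_right hn'] at this

/-- The regularity theorem in terms of `v = u - a₀ - t a₁`, which solves `∂_t^α v = P v + G` with
`G = F + P a₀ + t P a₁`. -/
theorem IsSolution.memH {N : ℕ} {T α β : ℝ} (hT : 0 < T) (hα : 0 < α) (hβ : 0 ≤ β)
    {a₀ a₁ : Fin N → ℝ} {P : ℝ → Matrix (Fin N) (Fin N) ℝ} {F u : ℝ → Fin N → ℝ}
    (hu : IsSolution T α P F a₀ a₁ u) (hP : ∀ i j, MemSobolev T ⌈β⌉₊ ⊤ (fun t => P t i j))
    (hF : ∀ i, MemRL T β (fun t => (F t + P t *ᵥ a₀ + t • (P t *ᵥ a₁)) i)) (i : Fin N) :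
    MemH T (α + β) (fun t => (u t - a₀ - t • a₁) i) := by
  rw [memH_iff_memRL hT (by linarith)]
  refine memRL_of_integral_equation (P := fun i j t => P t i j)
    (v := fun i t => (u t - a₀ - t • a₁) i) hT hα hβ hP
    (fun i => ((memH_iff_memRL hT hα.le).1 (hu.1 i)).mono le_rfl hα.le) hF (fun i => ?_) i
  refine Filter.EventuallyEq.trans (rlIntegral_congr_ae (.of_forall fun t => ?_)) (hu.2 i).2.2
  have h : u t = (u t - a₀ - t • a₁) + a₀ + t • a₁ := by abel
  have h2 : (P t *ᵥ u t) = P t *ᵥ (u t - a₀ - t • a₁) + P t *ᵥ a₀ + t • (P t *ᵥ a₁) := by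
    conv_lhs => rw [h]
    rw [Matrix.mulVec_add, Matrix.mulVec_add, Matrix.mulVec_smul]
  have h3 : ∑ j, P t i j * (u t - a₀ - t • a₁) j = (P t *ᵥ (u t - a₀ - t • a₁)) i := rfl
  simp only [h3]
  rw [h2]
  simp only [Pi.add_apply]
  ring

theorem memRL_one_mul_id {T c : ℝ} (hT : 0 < T) {p : ℝ → ℝ} (hp : MemSobolev T 1 ⊤ p) :
    MemRL T 1 (fun t => p t * (t * c)) := by
  have h : MemRL T 1 (fun t => t * c) :=
    ⟨fun _ => c, memLp_const c, .of_forall fun t => by simp [rlIntegral_one]⟩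
  exact memRL_mul hT zero_le_one (by simpa using hp) h

end

end FracODE

theorem mainTheorem5 {N : ℕ} (T α : ℝ) (hT : 0 < T) (hα : 1 < α) (hα' : α ≤ 2)
    (a₀ a₁ : Fin N → ℝ) (P : ℝ → Matrix (Fin N) (Fin N) ℝ) (F : ℝ → Fin N → ℝ)
    (u : ℝ → Fin N → ℝ) (hu : FracODE.IsSolution T α P F a₀ a₁ u) :
    (∀ β : ℝ, 0 < β →
      (∀ i j, FracODE.MemSobolev T ⌈β⌉₊ ⊤ (fun t => P t i j)) →
      (∀ i, FracODE.MemH T β (fun t => (F t + P t *ᵥ a₀ + t • (P t *ᵥ a₁)) i)) →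
      ∀ i, FracODE.MemH T (α + β) (fun t => (u t - a₀ - t • a₁) i)) ∧
    ((∀ i j, FracODE.MemSobolev T 1 ⊤ (fun t => P t i j)) →
      (∀ i, FracODE.MemH T 1 (fun t => (F t + P t *ᵥ a₀) i)) →
      ∀ i, FracODE.MemH T (α + 1) (fun t => (u t - a₀ - t • a₁) i)) := by
  have hα0 : 0 < α := by linarith
  refine ⟨fun β hβ hP hF => hu.memH hT hα0 hβ.le hP fun i =>
    (FracODE.memH_iff_memRL hT hβ.le).1 (hF i), fun hP hF => ?_⟩
  refine hu.memH hT hα0 zero_le_one (by simpa using hP) fun i => ?_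
  have h1 := (FracODE.memH_iff_memRL hT zero_le_one).1 (hF i)
  have h2 : FracODE.MemRL T 1 (fun t => ∑ j, P t i j * (t * a₁ j)) :=
    FracODE.MemRL.sum zero_le_one _ fun j => FracODE.memRL_one_mul_id hT (hP i j)
  refine (h1.add zero_le_one h2).congr_ae (.of_forall fun t => ?_)
  simp only [Pi.add_apply, Pi.smul_apply, smul_eq_mul, Matrix.mulVec, dotProduct, Finset.mul_sum]
  congr 1
  exact Finset.sum_congr rfl fun j _ => by ring
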